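/- Let $(\Omega,\mathcal F,\mathbb P)$ be a probability space and $\rho$ an integrable random variable on it with $\rho>0$ almost surely and with continuous distribution function $F_\rho$ (that is, $\rho$ is atomless). Let $w:[0,1]\to[0,1]$ be differentiable and strictly increasing with $w(0)=0$ and $w(1)=1$. Let $u:(0,\infty)\to\mathbb R$ be strictly increasing and twice differentiable with $u''<0$, and put $u(0):=\lim_{x\downarrow0}u(x)\in[-\infty,\infty)$. Let $x_0\in\mathbb R$. The quantile function of a random variable $X$ with distribution function $F_X$ is $F_X^{-1}(x)=\sup\{t\in\mathbb R: F_X(t)\le x\}$, $x\in(0,1)$. Let $\mathcal G$ be the set of all increasing right-continuous functions $Q:(0,1)\to[0,\infty)$; these are exactly the quantile functions of nonnegative random variables. Two random variables $X,Y$ are comonotonic if $(X(\omega')-X(\omega))(Y(\omega')-Y(\omega))\ge0$ for $\mathbb P\otimes\mathbb P$-almost all $(\omega,\omega')$. For $x\in[0,1]$ define $$\varphi(x):=-\int_0^{w^{-1}(1-x)}F_\rho^{-1}(y)\,dy,\qquad \delta(x):=\sup_{0\le a\le x\le b\le1,\ a<b}\frac{(b-x)\varphi(a)+(x-a)\varphi(b)}{b-a},$$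 so that $\delta$ is the concave envelope of $\varphi$ on $[0,1]$. Let $\delta'$ be the left derivative of $\delta$ on $(0,1)$ and put $$\widetilde\rho:=\delta'(1-F_\rho(\rho)),$$ which is defined almost surely. Consider the problems $$(\mathrm{RDUT})\qquad \sup_X\int_{[0,\infty)}u(x)\,d\bigl(1-w(1-F_X(x))\bigr)\quad\text{subject to } \mathbb E[\rho X]=x_0,\ X\ge0,$$ $$(\mathrm{EUT})\qquad \sup_X\mathbb E[u(X)]\quad\text{subject to } \mathbb E[\widetilde\rho X]=x_0,\ X\ge0.$$ The integrals of $u$ are extended-real valued, with value $-\infty$ when the positive and the negative part both have infinite integral. An optimal solution of such a problem is a random variable that satisfies the constraints and attains the supremum, the supremum being finite. Then the following hold. 1. $\widetilde\rho$ is a random variable with $\widetilde\rho>0$ almost surely, it is comonotonic with $\rho$, and its quantile function is $F_{\widetilde\rho}^{-1}(x)=\delta'(1-x)$, $x\in(0,1)$. 2. If $\widetilde X^*$ is an optimal solution of (EUT) and $\widetilde Q^*$ is its quantile function, then $$X^*:=\widetilde Q^*\bigl(1-w(F_\rho(\rho))\bigr)$$ is an optimal solution of (RDUT). 3. Conversely,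 if $X^*$ is an optimal solution of (RDUT), then there is a unique $\widetilde Q^*\in\mathcal G$ such that $X^*=\widetilde Q^*\bigl(1-w(F_\rho(\rho))\bigr)$ almost surely. Moreover, for every random variable $U$ on $\Omega$ that is uniformly distributed on $(0,1)$ and comonotonic with $\widetilde\rho$, the random variable $\widetilde Q^*(1-U)$ is an optimal solution of (EUT). -/

import Mathlib

open Set MeasureTheory ProbabilityTheory

namespace RDUT

/-- A probability weighting function: differentiable and strictly increasing on `[0,1]`,
with `w 0 = 0` and `w 1 = 1`.  Values of `w` outside `[0,1]` are irrelevant. -/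
structure IsWeighting (w : ℝ → ℝ) : Prop where
  differentiableOn : DifferentiableOn ℝ w (Icc 0 1)
  strictMonoOn : StrictMonoOn w (Icc 0 1)
  map_zero : w 0 = 0
  map_one : w 1 = 1

/-- A utility function: strictly increasing and twice differentiable on the positive half-line,
with negative second derivative.  Its value at `0` is the limit at `0`, see `utilityExt`. -/
structure IsUtility (u : ℝ → ℝ) : Prop where
  strictMonoOn : StrictMonoOn u (Ioi 0)
  differentiableOn : DifferentiableOn ℝ u (Ioi 0)
  differentiableOn_deriv : DifferentiableOn ℝ (deriv u) (Ioi 0)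
  deriv_deriv_neg : ∀ x, 0 < x → deriv (deriv u) x < 0

open Classical in
/-- The utility as an extended-real function on `[0, ∞)`: `u x` for `x > 0`, and at `0` the
right limit `u(0+) = inf_{y > 0} u y`, which may be `-∞` (logarithmic or power utility). -/
noncomputable def utilityExt (u : ℝ → ℝ) (x : ℝ) : EReal :=
  if 0 < x then (u x : EReal) else ⨅ y : Ioi (0 : ℝ), (u y : EReal)

/-- The integral of an extended-real function, `∫ f⁺ - ∫ f⁻`
(with value `⊥` in the undefined case `∞ - ∞`). -/
noncomputable def extIntegral {α : Type*} [MeasurableSpace α] (m : Measure α) (f : α → EReal) :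
    EReal :=
  ((∫⁻ a, (f a).toENNReal ∂m : ENNReal) : EReal)
    - ((∫⁻ a, (-f a).toENNReal ∂m : ENNReal) : EReal)

/-- The distorted distribution function `x ↦ 1 - w (1 - F x)`, with `F` the cumulative
distribution function of the law `m`. -/
noncomputable def distortedCDF {w : ℝ → ℝ} (hw : IsWeighting w) (m : Measure ℝ) :
    StieltjesFunction ℝ where
  toFun x := 1 - w (1 - cdf m x)
  mono' := by
    intro x y hxy
    have h0 := cdf_nonneg m x
    have h1 := cdf_le_one m x
    have h2 := cdf_nonneg m y
    have h3 := cdf_le_one m y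
    have h4 := monotone_cdf m hxy
    have := hw.strictMonoOn.monotoneOn (a := 1 - cdf m y) (b := 1 - cdf m x)
      ⟨by linarith, by linarith⟩ ⟨by linarith, by linarith⟩ (by linarith)
    linarith
  right_continuous' := by
    intro x
    have hF : ContinuousWithinAt (fun y => 1 - cdf m y) (Ici x) x :=
      continuousWithinAt_const.sub ((cdf m).right_continuous x)
    have hmem : ∀ y, 1 - cdf m y ∈ Icc (0 : ℝ) 1 := fun y =>
      ⟨by linarith [cdf_le_one m y], by linarith [cdf_nonneg m y]⟩
    exact continuousWithinAt_const.sub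
      (ContinuousWithinAt.comp (g := w) (t := Icc 0 1) (hw.differentiableOn.continuousOn _ (hmem x))
        hF (fun y _ => hmem y))

section Problems

variable {Ω : Type*} [MeasurableSpace Ω]

/-- The rank-dependent utility `∫_0^∞ u(x) d(1 - w(1 - F_X(x)))`, a Lebesgue-Stieltjes integral
over `[0, ∞)` (the possible atom at `0` is included). -/
noncomputable def rdu (μ : Measure Ω) (u : ℝ → ℝ) {w : ℝ → ℝ} (hw : IsWeighting w) (X : Ω → ℝ) :
    EReal :=
  extIntegral ((distortedCDF hw (μ.map X)).measure.restrict (Ici 0)) (utilityExt u)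

/-- The expected utility `E[u(X)]`. -/
noncomputable def expectedUtility (μ : Measure Ω) (u : ℝ → ℝ) (X : Ω → ℝ) : EReal :=
  extIntegral μ (fun ω => utilityExt u (X ω))

/-- The constraints `E[κ X] = x₀`, `X ≥ 0` for the pricing kernel `κ`. -/
structure IsFeasible (μ : Measure Ω) (κ : Ω → ℝ) (x₀ : ℝ) (X : Ω → ℝ) : Prop where
  aemeasurable : AEMeasurable X μ
  nonneg : ∀ᵐ ω ∂μ, 0 ≤ X ω
  integrable : Integrable (fun ω => κ ω * X ω) μ
  budget : ∫ ω, κ ω * X ω ∂μ = x₀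

/-- `X` is an optimal solution to: maximise `J` subject to `E[κ X] = x₀`, `X ≥ 0`.
It is feasible and attains the supremum, which is finite. -/
structure IsOptimal (μ : Measure Ω) (κ : Ω → ℝ) (x₀ : ℝ) (J : (Ω → ℝ) → EReal) (X : Ω → ℝ) :
    Prop where
  feasible : IsFeasible μ κ x₀ X
  ne_bot : J X ≠ ⊥
  ne_top : J X ≠ ⊤
  le : ∀ Y, IsFeasible μ κ x₀ Y → J Y ≤ J X

/-- The quantile function `Q(x) = sup {t : F(t) ≤ x}`, `x ∈ (0,1)`, of a random variable. -/
noncomputable def quantile (μ : Measure Ω) (X : Ω → ℝ) (x : ℝ) : ℝ :=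
  sSup {t : ℝ | cdf (μ.map X) t ≤ x}

/-- Two random variables are comonotonic if `(X(ω') - X(ω)) (Y(ω') - Y(ω)) ≥ 0` almost surely
under the product measure. -/
def Comonotonic (μ : Measure Ω) (X Y : Ω → ℝ) : Prop :=
  ∀ᵐ p ∂(μ.prod μ), 0 ≤ (X p.2 - X p.1) * (Y p.2 - Y p.1)

/-- `φ(x) = - ∫_0^{w⁻¹(1 - x)} F_ρ⁻¹(y) dy` for `x ∈ [0,1]`, with `F_ρ⁻¹` the quantile function
of `ρ` and `w⁻¹` the inverse of `w : [0,1] → [0,1]`. -/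
noncomputable def phi (μ : Measure Ω) (ρ : Ω → ℝ) (w : ℝ → ℝ) (x : ℝ) : ℝ :=
  -∫ y in (0 : ℝ)..(Function.invFunOn w (Icc 0 1) (1 - x)), quantile μ ρ y

end Problems

/-- Functions in the class of quantile functions of nonnegative random variables: increasing and
right-continuous maps `(0,1) → [0, ∞)` (left limits exist by monotonicity).  Only the values
on `(0,1)` matter. -/
structure IsQuantileFunction (Q : ℝ → ℝ) : Prop where
  nonneg : ∀ x ∈ Ioo (0 : ℝ) 1, 0 ≤ Q x
  monotoneOn : MonotoneOn Q (Ioo 0 1)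
  rightContinuous : ∀ x ∈ Ioo (0 : ℝ) 1, ContinuousWithinAt Q (Ici x) x

/-- The concave envelope on `[0,1]`:
`sup { ((b - x) f(a) + (x - a) f(b)) / (b - a) : 0 ≤ a ≤ x ≤ b ≤ 1, a < b }`. -/
noncomputable def concaveEnvelope (f : ℝ → ℝ) (x : ℝ) : ℝ :=
  sSup {y : ℝ | ∃ a b : ℝ, 0 ≤ a ∧ a ≤ x ∧ x ≤ b ∧ b ≤ 1 ∧ a < b ∧
    y = ((b - x) * f a + (x - a) * f b) / (b - a)}

/-- The left derivative.  A concave `δ` has one at every interior point, it agrees with `δ'`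
off a countable set, and it is the version for which `x ↦ δ'(1 - x)` is right-continuous. -/
noncomputable def leftDeriv (f : ℝ → ℝ) (x : ℝ) : ℝ :=
  derivWithin f (Iic x) x

/-- `x ↦ δ'(x)`, with `δ` the concave envelope of `φ` on `[0,1]`. -/
noncomputable def deltaDeriv {Ω : Type*} [MeasurableSpace Ω] (μ : Measure Ω) (ρ : Ω → ℝ)
    (w : ℝ → ℝ) : ℝ → ℝ :=
  leftDeriv (concaveEnvelope (phi μ ρ w))

/-- The new pricing kernel `ρ̃ = δ'(1 - F_ρ(ρ))`. -/
noncomputable def newKernel {Ω : Type*} [MeasurableSpace Ω] (μ : Measure Ω) (ρ : Ω → ℝ)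
    (w : ℝ → ℝ) (ω : Ω) : ℝ :=
  deltaDeriv μ ρ w (1 - cdf (μ.map ρ) (ρ ω))

end RDUT

/-! Both problems reduce to one problem about quantile functions `Q` on `(0,1)`, with the same
objective `∫ u(Q(x)) dx` and two different budgets.

In the rank-dependent problem let `G` be the quantile function of `X`, and put `Q(1 - w(y)) = G(1 -
y)`. The distorted law of `X` is then the law of `Q` under Lebesgue measure
(`distortedCDF_measure_eq`). By Hardy-Littlewood the cheapest payoff with the law of `X` is the one
antimonotone to `ρ`, namely `Q(1 - w(F_ρ(ρ)))`, and its cost is `∫ Q dφ` (`phiCost`). In the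
expected-utility problem with kernel `δ'(1 - F_ρ(ρ))` the same argument gives the cost `∫ Q dδ`
(`deltaCost`).

By the layer-cake formula, each budget is the integral over `t > 0` of `-φ` or `-δ` at the point
where `Q` crosses the level `t`. Since `φ ≤ δ`, the second budget is never larger
(`deltaCost_le_phiCost`). They agree when `Q` is constant on the intervals where `δ` is affine:
wherever `φ < δ`, the envelope is locally affine, so no crossing happens there
(`phiCost_eq_deltaCost`). Replacing `Q` by its averages over the level sets of `δ'` makes it
constant on such intervals, preserves `∫ Q dδ`, and by Jensen does not lower the utility
(`exists_leveled`). Hence the two problems have the same value.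

From expected to rank-dependent utility: by strict concavity an optimal `Q` equals its own average
almost everywhere, so its two budgets coincide and it is feasible and optimal for the other problem.
Conversely, a rank-dependent optimum attains the common value at an expected-utility cost of at most
`x₀`. A slack budget could be spent on a positive constant, which strictly raises utility, so the
cost is exactly `x₀`. The same argument shows that the rearranged `X` costs as much as `X`. The
equality case of Hardy-Littlewood, available because `F_ρ⁻¹` is strictly increasing, then identifies
`X`, and right continuity makes `Q` unique. -/

namespace RDUT

/-! ### The concave envelope on the unit interval. -/

section Envelope

open Filter Topology

variable {f : ℝ → ℝ} {M : ℝ}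

/-- This makes the envelope the least concave majorant: a concave function above `f` is above all
the chords whose supremum defines the envelope. -/
theorem chord_le_of_concaveOn {g : ℝ → ℝ} (hg : ConcaveOn ℝ (Icc 0 1) g)
    (hfg : ∀ t ∈ Icc (0 : ℝ) 1, f t ≤ g t) {a x b : ℝ} (ha : 0 ≤ a) (hax : a ≤ x) (hxb : x ≤ b)
    (hb : b ≤ 1) (hab : a < b) : ((b - x) * f a + (x - a) * f b) / (b - a) ≤ g x := by
  have hba : 0 < b - a := by linarith
  have h := hg.2 (show a ∈ Icc (0 : ℝ) 1 from ⟨ha, by linarith⟩)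
    (show b ∈ Icc (0 : ℝ) 1 from ⟨by linarith, hb⟩)
    (show 0 ≤ (b - x) / (b - a) from div_nonneg (by linarith) hba.le)
    (show 0 ≤ (x - a) / (b - a) from div_nonneg (by linarith) hba.le) (by field_simp; ring)
  have hx : (b - x) / (b - a) * a + (x - a) / (b - a) * b = x := by field_simp; ring
  simp only [smul_eq_mul, hx] at h
  have h1 := mul_le_mul_of_nonneg_left (hfg a ⟨ha, by linarith⟩)
    (div_nonneg (by linarith : 0 ≤ b - x) hba.le)
  have h2 := mul_le_mul_of_nonneg_left (hfg b ⟨by linarith, hb⟩)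
    (div_nonneg (by linarith : 0 ≤ x - a) hba.le)
  calc _ = (b - x) / (b - a) * f a + (x - a) / (b - a) * f b := by field_simp
    _ ≤ _ := by linarith

theorem chord_le_concaveEnvelope (hM : ∀ t ∈ Icc (0 : ℝ) 1, f t ≤ M) {a x b : ℝ} (ha : 0 ≤ a)
    (hax : a ≤ x) (hxb : x ≤ b) (hb : b ≤ 1) (hab : a < b) :
    ((b - x) * f a + (x - a) * f b) / (b - a) ≤ concaveEnvelope f x := by
  refine le_csSup ⟨M, ?_⟩ ⟨a, b, ha, hax, hxb, hb, hab, rfl⟩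
  rintro y ⟨a, b, ha, hax, hxb, hb, hab, rfl⟩
  exact chord_le_of_concaveOn (g := fun _ => M) (concaveOn_const M (convex_Icc 0 1)) hM ha hax hxb
    hb hab

theorem concaveEnvelope_le {x y : ℝ} (hx : x ∈ Icc (0 : ℝ) 1)
    (h : ∀ a b : ℝ, 0 ≤ a → a ≤ x → x ≤ b → b ≤ 1 → a < b →
      ((b - x) * f a + (x - a) * f b) / (b - a) ≤ y) : concaveEnvelope f x ≤ y := by
  refine csSup_le ⟨_, 0, 1, le_rfl, hx.1, hx.2, le_rfl, zero_lt_one, rfl⟩ ?_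
  rintro z ⟨a, b, ha, hax, hxb, hb, hab, rfl⟩
  exact h a b ha hax hxb hb hab

theorem concaveEnvelope_le_of_concaveOn {g : ℝ → ℝ} (hg : ConcaveOn ℝ (Icc 0 1) g)
    (hfg : ∀ t ∈ Icc (0 : ℝ) 1, f t ≤ g t) {x : ℝ} (hx : x ∈ Icc (0 : ℝ) 1) :
    concaveEnvelope f x ≤ g x :=
  concaveEnvelope_le hx fun _ _ ha hax hxb hb hab => chord_le_of_concaveOn hg hfg ha hax hxb hb hab

theorem le_concaveEnvelope (hM : ∀ t ∈ Icc (0 : ℝ) 1, f t ≤ M) {x : ℝ} (hx : x ∈ Icc (0 : ℝ) 1) :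
    f x ≤ concaveEnvelope f x := by
  rcases hx.2.lt_or_eq with h | rfl
  · have := chord_le_concaveEnvelope hM hx.1 le_rfl h.le le_rfl h
    have h0 : (1 - x) ≠ 0 := by linarith
    simpa [h0] using this
  · have := chord_le_concaveEnvelope hM le_rfl zero_le_one le_rfl le_rfl zero_lt_one
    simpa using this

theorem concaveOn_affine (c s x : ℝ) : ConcaveOn ℝ (Icc 0 1) fun t => c + s * (t - x) := by
  refine ⟨convex_Icc 0 1, fun p _ q _ a b _ _ hab => le_of_eq ?_⟩
  simp only [smul_eq_mul]
  obtain rfl : b = 1 - a := by linarith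
  ring

theorem concaveEnvelope_zero (hM : ∀ t ∈ Icc (0 : ℝ) 1, f t ≤ M) : concaveEnvelope f 0 = f 0 := by
  refine le_antisymm (concaveEnvelope_le ⟨le_rfl, zero_le_one⟩ ?_)
    (le_concaveEnvelope hM ⟨le_rfl, zero_le_one⟩)
  intro a b ha ha' _ _ hab
  obtain rfl : a = 0 := le_antisymm ha' ha
  have : b ≠ 0 := hab.ne'
  simp [this]

theorem concaveEnvelope_one (hM : ∀ t ∈ Icc (0 : ℝ) 1, f t ≤ M) : concaveEnvelope f 1 = f 1 := by
  refine le_antisymm (concaveEnvelope_le ⟨zero_le_one, le_rfl⟩ ?_)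
    (le_concaveEnvelope hM ⟨zero_le_one, le_rfl⟩)
  intro a b _ _ hb hb' hab
  obtain rfl : b = 1 := le_antisymm hb' hb
  have : 1 - a ≠ 0 := by linarith
  simp [this]

/-- The slope is the supremum of the slopes from `(x, d)` to points of the graph of `f` on the
right. None of these exceeds a slope from the left, since otherwise a chord of `f` would pass above
`d`, the value of the envelope at `x`. -/
theorem exists_affine_majorant (hM : ∀ t ∈ Icc (0 : ℝ) 1, f t ≤ M) {x : ℝ}
    (hx : x ∈ Ioo (0 : ℝ) 1) :
    ∃ s : ℝ, ∀ t ∈ Icc (0 : ℝ) 1, f t ≤ concaveEnvelope f x + s * (t - x) := by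
  set d := concaveEnvelope f x with hd
  have key : ∀ a b : ℝ, 0 ≤ a → a < x → x < b → b ≤ 1 →
      (f b - d) / (b - x) ≤ (d - f a) / (x - a) := by
    intro a b ha hax hxb hb
    have h := chord_le_concaveEnvelope hM ha hax.le hxb.le hb (hax.trans hxb)
    rw [div_le_iff₀ (by linarith), ← hd] at h
    rw [div_le_div_iff₀ (by linarith) (by linarith)]
    nlinarith
  let S : Set ℝ := {y | ∃ b : ℝ, x < b ∧ b ≤ 1 ∧ y = (f b - d) / (b - x)}
  have hS : S.Nonempty := ⟨_, 1, hx.2, le_rfl, rfl⟩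
  have hSb : BddAbove S := by
    refine ⟨(d - f 0) / (x - 0), ?_⟩
    rintro y ⟨b, hxb, hb, rfl⟩
    exact key 0 b le_rfl hx.1 hxb hb
  refine ⟨sSup S, fun t ht => ?_⟩
  rcases lt_trichotomy t x with h | rfl | h
  · have h1 : sSup S ≤ (d - f t) / (x - t) := by
      refine csSup_le hS ?_
      rintro y ⟨b, hxb, hb, rfl⟩
      exact key t b ht.1 h hxb hb
    rw [le_div_iff₀ (by linarith)] at h1
    linarith
  · simpa using le_concaveEnvelope hM ht
  · have h1 : (f t - d) / (t - x) ≤ sSup S := le_csSup hSb ⟨t, h, ht.2, rfl⟩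
    rw [div_le_iff₀ (by linarith)] at h1
    linarith

/-- The supporting line at the middle point majorises `f`, hence the envelope, and its slope
separates the two adjacent slopes. -/
theorem concaveOn_concaveEnvelope (hM : ∀ t ∈ Icc (0 : ℝ) 1, f t ≤ M) :
    ConcaveOn ℝ (Icc 0 1) (concaveEnvelope f) := by
  refine concaveOn_of_slope_anti_adjacent (convex_Icc 0 1) ?_
  intro a x b ha hb hax hxb
  have hx : x ∈ Ioo (0 : ℝ) 1 := ⟨ha.1.trans_lt hax, hxb.trans_le hb.2⟩
  obtain ⟨s, hs⟩ := exists_affine_majorant hM hx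
  have h1 := concaveEnvelope_le_of_concaveOn (concaveOn_affine _ s x) hs ha
  have h2 := concaveEnvelope_le_of_concaveOn (concaveOn_affine _ s x) hs hb
  have h3 : (concaveEnvelope f b - concaveEnvelope f x) / (b - x) ≤ s := by
    rw [div_le_iff₀ (by linarith)]; linarith
  have h4 : s ≤ (concaveEnvelope f x - concaveEnvelope f a) / (x - a) := by
    rw [le_div_iff₀ (by linarith)]; linarith
  exact h3.trans h4

/-- Near a point of continuity of `f` at the end `p` of `[0,1]`, the concave envelope stays below
an affine function that exceeds `f p` by `ε` at `p`. -/
theorem exists_concaveEnvelope_le_affine (hM : ∀ t ∈ Icc (0 : ℝ) 1, f t ≤ M) {p σ : ℝ}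
    (hσ : ∀ t ∈ Icc (0 : ℝ) 1, 0 ≤ σ * (t - p) ∧ |t - p| = σ * (t - p))
    (hf : ContinuousWithinAt f (Icc 0 1) p) {ε : ℝ} (hε : 0 < ε) :
    ∃ s : ℝ, ∀ t ∈ Icc (0 : ℝ) 1, concaveEnvelope f t ≤ f p + ε + s * (t - p) := by
  obtain ⟨η, hη, h⟩ := Metric.continuousWithinAt_iff.1 hf ε hε
  -- Here `σ` is the sign that points from `p` into `[0,1]`. At distance `η` from `p` the line has
  -- gained `|M - f p|`, so it is above the bound `M` where continuity gives no control.
  refine ⟨|M - f p| / η * σ, fun t ht => concaveEnvelope_le_of_concaveOn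
    (concaveOn_affine (f p + ε) _ p) ?_ ht⟩
  intro t ht
  have h0 : 0 ≤ |M - f p| / η := by positivity
  by_cases htp : |t - p| < η
  · have := h ht (by rwa [Real.dist_eq])
    rw [Real.dist_eq] at this
    have h1 := (abs_lt.1 this).2
    have h2 := mul_nonneg h0 (hσ t ht).1
    rw [mul_assoc]; linarith
  · push Not at htp
    rw [(hσ t ht).2] at htp
    have h2 := mul_le_mul_of_nonneg_left htp h0
    rw [div_mul_cancel₀ _ hη.ne'] at h2
    have h3 := le_abs_self (M - f p)
    have h4 := hM t ht
    rw [mul_assoc]; linarith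

theorem continuousWithinAt_concaveEnvelope_end (hM : ∀ t ∈ Icc (0 : ℝ) 1, f t ≤ M) {p σ : ℝ}
    (hEp : concaveEnvelope f p = f p)
    (hσ : ∀ t ∈ Icc (0 : ℝ) 1, 0 ≤ σ * (t - p) ∧ |t - p| = σ * (t - p))
    (hf : ContinuousWithinAt f (Icc 0 1) p) :
    ContinuousWithinAt (concaveEnvelope f) (Icc 0 1) p := by
  rw [ContinuousWithinAt, hEp]
  refine tendsto_order.2 ⟨fun a ha => ?_, fun a ha => ?_⟩
  · filter_upwards [(tendsto_order.1 hf).1 a ha, self_mem_nhdsWithin] with t ht ht'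
    exact ht.trans_le (le_concaveEnvelope hM ht')
  · obtain ⟨s, hs⟩ := exists_concaveEnvelope_le_affine hM hσ hf (half_pos (sub_pos.2 ha))
    have hc : Tendsto (fun t => f p + (a - f p) / 2 + s * (t - p)) (𝓝[Icc 0 1] p)
        (𝓝 (f p + (a - f p) / 2 + s * (p - p))) := by
      apply Continuous.continuousWithinAt (f := fun t => f p + (a - f p) / 2 + s * (t - p))
      fun_prop
    filter_upwards [(tendsto_order.1 hc).2 a (by linarith), self_mem_nhdsWithin] with t ht ht'
    exact (hs t ht').trans_lt ht

theorem continuousOn_concaveEnvelope (hM : ∀ t ∈ Icc (0 : ℝ) 1, f t ≤ M)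
    (hf : ContinuousOn f (Icc 0 1)) : ContinuousOn (concaveEnvelope f) (Icc 0 1) := by
  intro p hp
  rcases hp.1.eq_or_lt with rfl | h0
  · exact continuousWithinAt_concaveEnvelope_end hM (concaveEnvelope_zero hM) (σ := 1)
      (fun t ht => ⟨by linarith [ht.1], by rw [abs_of_nonneg (by linarith [ht.1])]; ring⟩) (hf _ hp)
  rcases hp.2.eq_or_lt with rfl | h1
  · exact continuousWithinAt_concaveEnvelope_end hM (concaveEnvelope_one hM) (σ := -1)
      (fun t ht => ⟨by linarith [ht.2], by rw [abs_of_nonpos (by linarith [ht.2])]; ring⟩) (hf _ hp)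
  · have := ((concaveOn_concaveEnvelope hM).continuousOn_interior) p (by
      rw [interior_Icc]; exact ⟨h0, h1⟩)
    rw [interior_Icc] at this
    exact (this.continuousAt (Ioo_mem_nhds h0 h1)).continuousWithinAt

/-- Where the envelope lies strictly above the function, it is locally affine. -/
theorem exists_affine_of_lt_concaveEnvelope (hM : ∀ t ∈ Icc (0 : ℝ) 1, f t ≤ M)
    (hf : ContinuousOn f (Icc 0 1)) {t : ℝ} (ht : t ∈ Ioo (0 : ℝ) 1)
    (hlt : f t < concaveEnvelope f t) :
    ∃ a b s : ℝ, 0 ≤ a ∧ a < t ∧ t < b ∧ b ≤ 1 ∧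
      ∀ x ∈ Icc a b, concaveEnvelope f x = concaveEnvelope f a + s * (x - a) := by
  set E := concaveEnvelope f
  have hEc : ConcaveOn ℝ (Icc 0 1) E := concaveOn_concaveEnvelope hM
  have hn : Icc (0 : ℝ) 1 ∈ 𝓝 t := Icc_mem_nhds ht.1 ht.2
  have hEt : ContinuousAt E t := (continuousOn_concaveEnvelope hM hf).continuousAt hn
  have hft : ContinuousAt f t := hf.continuousAt hn
  obtain ⟨c, hc1, hc2⟩ := exists_between hlt
  have hev : ∀ᶠ x in 𝓝 t, f x < c ∧ c < E x ∧ x ∈ Icc (0 : ℝ) 1 :=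
    ((tendsto_order.1 hft).2 c hc1).and (((tendsto_order.1 hEt).1 c hc2).and hn)
  obtain ⟨l, r, htlr, hlr⟩ := mem_nhds_iff_exists_Ioo_subset.1 hev
  obtain ⟨a, hla, hat⟩ := exists_between htlr.1
  obtain ⟨b, htb, hbr⟩ := exists_between htlr.2
  have hsub : ∀ x ∈ Icc a b, f x < c ∧ c < E x ∧ x ∈ Icc (0 : ℝ) 1 := fun x hx =>
    hlr ⟨hla.trans_le hx.1, hx.2.trans_lt hbr⟩
  have hab : a < b := hat.trans htb
  have haa := hsub a ⟨le_rfl, hab.le⟩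
  have hbb := hsub b ⟨hab.le, le_rfl⟩
  set s := (E b - E a) / (b - a) with hs
  have hsb : E b = E a + s * (b - a) := by
    rw [hs, div_mul_cancel₀ _ (by linarith)]; ring
  have hin : ∀ x ∈ Icc a b, E a + s * (x - a) ≤ E x := by
    intro x hx
    have := chord_le_of_concaveOn (f := E) hEc (fun _ _ => le_rfl) haa.2.2.1 hx.1 hx.2 hbb.2.2.2 hab
    refine le_trans (le_of_eq ?_) this
    rw [eq_div_iff (by linarith), hsb]; ring
  -- The minimum of the envelope and its secant line through `a` and `b` is a concave majorant of
  -- `f`: on `[a, b]` the secant is above the level `c`, which separates `f` from the envelope, and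
  -- outside `[a, b]` concavity puts the envelope below the secant. Minimality of the envelope then
  -- bounds it by the secant.
  have hmin : ∀ x ∈ Icc (0 : ℝ) 1, f x ≤ min (E x) (E a + s * (x - a)) := by
    intro x hx
    refine le_min (le_concaveEnvelope hM hx) ?_
    by_cases hxa : x < a
    · refine (le_concaveEnvelope hM hx).trans ?_
      have := chord_le_of_concaveOn (f := E) hEc (fun _ _ => le_rfl) hx.1 hxa.le hab.le
        hbb.2.2.2 (hxa.trans hab)
      rw [div_le_iff₀ (by linarith), hsb] at this
      have h : (b - a) * (E x) ≤ (b - a) * (E a + s * (x - a)) := by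
        nlinarith
      exact le_of_mul_le_mul_left h (by linarith)
    by_cases hbx : b < x
    · refine (le_concaveEnvelope hM hx).trans ?_
      have := chord_le_of_concaveOn (f := E) hEc (fun _ _ => le_rfl) haa.2.2.1 hab.le hbx.le
        hx.2 (hab.trans hbx)
      rw [div_le_iff₀ (by linarith), hsb] at this
      have h : (b - a) * (E x) ≤ (b - a) * (E a + s * (x - a)) := by
        nlinarith
      exact le_of_mul_le_mul_left h (by linarith)
    push Not at hxa hbx
    refine (hsub x ⟨hxa, hbx⟩).1.le.trans ?_
    have h1 := haa.2.1
    have h2 := hbb.2.1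
    rw [hsb] at h2
    have h : (b - a) * c ≤ (b - a) * (E a + s * (x - a)) := by
      nlinarith [mul_le_mul_of_nonneg_left h1.le (sub_nonneg.2 hbx),
        mul_le_mul_of_nonneg_left h2.le (sub_nonneg.2 hxa)]
    exact le_of_mul_le_mul_left h (by linarith)
  refine ⟨a, b, s, haa.2.2.1, hat, htb, hbb.2.2.2, fun x hx => le_antisymm ?_ (hin x hx)⟩
  exact (concaveEnvelope_le_of_concaveOn (hEc.inf (concaveOn_affine _ s a)) hmin
    (hsub x hx).2.2).trans (min_le_right _ _)

end Envelope

/-! ### Left derivatives of concave functions, by reflection. -/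

section LeftDeriv

open Filter Topology

variable {E : ℝ → ℝ}

/-- The reflection turns left derivatives of a concave function at `1 - y` into right derivatives of
a convex function at `y`, in the parametrisation that the quantile of the new kernel requires. -/
theorem convexOn_neg_reflect (hE : ConcaveOn ℝ (Icc 0 1) E) :
    ConvexOn ℝ (Icc 0 1) fun y => -E (1 - y) := by
  refine ⟨convex_Icc 0 1, fun x hx y hy a b ha hb hab => ?_⟩
  have h := hE.2 (show 1 - x ∈ Icc (0 : ℝ) 1 from ⟨by linarith [hx.2], by linarith [hx.1]⟩)
    (show 1 - y ∈ Icc (0 : ℝ) 1 from ⟨by linarith [hy.2], by linarith [hy.1]⟩) ha hb hab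
  have h1 : a • (1 - x) + b • (1 - y) = 1 - (a • x + b • y) := by
    simp only [smul_eq_mul]; linear_combination hab
  rw [h1] at h
  simp only [smul_eq_mul] at *
  linarith

theorem leftDeriv_eq_of_hasDerivWithinAt_reflect {y d : ℝ}
    (h : HasDerivWithinAt (fun y => -E (1 - y)) d (Ioi y) y) : leftDeriv E (1 - y) = d := by
  have h1 : HasDerivWithinAt (fun y => -E (1 - y)) d (Ici y) (1 - (1 - y)) := by
    rw [sub_sub_cancel]; exact h.Ici_of_Ioi
  have h2 : HasDerivWithinAt (fun x : ℝ => 1 - x) (-1) (Iic (1 - y)) (1 - y) := by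
    simpa using ((hasDerivWithinAt_id (1 - y) (Iic (1 - y))).const_sub (1 : ℝ))
  have h3 := (h1.comp (1 - y) h2 (fun x hx => by
    simp only [mem_Iic, mem_Ici] at *; linarith)).neg
  have h4 : HasDerivWithinAt E d (Iic (1 - y)) (1 - y) := by
    refine (h3.congr_deriv (by ring)).congr_of_eventuallyEq (.of_forall fun x => ?_) ?_ <;> simp
  exact h4.derivWithin (uniqueDiffWithinAt_Iic _)

theorem leftDeriv_reflect (hE : ConcaveOn ℝ (Icc 0 1) E) {y : ℝ} (hy : y ∈ Ioo (0 : ℝ) 1) :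
    leftDeriv E (1 - y) = derivWithin (fun y => -E (1 - y)) (Ioi y) y :=
  leftDeriv_eq_of_hasDerivWithinAt_reflect
    ((convexOn_neg_reflect hE).hasDerivWithinAt_rightDeriv_of_mem_interior
      (by rwa [interior_Icc]))

theorem hasDerivWithinAt_reflect (hE : ConcaveOn ℝ (Icc 0 1) E) {y : ℝ} (hy : y ∈ Ioo (0 : ℝ) 1) :
    HasDerivWithinAt (fun y => -E (1 - y)) (leftDeriv E (1 - y)) (Ioi y) y := by
  rw [leftDeriv_reflect hE hy]
  exact (convexOn_neg_reflect hE).hasDerivWithinAt_rightDeriv_of_mem_interior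
    (by rwa [interior_Icc])

theorem monotoneOn_leftDeriv_reflect (hE : ConcaveOn ℝ (Icc 0 1) E) :
    MonotoneOn (fun y => leftDeriv E (1 - y)) (Ioo 0 1) := by
  intro x hx y hy hxy
  have := (convexOn_neg_reflect hE).monotoneOn_rightDeriv (by rwa [interior_Icc])
    (by rwa [interior_Icc]) hxy
  simpa only [leftDeriv_reflect hE hx, leftDeriv_reflect hE hy] using this

theorem leftDeriv_reflect_le_slope (hE : ConcaveOn ℝ (Icc 0 1) E) {y z : ℝ} (hy : 0 < y)
    (hyz : y < z) (hz : z ≤ 1) : leftDeriv E (1 - y) ≤ (E (1 - y) - E (1 - z)) / (z - y) := by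
  have hy' : y ∈ Ioo (0 : ℝ) 1 := ⟨hy, by linarith⟩
  have h := (convexOn_neg_reflect hE).rightDeriv_le_slope_of_mem_interior
    (x := y) (y := z) (by rwa [interior_Icc]) ⟨by linarith, hz⟩ hyz
  rw [leftDeriv_reflect hE hy']
  refine h.trans (le_of_eq ?_)
  rw [slope_def_field]; congr 1; ring

theorem slope_le_leftDeriv_reflect (hE : ConcaveOn ℝ (Icc 0 1) E) {y z : ℝ} (hz : 0 ≤ z)
    (hyz : z < y) (hy : y < 1) : (E (1 - z) - E (1 - y)) / (y - z) ≤ leftDeriv E (1 - y) := by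
  have hy' : y ∈ interior (Icc (0 : ℝ) 1) := by rw [interior_Icc]; exact ⟨by linarith, hy⟩
  have h := (convexOn_neg_reflect hE).slope_le_leftDeriv_of_mem_interior
    (x := z) (y := y) ⟨hz, by linarith⟩ hy' hyz
  rw [leftDeriv_reflect hE (by rwa [interior_Icc] at hy')]
  refine le_trans (le_of_eq ?_)
    (h.trans ((convexOn_neg_reflect hE).leftDeriv_le_rightDeriv_of_mem_interior hy'))
  rw [slope_def_field]; congr 1; ring

theorem rightContinuous_leftDeriv_reflect (hE : ConcaveOn ℝ (Icc 0 1) E) {y : ℝ}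
    (hy : y ∈ Ioo (0 : ℝ) 1) :
    ContinuousWithinAt (fun y => leftDeriv E (1 - y)) (Ici y) y := by
  have hc : ContinuousAt (fun x => E (1 - x)) y := by
    have h := hE.continuousOn_interior
    rw [interior_Icc] at h
    have h1 : ContinuousAt E (1 - y) :=
      h.continuousAt (Ioo_mem_nhds (by linarith [hy.2]) (by linarith [hy.1]))
    exact ContinuousAt.comp (f := fun x => 1 - x) h1 (by fun_prop)
  refine tendsto_order.2 ⟨fun a ha => ?_, fun a ha => ?_⟩
  · filter_upwards [self_mem_nhdsWithin, mem_nhdsWithin_of_mem_nhds (Ioo_mem_nhds hy.1 hy.2)]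
      with z hz hz'
    exact ha.trans_le (monotoneOn_leftDeriv_reflect hE hy hz' hz)
  · have h1 := (hasDerivWithinAt_iff_tendsto_slope' (by simp)).1 (hasDerivWithinAt_reflect hE hy)
    -- The secant slope from `y` to a nearby fixed `z` is already below `a`. By continuity it stays
    -- below `a` when the base point moves to `x`, and it bounds the derivative at `x`.
    obtain ⟨z, hz, hz1, hz2⟩ := (((tendsto_order.1 h1).2 a ha).and
      ((eventually_mem_nhdsWithin (a := y) (s := Ioi y)).and
        (mem_nhdsWithin_of_mem_nhds (Iio_mem_nhds hy.2)))).exists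
    rw [slope_def_field] at hz
    have h2 : ContinuousAt (fun x => (E (1 - x) - E (1 - z)) / (z - x)) y :=
      (hc.sub continuousAt_const).div (by fun_prop) (sub_pos.2 hz1).ne'
    have h3 : (E (1 - y) - E (1 - z)) / (z - y) < a := by
      refine lt_of_eq_of_lt ?_ hz; congr 1; ring
    filter_upwards [self_mem_nhdsWithin, mem_nhdsWithin_of_mem_nhds ((tendsto_order.1 h2).2 a h3),
      mem_nhdsWithin_of_mem_nhds (Iio_mem_nhds hz1)] with x hx hx1 hx2
    exact (leftDeriv_reflect_le_slope hE (hy.1.trans_le hx) hx2 (le_of_lt hz2)).trans_lt hx1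

theorem leftDeriv_reflect_pos (hE : ConcaveOn ℝ (Icc 0 1) E) (hlt : ∀ x ∈ Ico (0 : ℝ) 1, E x < E 1)
    {y : ℝ} (hy : y ∈ Ioo (0 : ℝ) 1) : 0 < leftDeriv E (1 - y) := by
  refine lt_of_lt_of_le ?_ (slope_le_leftDeriv_reflect hE le_rfl hy.1 hy.2)
  have := hlt (1 - y) ⟨by linarith [hy.2], by linarith [hy.1]⟩
  rw [sub_zero, sub_zero]
  exact div_pos (by linarith) hy.1

/-- Only continuity is available at the endpoints. The sign of the one-sided derivative supplies its
integrability, after which the fundamental theorem of calculus applies. -/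
theorem intervalIntegrable_leftDeriv_reflect (hE : ConcaveOn ℝ (Icc 0 1) E)
    (hEc : ContinuousOn E (Icc 0 1)) (hpos : ∀ y ∈ Ioo (0 : ℝ) 1, 0 ≤ leftDeriv E (1 - y))
    {z : ℝ} (hz : z ∈ Icc (0 : ℝ) 1) :
    IntervalIntegrable (fun y => leftDeriv E (1 - y)) volume 0 z ∧
      ∫ y in (0 : ℝ)..z, leftDeriv E (1 - y) = E 1 - E (1 - z) := by
  have hc : ContinuousOn (fun y => -E (1 - y)) (Icc 0 z) :=
    (hEc.comp (f := fun y => 1 - y) (by fun_prop)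
      (fun y hy => ⟨by linarith [hy.2, hz.2], by linarith [hy.1]⟩)).neg
  have hsub : ∀ y ∈ Ioo (0 : ℝ) z, y ∈ Ioo (0 : ℝ) 1 := fun y hy => ⟨hy.1, hy.2.trans_le hz.2⟩
  have hi : IntervalIntegrable (fun y => leftDeriv E (1 - y)) volume 0 z := by
    rw [intervalIntegrable_iff_integrableOn_Ioc_of_le hz.1]
    exact intervalIntegral.integrableOn_deriv_right_of_nonneg hc
      (fun y hy => hasDerivWithinAt_reflect hE (hsub y hy)) (fun y hy => hpos y (hsub y hy))
  refine ⟨hi, ?_⟩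
  rw [intervalIntegral.integral_eq_sub_of_hasDeriv_right_of_le hz.1 hc
    (fun y hy => hasDerivWithinAt_reflect hE (hsub y hy)) hi]
  rw [sub_zero]; ring

theorem leftDeriv_eq_of_affine {a b s : ℝ}
    (h : ∀ x ∈ Icc a b, E x = E a + s * (x - a)) {x : ℝ} (hx : x ∈ Ioc a b) :
    leftDeriv E x = s := by
  have h1 : HasDerivWithinAt (fun x => E a + s * (x - a)) s (Iic x) x := by
    simpa using (((hasDerivWithinAt_id x (Iic x)).sub_const a).const_mul s).const_add (E a)
  refine (h1.congr_of_eventuallyEq ?_ (h x (Ioc_subset_Icc_self hx))).derivWithin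
    (uniqueDiffWithinAt_Iic _)
  filter_upwards [self_mem_nhdsWithin, mem_nhdsWithin_of_mem_nhds (Ioi_mem_nhds hx.1)] with y hy hy'
  exact h y ⟨le_of_lt hy', le_trans hy hx.2⟩

end LeftDeriv

/-! ### Quantile functions and uniform variables. -/

section Quantile

open Filter Topology

/-- Lebesgue measure on the open unit interval. -/
noncomputable abbrev unif : Measure ℝ := volume.restrict (Ioo 0 1)

instance isProbabilityMeasure_unif : IsProbabilityMeasure unif := ⟨by simp [unif]⟩

theorem ae_mem_unif : ∀ᵐ y ∂unif, y ∈ Ioo (0 : ℝ) 1 := ae_restrict_mem measurableSet_Ioo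

theorem unif_Iio {c : ℝ} (hc : c ≤ 1) : unif (Iio c) = ENNReal.ofReal c := by
  rw [unif, Measure.restrict_apply measurableSet_Iio]
  have : Iio c ∩ Ioo (0 : ℝ) 1 = Ioo 0 c := by
    ext x; simp only [mem_inter_iff, mem_Iio, mem_Ioo]; constructor
    · rintro ⟨a, b, _⟩; exact ⟨b, a⟩
    · rintro ⟨a, b⟩; exact ⟨b, a, by linarith⟩
  rw [this, Real.volume_Ioo, sub_zero]

theorem unif_Iic {c : ℝ} (hc : c ≤ 1) : unif (Iic c) = ENNReal.ofReal c := by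
  rw [← unif_Iio hc]; exact (measure_congr Iio_ae_eq_Iic).symm

theorem unif_Ioi {c : ℝ} (hc : 0 ≤ c) : unif (Ioi c) = ENNReal.ofReal (1 - c) := by
  rw [unif, Measure.restrict_apply measurableSet_Ioi]
  have : Ioi c ∩ Ioo (0 : ℝ) 1 = Ioo c 1 := by
    ext x; simp only [mem_inter_iff, mem_Ioi, mem_Ioo]; constructor
    · rintro ⟨a, _, b⟩; exact ⟨a, b⟩
    · rintro ⟨a, b⟩; exact ⟨a, by linarith, b⟩
  rw [this, Real.volume_Ioo]

theorem unif_Ici {c : ℝ} (hc : 0 ≤ c) : unif (Ici c) = ENNReal.ofReal (1 - c) := by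
  rw [← unif_Ioi hc]; exact (measure_congr Ioi_ae_eq_Ici).symm

theorem map_one_sub_unif : unif.map (fun y => 1 - y) = unif := by
  have h : MeasurePreserving (fun y : ℝ => 1 - y) volume volume :=
    Measure.measurePreserving_sub_left volume 1
  have h2 := h.restrict_preimage (measurableSet_Ioo (a := (0 : ℝ)) (b := 1))
  have h3 : (fun y : ℝ => 1 - y) ⁻¹' Ioo 0 1 = Ioo 0 1 := by
    ext x; simp only [mem_preimage, mem_Ioo]; constructor <;> rintro ⟨a, b⟩ <;> constructor <;>
      linarith
  rw [h3] at h2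
  exact h2.map_eq

theorem aemeasurable_of_monotoneOn {H : ℝ → ℝ} (hH : MonotoneOn H (Ioo 0 1)) :
    AEMeasurable H unif := aemeasurable_restrict_of_monotoneOn measurableSet_Ioo hH

theorem map_eq_of_measure_Iic {α β : Type*} [MeasurableSpace α] [MeasurableSpace β]
    {μ : Measure α} {ν : Measure β} [IsFiniteMeasure μ] {X : α → ℝ} {Y : β → ℝ}
    (hX : AEMeasurable X μ) (hY : AEMeasurable Y ν)
    (h : ∀ t, μ {a | X a ≤ t} = ν {b | Y b ≤ t}) : μ.map X = ν.map Y := by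
  have := Measure.isFiniteMeasure_map μ X
  refine Measure.ext_of_Iic _ _ fun t => ?_
  rw [Measure.map_apply_of_aemeasurable hX measurableSet_Iic,
    Measure.map_apply_of_aemeasurable hY measurableSet_Iic]
  exact h t

theorem measure_sdiff_comm {α : Type*} [MeasurableSpace α] {μ : Measure α} [IsFiniteMeasure μ]
    {A B : Set α} (hA : NullMeasurableSet A μ) (hB : NullMeasurableSet B μ) (h : μ A = μ B) :
    μ (B \ A) = μ (A \ B) := by
  have h1 := measure_inter_add_sdiff₀ A hB
  have h2 := measure_inter_add_sdiff₀ B hA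
  rw [inter_comm, ← h, ← h1] at h2
  exact (ENNReal.add_right_inj (measure_ne_top μ _)).1 h2

variable {Ω : Type*} [MeasurableSpace Ω] {μ : Measure Ω} {X : Ω → ℝ}

theorem bddAbove_quantileSet {y : ℝ} (hy : y ∈ Ioo (0 : ℝ) 1) :
    BddAbove {t : ℝ | cdf (μ.map X) t ≤ y} := by
  obtain ⟨t, ht⟩ := ((tendsto_order.1 (tendsto_cdf_atTop (μ.map X))).1 y hy.2).exists
  refine ⟨t, fun s hs => ?_⟩
  by_contra h
  exact absurd (ht.trans_le (monotone_cdf _ (not_le.1 h).le)) (not_lt.2 hs)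

theorem nonempty_quantileSet {y : ℝ} (hy : y ∈ Ioo (0 : ℝ) 1) :
    {t : ℝ | cdf (μ.map X) t ≤ y}.Nonempty := by
  obtain ⟨t, ht⟩ := ((tendsto_order.1 (tendsto_cdf_atBot (μ.map X))).2 y hy.1).exists
  exact ⟨t, ht.le⟩

theorem le_quantile {y t : ℝ} (hy : y ∈ Ioo (0 : ℝ) 1) (h : cdf (μ.map X) t ≤ y) :
    t ≤ quantile μ X y := le_csSup (bddAbove_quantileSet hy) h

theorem quantile_le {y t : ℝ} (hy : y ∈ Ioo (0 : ℝ) 1) (h : y < cdf (μ.map X) t) :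
    quantile μ X y ≤ t := by
  refine csSup_le (nonempty_quantileSet hy) fun s hs => ?_
  by_contra h'
  exact absurd (h.trans_le (monotone_cdf _ (not_le.1 h').le)) (not_lt.2 hs)

theorem le_cdf_of_quantile_le {y t : ℝ} (hy : y ∈ Ioo (0 : ℝ) 1) (h : quantile μ X y ≤ t) :
    y ≤ cdf (μ.map X) t := by
  have hc : Tendsto (cdf (μ.map X)) (𝓝[>] t) (𝓝 (cdf (μ.map X) t)) :=
    ((cdf (μ.map X)).right_continuous t).mono_left (nhdsWithin_mono _ Ioi_subset_Ici_self)
  refine ge_of_tendsto hc ?_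
  filter_upwards [self_mem_nhdsWithin] with s hs
  by_contra h'
  exact absurd (le_quantile hy (not_le.1 h').le) (not_le.2 (h.trans_lt hs))

theorem cdf_le_of_lt_quantile {y t : ℝ} (hy : y ∈ Ioo (0 : ℝ) 1) (h : t < quantile μ X y) :
    cdf (μ.map X) t ≤ y := by
  by_contra h'
  exact absurd (quantile_le hy (not_le.1 h')) (not_le.2 h)

theorem monotoneOn_quantile : MonotoneOn (quantile μ X) (Ioo 0 1) := fun _ hx _ hy hxy =>
  csSup_le_csSup (bddAbove_quantileSet hy) (nonempty_quantileSet hx) fun _ ht => le_trans ht hxy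

theorem rightContinuous_quantile {y : ℝ} (hy : y ∈ Ioo (0 : ℝ) 1) :
    ContinuousWithinAt (quantile μ X) (Ici y) y := by
  refine tendsto_order.2 ⟨fun a ha => ?_, fun a ha => ?_⟩
  · filter_upwards [self_mem_nhdsWithin, mem_nhdsWithin_of_mem_nhds (Ioo_mem_nhds hy.1 hy.2)]
      with z hz hz'
    exact ha.trans_le (monotoneOn_quantile hy hz' hz)
  · obtain ⟨b, hb, hba⟩ := exists_between ha
    have hyb : y < cdf (μ.map X) b := by
      by_contra h
      exact absurd (le_quantile hy (not_lt.1 h)) (not_le.2 hb)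
    filter_upwards [self_mem_nhdsWithin, mem_nhdsWithin_of_mem_nhds (Ioo_mem_nhds hy.1 hy.2),
      mem_nhdsWithin_of_mem_nhds (Iio_mem_nhds hyb)] with z _ hz' hzb
    exact (quantile_le hz' hzb).trans_lt hba

/-- Continuity gives `F(F⁻¹(y)) = y`, so the quantile function is injective as well as monotone. -/
theorem strictMonoOn_quantile (hc : Continuous (cdf (μ.map X))) :
    StrictMonoOn (quantile μ X) (Ioo 0 1) := by
  have h : ∀ y ∈ Ioo (0 : ℝ) 1, cdf (μ.map X) (quantile μ X y) = y := by
    intro y hy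
    refine le_antisymm ?_ (le_cdf_of_quantile_le hy le_rfl)
    refine le_of_tendsto (hc.continuousWithinAt (s := Iio (quantile μ X y))) ?_
    filter_upwards [self_mem_nhdsWithin] with t ht using cdf_le_of_lt_quantile hy ht
  intro x hx y hy hxy
  refine (monotoneOn_quantile hx hy hxy.le).lt_of_ne fun he => ?_
  rw [← h x hx, ← h y hy, he] at hxy
  exact lt_irrefl _ hxy

theorem aemeasurable_of_map_eq_unif {V : Ω → ℝ} (hV : μ.map V = unif) : AEMeasurable V μ := by
  by_contra h
  -- The pushforward along a map that is not a.e. measurable is the zero measure, which does not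
  -- have mass one.
  rw [Measure.map_of_not_aemeasurable h] at hV
  have := measure_univ (μ := unif)
  rw [← hV] at this
  simp at this

theorem ae_mem_of_map_eq_unif {V : Ω → ℝ} (hV : μ.map V = unif) : ∀ᵐ ω ∂μ, V ω ∈ Ioo (0 : ℝ) 1 :=
  ae_of_ae_map (aemeasurable_of_map_eq_unif hV) (hV ▸ ae_mem_unif)

variable [IsProbabilityMeasure μ]

theorem ofReal_cdf_map (hX : AEMeasurable X μ) (t : ℝ) :
    ENNReal.ofReal (cdf (μ.map X) t) = μ {ω | X ω ≤ t} := by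
  have := Measure.isProbabilityMeasure_map hX
  rw [ofReal_cdf, Measure.map_apply_of_aemeasurable hX measurableSet_Iic]; rfl

theorem quantile_nonneg (hX : AEMeasurable X μ) (h0 : ∀ᵐ ω ∂μ, 0 ≤ X ω) {y : ℝ}
    (hy : y ∈ Ioo (0 : ℝ) 1) : 0 ≤ quantile μ X y := by
  by_contra h
  obtain ⟨t, ht, ht0⟩ := exists_between (not_le.1 h)
  have h1 := le_cdf_of_quantile_le hy ht.le
  have h2 : μ {ω | X ω ≤ t} = 0 := by
    refine measure_mono_null (fun ω hω => ?_) h0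
    simp only [mem_ofPred_eq, mem_compl_iff] at *
    linarith
  rw [← ofReal_cdf_map hX, ENNReal.ofReal_eq_zero] at h2
  linarith [hy.1]

theorem map_quantile (hX : AEMeasurable X μ) : unif.map (quantile μ X) = μ.map X := by
  refine map_eq_of_measure_Iic (aemeasurable_of_monotoneOn monotoneOn_quantile) hX fun t => ?_
  rw [← ofReal_cdf_map hX]
  have h1 := cdf_le_one (μ.map X) t
  refine le_antisymm ?_ ?_
  · rw [← unif_Iic h1]
    refine measure_mono_ae ?_
    filter_upwards [ae_mem_unif] with y hy hyt using le_cdf_of_quantile_le hy hyt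
  · rw [← unif_Iio h1]
    refine measure_mono_ae ?_
    filter_upwards [ae_mem_unif] with y hy hyt using quantile_le hy hyt

/-- The law of `H(V)` determines `H` up to its values at jumps; right continuity at `y` selects the
value that the quantile function takes. -/
theorem quantile_comp_uniform {V : Ω → ℝ} (hV : μ.map V = unif) {H : ℝ → ℝ}
    (hH : MonotoneOn H (Ioo 0 1)) {y : ℝ} (hy : y ∈ Ioo (0 : ℝ) 1)
    (hc : ContinuousWithinAt H (Ici y) y) : quantile μ (fun ω => H (V ω)) y = H y := by
  have hVm := aemeasurable_of_map_eq_unif hV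
  have hHm : AEMeasurable H (μ.map V) := hV ▸ aemeasurable_of_monotoneOn hH
  have hm : AEMeasurable (fun ω => H (V ω)) μ := hHm.comp_aemeasurable hVm
  have hF : ∀ t, ENNReal.ofReal (cdf (μ.map fun ω => H (V ω)) t) = unif {y | H y ≤ t} := by
    intro t
    have h1 : μ.map (fun ω => H (V ω)) = unif.map H := by
      rw [← hV, AEMeasurable.map_map_of_aemeasurable hHm hVm]; rfl
    have := Measure.isProbabilityMeasure_map hm
    rw [ofReal_cdf, h1, Measure.map_apply_of_aemeasurable (aemeasurable_of_monotoneOn hH)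
      measurableSet_Iic]; rfl
  refine le_antisymm ?_ ?_
  · refine le_of_forall_gt_imp_ge_of_dense fun t ht => quantile_le hy ?_
    obtain ⟨z, ⟨hz1, hz2⟩, hz3⟩ := ((((tendsto_order.1 hc).2 t ht).filter_mono
      (nhdsWithin_mono _ Ioi_subset_Ici_self)).and
        (eventually_mem_nhdsWithin (a := y) (s := Ioi y)) |>.and
          (mem_nhdsWithin_of_mem_nhds (Iio_mem_nhds hy.2))).exists
    have hz : z ∈ Ioo (0 : ℝ) 1 := ⟨hy.1.trans hz2, hz3⟩
    have : ENNReal.ofReal z ≤ ENNReal.ofReal (cdf (μ.map fun ω => H (V ω)) t) := by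
      rw [hF, ← unif_Iio hz.2.le]
      refine measure_mono_ae ?_
      filter_upwards [ae_mem_unif] with x hx hxz
      exact (hH hx hz (le_of_lt hxz)).trans hz1.le
    exact lt_of_lt_of_le hz2 ((ENNReal.ofReal_le_ofReal_iff (cdf_nonneg _ _)).1 this)
  · refine le_of_forall_lt_imp_le_of_dense fun t ht => le_quantile hy ?_
    rw [← ENNReal.ofReal_le_ofReal_iff hy.1.le, hF, ← unif_Iic hy.2.le]
    refine measure_mono_ae ?_
    filter_upwards [ae_mem_unif] with x hx hxt
    by_contra h
    exact absurd ((hH hy hx (not_le.1 h).le).trans hxt) (not_le.2 ht)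

theorem map_cdf_eq_unif (hX : AEMeasurable X μ) (hc : Continuous (cdf (μ.map X))) :
    μ.map (fun ω => cdf (μ.map X) (X ω)) = unif := by
  have hm : AEMeasurable (fun ω => cdf (μ.map X) (X ω)) μ := hc.measurable.comp_aemeasurable hX
  have hle : ∀ y ∈ Ioo (0 : ℝ) 1, ∃ t, cdf (μ.map X) t = y := by
    intro y hy
    obtain ⟨s, hs⟩ := nonempty_quantileSet (μ := μ) (X := X) hy
    obtain ⟨t, ht⟩ := ((tendsto_order.1 (tendsto_cdf_atTop (μ.map X))).1 y hy.2).exists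
    exact mem_range_of_exists_le_of_exists_ge hc ⟨s, hs⟩ ⟨t, ht.le⟩
  have hge : ∀ y ∈ Ioo (0 : ℝ) 1, ENNReal.ofReal y ≤ μ {ω | cdf (μ.map X) (X ω) ≤ y} := by
    intro y hy
    obtain ⟨t, rfl⟩ := hle y hy
    rw [ofReal_cdf_map hX]
    exact measure_mono fun ω hω => monotone_cdf _ hω
  have hlt : ∀ y ∈ Ioo (0 : ℝ) 1, μ {ω | cdf (μ.map X) (X ω) < y} ≤ ENNReal.ofReal y := by
    intro y hy
    obtain ⟨t, rfl⟩ := hle y hy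
    rw [ofReal_cdf_map hX]
    refine measure_mono fun ω hω => ?_
    by_contra h
    exact absurd (monotone_cdf _ (not_le.1 h).le) (not_le.2 hω)
  -- The closed event is bounded by the open events at `z ↓ y`; for those, `F(X) < F(t)` implies `X
  -- ≤ t`. A flat piece of `F` would spoil the direct inclusion.
  have key : ∀ y ∈ Ico (0 : ℝ) 1, μ {ω | cdf (μ.map X) (X ω) ≤ y} ≤ ENNReal.ofReal y := by
    intro y hy
    have : Tendsto ENNReal.ofReal (𝓝[>] y) (𝓝 (ENNReal.ofReal y)) :=
      ENNReal.continuous_ofReal.continuousWithinAt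
    refine ge_of_tendsto this ?_
    filter_upwards [self_mem_nhdsWithin, mem_nhdsWithin_of_mem_nhds (Iio_mem_nhds hy.2)]
      with z hz hz1
    refine le_trans (measure_mono ?_) (hlt z ⟨hy.1.trans_lt hz, hz1⟩)
    exact fun ω (hω : _ ≤ y) => show _ < z from lt_of_le_of_lt hω hz
  rw [← Measure.map_id (μ := unif)]
  refine map_eq_of_measure_Iic hm aemeasurable_id fun t => ?_
  simp only [id]
  change _ = unif (Iic t)
  rcases lt_or_ge t 0 with h | h
  · rw [unif_Iic (by linarith), ENNReal.ofReal_of_nonpos h.le]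
    refine measure_mono_null (t := ∅) (fun ω hω => ?_) measure_empty
    exact absurd (cdf_nonneg (μ.map X) (X ω)) (not_le.2 (lt_of_le_of_lt hω h))
  rcases lt_or_ge t 1 with h1 | h1
  · rw [unif_Iic h1.le]
    refine le_antisymm (key t ⟨h, h1⟩) ?_
    rcases h.eq_or_lt with rfl | h
    · simp
    · exact hge t ⟨h, h1⟩
  · rw [measure_congr (t := univ), measure_univ, measure_congr (t := univ), measure_univ]
    · filter_upwards [ae_mem_unif] with x hx
      exact eq_true (hx.2.le.trans h1)
    · exact .of_forall fun ω => eq_true ((cdf_le_one _ _).trans h1)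

/-- A random variable is its quantile function of any uniform variable comonotonic with it. -/
theorem ae_eq_quantile_of_comonotonic {U : Ω → ℝ} (hU : μ.map U = unif) (hX : AEMeasurable X μ)
    (hco : Comonotonic μ U X) : X =ᵐ[μ] fun ω => quantile μ X (U ω) := by
  have hUm := aemeasurable_of_map_eq_unif hU
  -- The two events have equal probability, so their two set differences have equal probability too.
  -- A pair of points, one from each difference, violates comonotonicity; hence the product of the
  -- two probabilities is zero, and both differences are null.
  have key : ∀ t : ℝ, ∀ᵐ ω ∂μ, (X ω ≤ t ↔ U ω < cdf (μ.map X) t) := by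
    intro t
    set c := cdf (μ.map X) t with hc
    have hA : NullMeasurableSet {ω | X ω ≤ t} μ := hX.nullMeasurable measurableSet_Iic
    have hB : NullMeasurableSet {ω | U ω < c} μ := hUm.nullMeasurable measurableSet_Iio
    have hAB : μ {ω | X ω ≤ t} = μ {ω | U ω < c} := by
      rw [← ofReal_cdf_map hX, ← hc, ← unif_Iio (cdf_le_one _ _), ← hU,
        Measure.map_apply_of_aemeasurable hUm measurableSet_Iio]; rfl
    have hprod : μ ({ω | U ω < c} \ {ω | X ω ≤ t}) * μ ({ω | X ω ≤ t} \ {ω | U ω < c}) = 0 := by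
      rw [← Measure.prod_prod]
      refine measure_mono_null ?_ hco
      rintro ⟨p, q⟩ ⟨⟨h1, h2⟩, h3, h4⟩
      simp only [mem_ofPred_eq, mem_compl_iff, not_le, not_lt] at *
      nlinarith
    have hdiff : μ ({ω | U ω < c} \ {ω | X ω ≤ t}) = μ ({ω | X ω ≤ t} \ {ω | U ω < c}) :=
      measure_sdiff_comm hA hB hAB
    rw [hdiff, mul_self_eq_zero] at hprod
    rw [hprod] at hdiff
    filter_upwards [measure_eq_zero_iff_ae_notMem.1 hprod, measure_eq_zero_iff_ae_notMem.1 hdiff]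
      with ω h1 h2
    simp only [Set.mem_sdiff, mem_ofPred_eq, not_and, not_not] at h1 h2
    exact ⟨h1, h2⟩
  have hall : ∀ᵐ ω ∂μ, ∀ q : ℚ, (X ω ≤ q ↔ U ω < cdf (μ.map X) q) :=
    ae_all_iff.2 fun q => key q
  filter_upwards [hall, ae_mem_of_map_eq_unif hU] with ω h hω
  refine le_antisymm ?_ ?_
  · refine le_of_forall_rat_lt_imp_le fun q hq => le_quantile hω ?_
    by_contra h'
    exact absurd ((h q).2 (not_le.1 h')) (not_le.2 hq)
  · exact le_of_forall_lt_rat_imp_le fun q hq => quantile_le hω ((h q).1 hq.le)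

theorem ae_eq_quantile_cdf (hX : AEMeasurable X μ) (hc : Continuous (cdf (μ.map X))) :
    X =ᵐ[μ] fun ω => quantile μ X (cdf (μ.map X) (X ω)) := by
  refine ae_eq_quantile_of_comonotonic (map_cdf_eq_unif hX hc) hX (.of_forall fun p => ?_)
  rcases le_total (X p.1) (X p.2) with h | h
  · exact mul_nonneg (sub_nonneg.2 (monotone_cdf _ h)) (sub_nonneg.2 h)
  · exact mul_nonneg_of_nonpos_of_nonpos (sub_nonpos.2 (monotone_cdf _ h)) (sub_nonpos.2 h)

end Quantile

/-! ### Hardy-Littlewood rearrangement and its equality case. -/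

section Rearrangement

open Filter Topology

/-- By monotonicity `Q(1 - z)` exceeds `t` on an initial segment of the `z`, and `a` is its length.
Whether the endpoint belongs to it is left open, which costs only a null set. -/
theorem exists_threshold {Q : ℝ → ℝ} (hQ : MonotoneOn Q (Ioo 0 1)) (t : ℝ) :
    ∃ a ∈ Icc (0 : ℝ) 1, ∀ z ∈ Ioo (0 : ℝ) 1,
      (z < a → t < Q (1 - z)) ∧ (t < Q (1 - z) → z ≤ a) := by
  have hmem : ∀ z ∈ Ioo (0 : ℝ) 1, 1 - z ∈ Ioo (0 : ℝ) 1 := fun z hz =>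
    ⟨by linarith [hz.2], by linarith [hz.1]⟩
  -- The added point `0` gives the supremum the right value when `Q` never exceeds `t`.
  let S : Set ℝ := insert 0 {z | z ∈ Ioo (0 : ℝ) 1 ∧ t < Q (1 - z)}
  have hS1 : ∀ z ∈ S, z ≤ 1 := by
    rintro z (rfl | hz)
    · exact zero_le_one
    · exact hz.1.2.le
  have hSb : BddAbove S := ⟨1, hS1⟩
  refine ⟨sSup S, ⟨le_csSup hSb (mem_insert _ _), csSup_le ⟨0, mem_insert _ _⟩ hS1⟩,
    fun z hz => ⟨fun h => ?_, fun h => le_csSup hSb (mem_insert_of_mem _ ⟨hz, h⟩)⟩⟩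
  obtain ⟨x, hx, hzx⟩ := exists_lt_of_lt_csSup ⟨0, mem_insert _ _⟩ h
  rcases hx with rfl | hx
  · exact absurd hzx (not_lt.2 hz.1.le)
  · exact hx.2.trans_le (hQ (hmem x hx.1) (hmem z hz) (by linarith))

theorem aemeasurable_comp_one_sub {Q : ℝ → ℝ} (hQ : AEMeasurable Q unif) :
    AEMeasurable (fun y => Q (1 - y)) unif := by
  have h : Measurable fun y : ℝ => 1 - y := by fun_prop
  exact AEMeasurable.comp_measurable (f := fun y => 1 - y) (by rwa [map_one_sub_unif]) h

theorem lintegral_comp_one_sub (f : ℝ → ENNReal) (hf : AEMeasurable f unif) :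
    ∫⁻ y, f (1 - y) ∂unif = ∫⁻ y, f y ∂unif := by
  have h : AEMeasurable (fun y : ℝ => 1 - y) unif := by fun_prop
  have := lintegral_map' (f := f) (by rwa [map_one_sub_unif]) h
  rw [← this, map_one_sub_unif]

variable {Ω : Type*} [MeasurableSpace Ω] {μ : Measure Ω} {V : Ω → ℝ}

theorem lintegral_comp_uniform (hV : μ.map V = unif) {f : ℝ → ENNReal} (hf : AEMeasurable f unif) :
    ∫⁻ ω, f (V ω) ∂μ = ∫⁻ y, f y ∂unif := by
  rw [← hV] at hf ⊢
  exact (lintegral_map' hf (aemeasurable_of_map_eq_unif (by assumption))).symm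

theorem aemeasurable_comp_uniform {β : Type*} [MeasurableSpace β] (hV : μ.map V = unif)
    {f : ℝ → β} (hf : AEMeasurable f unif) : AEMeasurable (fun ω => f (V ω)) μ :=
  AEMeasurable.comp_aemeasurable (hV ▸ hf) (aemeasurable_of_map_eq_unif hV)

theorem measure_uniform_lt (hV : μ.map V = unif) {p : ℝ} (hp : p ≤ 1) :
    μ {ω | V ω < p} = ENNReal.ofReal p := by
  rw [← unif_Iio hp, ← hV,
    Measure.map_apply_of_aemeasurable (aemeasurable_of_map_eq_unif hV) measurableSet_Iio]
  rfl

theorem ae_ne_of_uniform (hV : μ.map V = unif) (p : ℝ) : ∀ᵐ ω ∂μ, V ω ≠ p := by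
  refine ae_of_ae_map (p := fun y => y ≠ p) (aemeasurable_of_map_eq_unif hV) ?_
  rw [hV]
  exact ae_restrict_of_ae (Measure.ae_ne volume p)

theorem setOf_lt_ae_eq (hV : μ.map V = unif) {Q : ℝ → ℝ} {t a : ℝ}
    (ha : ∀ z ∈ Ioo (0 : ℝ) 1, (z < a → t < Q (1 - z)) ∧ (t < Q (1 - z) → z ≤ a)) :
    {ω | t < Q (1 - V ω)} =ᵐ[μ] {ω | V ω < a} := by
  filter_upwards [ae_mem_of_map_eq_unif hV, ae_ne_of_uniform hV a] with ω h1 h2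
  exact propext ⟨fun h => lt_of_le_of_ne ((ha _ h1).2 h) h2, (ha _ h1).1⟩

theorem withDensity_le_of_ae_le {k : Ω → ENNReal} {S : Set Ω} (hS : NullMeasurableSet S μ)
    {c : ENNReal} (h : ∀ᵐ ω ∂μ, ω ∈ S → k ω ≤ c) : μ.withDensity k S ≤ c * μ S := by
  rw [withDensity_apply₀ _ hS, ← setLIntegral_const]
  exact lintegral_mono_ae ((ae_restrict_iff'₀ hS).2 h)

theorem le_withDensity_of_ae_le {k : Ω → ENNReal} {S : Set Ω} (hS : NullMeasurableSet S μ)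
    {c : ENNReal} (h : ∀ᵐ ω ∂μ, ω ∈ S → c ≤ k ω) : c * μ S ≤ μ.withDensity k S := by
  rw [withDensity_apply₀ _ hS, ← setLIntegral_const]
  exact lintegral_mono_ae ((ae_restrict_iff'₀ hS).2 h)

/-- The cost of a nonnegative payoff as a layer-cake integral. -/
theorem lintegral_mul_eq_layercake {k : Ω → ENNReal} (hk : AEMeasurable k μ) {X : Ω → ℝ}
    (hX : AEMeasurable X μ) (h0 : ∀ᵐ ω ∂μ, 0 ≤ X ω) :
    ∫⁻ ω, k ω * ENNReal.ofReal (X ω) ∂μ = ∫⁻ t in Ioi 0, μ.withDensity k {ω | t < X ω} := by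
  have hac : μ.withDensity k ≪ μ := withDensity_absolutelyContinuous _ _
  rw [← lintegral_eq_lintegral_meas_lt _ (hac.ae_le h0) (hX.mono_ac hac),
    lintegral_withDensity_eq_lintegral_mul₀ hk hX.ennreal_ofReal]
  rfl

theorem lintegral_mul_quantile (hV : μ.map V = unif) {H Q : ℝ → ℝ} (hH : MonotoneOn H (Ioo 0 1))
    (hQ : AEMeasurable Q unif) :
    ∫⁻ y, ENNReal.ofReal (H y) * ENNReal.ofReal (Q y) ∂unif =
      ∫⁻ ω, ENNReal.ofReal (H (V ω)) * ENNReal.ofReal (Q (V ω)) ∂μ :=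
  (lintegral_comp_uniform hV (f := fun y => ENNReal.ofReal (H y) * ENNReal.ofReal (Q y))
    ((aemeasurable_of_monotoneOn hH).ennreal_ofReal.mul hQ.ennreal_ofReal)).symm

variable [IsProbabilityMeasure μ]

/-- For `p = 0` or `p = 1` the value `H p` is not controlled, but both events are null or both are
full. -/
theorem setOf_lt_one_ae_eq (hV : μ.map V = unif) {A : Set Ω} (hA : NullMeasurableSet A μ)
    {p : ℝ} (hp : p ∈ Icc (0 : ℝ) 1) (hp' : p ∉ Ioo (0 : ℝ) 1) (hμ : μ A = ENNReal.ofReal p) :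
    A =ᵐ[μ] {ω | V ω < p} := by
  rcases hp.1.eq_or_lt with rfl | h0
  · rw [ENNReal.ofReal_zero] at hμ
    have h2 := measure_uniform_lt hV zero_le_one
    rw [ENNReal.ofReal_zero] at h2
    exact (ae_eq_empty.2 hμ).trans (ae_eq_empty.2 h2).symm
  · obtain rfl : p = 1 := by
      by_contra h; exact hp' ⟨h0, lt_of_le_of_ne hp.2 h⟩
    rw [ENNReal.ofReal_one] at hμ
    have h2 := measure_uniform_lt hV le_rfl
    rw [ENNReal.ofReal_one] at h2
    have hB : NullMeasurableSet {ω | V ω < 1} μ :=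
      (aemeasurable_of_map_eq_unif hV).nullMeasurable measurableSet_Iio
    exact ((ae_eq_univ_iff_measure_eq hA).2 (by rw [hμ, measure_univ])).trans
      ((ae_eq_univ_iff_measure_eq hB).2 (by rw [h2, measure_univ])).symm

/-- Among the events of given probability, a monotone weight of a uniform variable is smallest on
the lower tail event. -/
theorem withDensity_lowerTail_le (hV : μ.map V = unif) {H : ℝ → ℝ} (hH : MonotoneOn H (Ioo 0 1))
    {A : Set Ω} (hA : NullMeasurableSet A μ) {p : ℝ} (hp : p ∈ Icc (0 : ℝ) 1)
    (hμ : μ A = ENNReal.ofReal p) :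
    μ.withDensity (fun ω => ENNReal.ofReal (H (V ω))) {ω | V ω < p} ≤
      μ.withDensity (fun ω => ENNReal.ofReal (H (V ω))) A := by
  set ν := μ.withDensity (fun ω => ENNReal.ofReal (H (V ω))) with hν
  have hac : ν ≪ μ := withDensity_absolutelyContinuous _ _
  by_cases hp' : p ∈ Ioo (0 : ℝ) 1
  · have hB : NullMeasurableSet {ω | V ω < p} μ :=
      (aemeasurable_of_map_eq_unif hV).nullMeasurable measurableSet_Iio
    have hd := measure_sdiff_comm hA hB (hμ.trans (measure_uniform_lt hV hp.2).symm)
    rw [← measure_inter_add_sdiff₀ A (hB.mono_ac hac),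
      ← measure_inter_add_sdiff₀ {ω | V ω < p} (hA.mono_ac hac), inter_comm]
    gcongr 1
    -- The two differences have the same probability, and the weight is at most `H p` on the first
    -- and at least `H p` on the second.
    calc ν ({ω | V ω < p} \ A) ≤ ENNReal.ofReal (H p) * μ ({ω | V ω < p} \ A) := by
          refine withDensity_le_of_ae_le (hB.diff hA) ?_
          filter_upwards [ae_mem_of_map_eq_unif hV] with ω h1 h2
          exact ENNReal.ofReal_le_ofReal (hH h1 hp' (le_of_lt h2.1))
      _ = ENNReal.ofReal (H p) * μ (A \ {ω | V ω < p}) := by rw [hd]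
      _ ≤ _ := by
          refine le_withDensity_of_ae_le (hA.diff hB) ?_
          filter_upwards [ae_mem_of_map_eq_unif hV] with ω h1 h2
          exact ENNReal.ofReal_le_ofReal (hH hp' h1 (not_lt.1 h2.2))
  · exact (measure_congr (hac.ae_eq (setOf_lt_one_ae_eq hV hA hp hp' hμ))).ge

/-- Equality case of the lower-tail bound. After the finite common part is cancelled, the weight
must equal `H p` almost everywhere on `{V < p} \ A`; by strict monotonicity it is smaller there, so
this difference is null. -/
theorem ae_eq_lowerTail_of_withDensity_le (hV : μ.map V = unif) {H : ℝ → ℝ}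
    (hH : StrictMonoOn H (Ioo 0 1)) (hpos : ∀ y ∈ Ioo (0 : ℝ) 1, 0 ≤ H y)
    {A : Set Ω} (hA : NullMeasurableSet A μ) {p : ℝ} (hp : p ∈ Icc (0 : ℝ) 1)
    (hμ : μ A = ENNReal.ofReal p)
    (hle : μ.withDensity (fun ω => ENNReal.ofReal (H (V ω))) A ≤
      μ.withDensity (fun ω => ENNReal.ofReal (H (V ω))) {ω | V ω < p})
    (hfin : μ.withDensity (fun ω => ENNReal.ofReal (H (V ω))) A ≠ ⊤) :
    A =ᵐ[μ] {ω | V ω < p} := by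
  set ν := μ.withDensity (fun ω => ENNReal.ofReal (H (V ω))) with hν
  have hac : ν ≪ μ := withDensity_absolutelyContinuous _ _
  by_cases hp' : p ∈ Ioo (0 : ℝ) 1
  · have hB : NullMeasurableSet {ω | V ω < p} μ :=
      (aemeasurable_of_map_eq_unif hV).nullMeasurable measurableSet_Iio
    have hd := measure_sdiff_comm hA hB (hμ.trans (measure_uniform_lt hV hp.2).symm)
    rw [← measure_inter_add_sdiff₀ A (hB.mono_ac hac),
      ← measure_inter_add_sdiff₀ {ω | V ω < p} (hA.mono_ac hac), inter_comm] at hle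
    have hle' := (ENNReal.add_le_add_iff_left
      (measure_ne_top_of_subset inter_subset_right hfin)).1 hle
    have h3 : ENNReal.ofReal (H p) * μ (A \ {ω | V ω < p}) ≤ ν (A \ {ω | V ω < p}) := by
      refine le_withDensity_of_ae_le (hA.diff hB) ?_
      filter_upwards [ae_mem_of_map_eq_unif hV] with ω h1 h2
      exact ENNReal.ofReal_le_ofReal (hH.monotoneOn hp' h1 (not_lt.1 h2.2))
    rw [← hd] at h3
    have hBA : NullMeasurableSet ({ω | V ω < p} \ A) μ := hB.diff hA
    have h4 := h3.trans hle'
    rw [← setLIntegral_const, hν, withDensity_apply₀ _ hBA] at h4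
    have hae := (ae_restrict_iff'₀ hBA).1 (ae_eq_of_ae_le_of_lintegral_le
      (f := fun ω => ENNReal.ofReal (H (V ω))) (g := fun _ => ENNReal.ofReal (H p))
      (μ := μ.restrict ({ω | V ω < p} \ A)) ((ae_restrict_iff'₀ hBA).2 (by
        filter_upwards [ae_mem_of_map_eq_unif hV] with ω h1 h2
        exact ENNReal.ofReal_le_ofReal (hH.monotoneOn h1 hp' (le_of_lt h2.1))))
      (by
        rw [← withDensity_apply₀ _ hBA, ← hν]
        refine ne_top_of_le_ne_top (b := ENNReal.ofReal (H p) * μ ({ω | V ω < p} \ A))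
          (ENNReal.mul_ne_top ENNReal.ofReal_ne_top (measure_ne_top _ _)) ?_
        refine withDensity_le_of_ae_le hBA ?_
        filter_upwards [ae_mem_of_map_eq_unif hV] with ω h1 h2
        exact ENNReal.ofReal_le_ofReal (hH.monotoneOn h1 hp' (le_of_lt h2.1)))
      aemeasurable_const h4)
    have h5 : μ ({ω | V ω < p} \ A) = 0 := by
      rw [measure_eq_zero_iff_ae_notMem]
      filter_upwards [hae, ae_mem_of_map_eq_unif hV] with ω h1 h2 h3
      refine absurd (h1 h3) (ne_of_lt ?_)
      rw [ENNReal.ofReal_lt_ofReal_iff']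
      have := hH h2 hp' h3.1
      exact ⟨this, (hpos _ h2).trans_lt this⟩
    rw [hd] at h5
    refine ae_eq_set.2 ⟨h5, hd.trans h5⟩
  · exact setOf_lt_one_ae_eq hV hA hp hp' hμ

theorem measure_lt_quantile (hV : μ.map V = unif) {X : Ω → ℝ} (hX : AEMeasurable X μ) (t : ℝ) :
    μ {ω | t < X ω} = μ {ω | t < quantile μ X (1 - V ω)} := by
  have hm := aemeasurable_of_monotoneOn (monotoneOn_quantile (μ := μ) (X := X))
  have h1 : μ {ω | t < X ω} = (μ.map X) (Ioi t) :=
    (Measure.map_apply_of_aemeasurable hX measurableSet_Ioi).symm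
  have h2 : unif.map (quantile μ X) = μ.map (fun ω => quantile μ X (1 - V ω)) := by
    have h3 : unif = μ.map (fun ω => 1 - V ω) := by
      rw [← map_one_sub_unif, ← hV, AEMeasurable.map_map_of_aemeasurable (by fun_prop)
        (aemeasurable_of_map_eq_unif hV)]; rfl
    conv_lhs => rw [h3]
    rw [AEMeasurable.map_map_of_aemeasurable (by rwa [← h3])
      ((aemeasurable_of_map_eq_unif hV).const_sub 1)]; rfl
  rw [h1, ← map_quantile hX, h2, Measure.map_apply_of_aemeasurable
    (aemeasurable_comp_uniform hV (aemeasurable_comp_one_sub hm)) measurableSet_Ioi]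
  rfl

theorem withDensity_quantile_le (hV : μ.map V = unif) {H : ℝ → ℝ} (hH : MonotoneOn H (Ioo 0 1))
    {X : Ω → ℝ} (hX : AEMeasurable X μ) (t : ℝ) :
    μ.withDensity (fun ω => ENNReal.ofReal (H (V ω))) {ω | t < quantile μ X (1 - V ω)} ≤
      μ.withDensity (fun ω => ENNReal.ofReal (H (V ω))) {ω | t < X ω} := by
  obtain ⟨a, ha, hat⟩ := exists_threshold (monotoneOn_quantile (μ := μ) (X := X)) t
  have hae := setOf_lt_ae_eq hV hat
  rw [measure_congr ((withDensity_absolutelyContinuous _ _).ae_eq hae)]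
  refine withDensity_lowerTail_le hV hH (hX.nullMeasurable measurableSet_Ioi) ha ?_
  rw [← measure_uniform_lt hV ha.2, ← measure_congr hae]
  exact measure_lt_quantile hV hX t

/-- Hardy-Littlewood: the antimonotone rearrangement is the cheapest payoff of a given law. -/
theorem lintegral_mul_quantile_le (hV : μ.map V = unif) {H : ℝ → ℝ} (hH : MonotoneOn H (Ioo 0 1))
    {X : Ω → ℝ} (hX : AEMeasurable X μ) (h0 : ∀ᵐ ω ∂μ, 0 ≤ X ω) :
    ∫⁻ y, ENNReal.ofReal (H y) * ENNReal.ofReal (quantile μ X (1 - y)) ∂unif ≤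
      ∫⁻ ω, ENNReal.ofReal (H (V ω)) * ENNReal.ofReal (X ω) ∂μ := by
  have hQ := aemeasurable_comp_one_sub (aemeasurable_of_monotoneOn (monotoneOn_quantile (μ := μ)
    (X := X)))
  have hk := (aemeasurable_comp_uniform hV (aemeasurable_of_monotoneOn hH)).ennreal_ofReal
  rw [lintegral_mul_quantile hV hH hQ, lintegral_mul_eq_layercake hk hX h0,
    lintegral_mul_eq_layercake hk (aemeasurable_comp_uniform hV hQ)]
  · exact lintegral_mono fun t => withDensity_quantile_le hV hH hX t
  · filter_upwards [ae_mem_of_map_eq_unif hV] with ω hω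
    exact quantile_nonneg hX h0 ⟨by linarith [hω.2], by linarith [hω.1]⟩

/-- The cheapest payoff of a given law is unique when the weight is strictly monotone. -/
theorem ae_eq_of_lintegral_le_quantile (hV : μ.map V = unif) {H : ℝ → ℝ}
    (hH : StrictMonoOn H (Ioo 0 1)) (hpos : ∀ y ∈ Ioo (0 : ℝ) 1, 0 ≤ H y)
    {X : Ω → ℝ} (hX : AEMeasurable X μ) (h0 : ∀ᵐ ω ∂μ, 0 ≤ X ω)
    (hfin : ∫⁻ ω, ENNReal.ofReal (H (V ω)) * ENNReal.ofReal (X ω) ∂μ ≠ ⊤)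
    (hle : ∫⁻ ω, ENNReal.ofReal (H (V ω)) * ENNReal.ofReal (X ω) ∂μ ≤
      ∫⁻ y, ENNReal.ofReal (H y) * ENNReal.ofReal (quantile μ X (1 - y)) ∂unif) :
    X =ᵐ[μ] fun ω => quantile μ X (1 - V ω) := by
  have hfin' := ne_top_of_le_ne_top hfin (lintegral_mul_quantile_le hV hH.monotoneOn hX h0)
  have hQ := aemeasurable_comp_one_sub (aemeasurable_of_monotoneOn (monotoneOn_quantile (μ := μ)
    (X := X)))
  have hk := (aemeasurable_comp_uniform hV (aemeasurable_of_monotoneOn hH.monotoneOn)).ennreal_ofReal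
  have hY0 : ∀ᵐ ω ∂μ, 0 ≤ quantile μ X (1 - V ω) := by
    filter_upwards [ae_mem_of_map_eq_unif hV] with ω hω
    exact quantile_nonneg hX h0 ⟨by linarith [hω.2], by linarith [hω.1]⟩
  rw [lintegral_mul_quantile hV hH.monotoneOn hQ,
    lintegral_mul_eq_layercake hk (aemeasurable_comp_uniform hV hQ) hY0] at hle hfin'
  rw [lintegral_mul_eq_layercake hk hX h0] at hle hfin
  set ν := μ.withDensity (fun ω => ENNReal.ofReal (H (V ω))) with hν
  have hanti : Antitone fun t => ν {ω | t < X ω} := fun s t hst =>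
    measure_mono fun ω (hω : t < X ω) => lt_of_le_of_lt hst hω
  -- The inequality holds layer by layer and the finite totals agree, so almost every layer is an
  -- equality case.
  have hae := ae_eq_of_ae_le_of_lintegral_le
    (.of_forall fun t => withDensity_quantile_le hV hH.monotoneOn hX t) hfin'
    hanti.measurable.aemeasurable hle
  have hft := ae_lt_top' hanti.measurable.aemeasurable hfin
  have hgood : ∀ᵐ t ∂(volume.restrict (Ioi (0 : ℝ))),
      {ω | t < X ω} =ᵐ[μ] {ω | t < quantile μ X (1 - V ω)} := by
    filter_upwards [hae, hft] with t h1 h2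
    obtain ⟨a, ha, hat⟩ := exists_threshold (monotoneOn_quantile (μ := μ) (X := X)) t
    have hae := setOf_lt_ae_eq hV hat
    rw [measure_congr ((withDensity_absolutelyContinuous _ _).ae_eq hae)] at h1
    refine (ae_eq_lowerTail_of_withDensity_le hV hH hpos (hX.nullMeasurable measurableSet_Ioi) ha ?_
      h1.ge h2.ne).trans hae.symm
    rw [← measure_uniform_lt hV ha.2, ← measure_congr hae]
    exact measure_lt_quantile hV hX t
  have hdense : ∀ a b : ℝ, 0 ≤ a → a < b →
      ∃ t, a < t ∧ t < b ∧ {ω | t < X ω} =ᵐ[μ] {ω | t < quantile μ X (1 - V ω)} := by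
    intro a b ha hab
    by_contra! hcon
    have h1 : (volume.restrict (Ioi (0 : ℝ))) (Ioo a b) = 0 := by
      refine measure_mono_null ?_ hgood
      exact fun t ht => hcon t ht.1 ht.2
    rw [Measure.restrict_apply measurableSet_Ioo, inter_eq_self_of_subset_left
      (show Ioo a b ⊆ Ioi 0 from fun x hx => lt_of_le_of_lt ha hx.1), Real.volume_Ioo, ENNReal.ofReal_eq_zero] at h1
    linarith
  -- Good thresholds are known only for almost every `t`, so a given rational may be bad. One good
  -- threshold between each pair of nonnegative rationals yields a countable family that still
  -- separates nonnegative reals.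
  have hchoice : ∀ p : ℚ × ℚ, ∃ t : ℝ, (0 ≤ (p.1 : ℝ) → (p.1 : ℝ) < p.2 → p.1 < t ∧ t < p.2 ∧
      {ω | t < X ω} =ᵐ[μ] {ω | t < quantile μ X (1 - V ω)}) := by
    intro p
    by_cases h : 0 ≤ (p.1 : ℝ) ∧ (p.1 : ℝ) < p.2
    · obtain ⟨t, ht⟩ := hdense p.1 p.2 h.1 h.2
      exact ⟨t, fun _ _ => ht⟩
    · exact ⟨0, fun h1 h2 => absurd ⟨h1, h2⟩ h⟩
  choose τ hτ using hchoice
  have hall : ∀ᵐ ω ∂μ, ∀ p : ℚ × ℚ, 0 ≤ (p.1 : ℝ) → (p.1 : ℝ) < p.2 →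
      (τ p < X ω ↔ τ p < quantile μ X (1 - V ω)) := by
    refine ae_all_iff.2 fun p => ?_
    by_cases h : 0 ≤ (p.1 : ℝ) ∧ (p.1 : ℝ) < p.2
    · filter_upwards [(hτ p h.1 h.2).2.2] with ω hω _ _
      exact iff_of_eq hω
    · exact .of_forall fun ω h1 h2 => absurd ⟨h1, h2⟩ h
  have hno : ∀ (x y : ℝ), 0 ≤ x → x < y → (∀ p : ℚ × ℚ, 0 ≤ (p.1 : ℝ) → (p.1 : ℝ) < p.2 →
      (τ p < x ↔ τ p < y)) → False := by
    intro x y hx hxy h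
    obtain ⟨p, hp1, hp2⟩ := exists_rat_btwn hxy
    obtain ⟨q, hq1, hq2⟩ := exists_rat_btwn hp2
    have h1 := hτ (p, q) (hx.trans hp1.le) hq1
    have h2 := (h (p, q) (hx.trans hp1.le) hq1).2 (h1.2.1.trans hq2)
    exact absurd (h1.1.trans h2) (not_lt.2 hp1.le)
  filter_upwards [hall, h0, hY0] with ω h1 h2 h3
  rcases lt_trichotomy (X ω) (quantile μ X (1 - V ω)) with h | h | h
  · exact (hno _ _ h2 h h1).elim
  · exact h
  · exact (hno _ _ h3 h fun p hp hp' => (h1 p hp hp').symm).elim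

end Rearrangement

/-! ### The inverse of the weighting function. -/

section Weighting

open Filter Topology

/-- The inverse of a weighting function on the unit interval. -/
noncomputable abbrev winv (w : ℝ → ℝ) : ℝ → ℝ := Function.invFunOn w (Icc 0 1)

variable {w : ℝ → ℝ} (hw : IsWeighting w)
include hw

theorem IsWeighting.surjOn : SurjOn w (Icc 0 1) (Icc 0 1) := by
  have := intermediate_value_Icc (zero_le_one (α := ℝ)) hw.differentiableOn.continuousOn
  rwa [hw.map_zero, hw.map_one] at this

theorem IsWeighting.mapsTo : MapsTo w (Icc 0 1) (Icc 0 1) := fun _ hx =>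
  ⟨hw.map_zero ▸ hw.strictMonoOn.monotoneOn ⟨le_rfl, zero_le_one⟩ hx hx.1,
    hw.map_one ▸ hw.strictMonoOn.monotoneOn hx ⟨zero_le_one, le_rfl⟩ hx.2⟩

theorem IsWeighting.mapsTo_Ioo : MapsTo w (Ioo 0 1) (Ioo 0 1) := fun _ hx =>
  ⟨hw.map_zero ▸ hw.strictMonoOn ⟨le_rfl, zero_le_one⟩ (Ioo_subset_Icc_self hx) hx.1,
    hw.map_one ▸ hw.strictMonoOn (Ioo_subset_Icc_self hx) ⟨zero_le_one, le_rfl⟩ hx.2⟩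

theorem IsWeighting.winv_mem {x : ℝ} (hx : x ∈ Icc (0 : ℝ) 1) : winv w x ∈ Icc (0 : ℝ) 1 :=
  Function.invFunOn_mem (hw.surjOn hx)

theorem IsWeighting.apply_winv {x : ℝ} (hx : x ∈ Icc (0 : ℝ) 1) : w (winv w x) = x :=
  Function.invFunOn_eq (hw.surjOn hx)

theorem IsWeighting.winv_apply {x : ℝ} (hx : x ∈ Icc (0 : ℝ) 1) : winv w (w x) = x :=
  hw.strictMonoOn.injOn (hw.winv_mem (hw.mapsTo hx)) hx (hw.apply_winv (hw.mapsTo hx))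

theorem IsWeighting.winv_zero : winv w 0 = 0 := by
  have := hw.winv_apply (x := 0) ⟨le_rfl, zero_le_one⟩
  rwa [hw.map_zero] at this

theorem IsWeighting.winv_one : winv w 1 = 1 := by
  have := hw.winv_apply (x := 1) ⟨zero_le_one, le_rfl⟩
  rwa [hw.map_one] at this

theorem IsWeighting.strictMonoOn_winv : StrictMonoOn (winv w) (Icc 0 1) := by
  intro x hx y hy hxy
  rw [← hw.strictMonoOn.lt_iff_lt (hw.winv_mem hx) (hw.winv_mem hy), hw.apply_winv hx,
    hw.apply_winv hy]
  exact hxy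

theorem IsWeighting.lt_winv_iff {x y : ℝ} (hx : x ∈ Icc (0 : ℝ) 1) (hy : y ∈ Icc (0 : ℝ) 1) :
    x < winv w y ↔ w x < y := by
  rw [← hw.strictMonoOn.lt_iff_lt hx (hw.winv_mem hy), hw.apply_winv hy]

theorem IsWeighting.winv_mem_Ioo {x : ℝ} (hx : x ∈ Ioo (0 : ℝ) 1) : winv w x ∈ Ioo (0 : ℝ) 1 :=
  ⟨hw.winv_zero ▸ hw.strictMonoOn_winv ⟨le_rfl, zero_le_one⟩ (Ioo_subset_Icc_self hx) hx.1,
    hw.winv_one ▸ hw.strictMonoOn_winv (Ioo_subset_Icc_self hx) ⟨zero_le_one, le_rfl⟩ hx.2⟩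

/-- A monotone surjection of the unit interval onto itself has no jumps. -/
theorem IsWeighting.continuousOn_winv : ContinuousOn (winv w) (Icc 0 1) := by
  let v : Icc (0 : ℝ) 1 → Icc (0 : ℝ) 1 := fun x => ⟨winv w x, hw.winv_mem x.2⟩
  have hv : Monotone v := fun x y hxy => hw.strictMonoOn_winv.monotoneOn x.2 y.2 hxy
  have hs : Function.Surjective v := fun y =>
    ⟨⟨w y, hw.mapsTo y.2⟩, Subtype.ext (hw.winv_apply y.2)⟩
  rw [continuousOn_iff_continuous_domRestrict]
  exact continuous_subtype_val.comp (hv.continuous_of_surjective hs)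

end Weighting

/-! ### The function `φ`, its envelope `δ`, and the two budgets. -/

section Kernel

open Filter Topology

variable {Ω : Type*} [MeasurableSpace Ω]

/-- A pricing kernel: positive, integrable, with continuous distribution function. -/
structure IsKernel (μ : Measure Ω) (ρ : Ω → ℝ) : Prop where
  pos : ∀ᵐ ω ∂μ, 0 < ρ ω
  integrable : Integrable ρ μ
  continuous_cdf : Continuous (cdf (μ.map ρ))

variable {μ : Measure Ω} {ρ : Ω → ℝ} {w : ℝ → ℝ}

theorem IsKernel.aemeasurable (hρ : IsKernel μ ρ) : AEMeasurable ρ μ := hρ.integrable.aemeasurable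

theorem phi_eq (μ : Measure Ω) (ρ : Ω → ℝ) (w : ℝ → ℝ) (x : ℝ) :
    phi μ ρ w x = -∫ y in (0 : ℝ)..winv w (1 - x), quantile μ ρ y := rfl

theorem one_sub_mem {x : ℝ} (hx : x ∈ Icc (0 : ℝ) 1) : 1 - x ∈ Icc (0 : ℝ) 1 :=
  ⟨by linarith [hx.2], by linarith [hx.1]⟩

theorem one_sub_mem_Ioo {x : ℝ} (hx : x ∈ Ioo (0 : ℝ) 1) : 1 - x ∈ Ioo (0 : ℝ) 1 :=
  ⟨by linarith [hx.2], by linarith [hx.1]⟩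

theorem phi_one (hw : IsWeighting w) : phi μ ρ w 1 = 0 := by
  rw [phi_eq, sub_self, hw.winv_zero, intervalIntegral.integral_same, neg_zero]

/-- The budget of the quantile `Q` in the rank-dependent problem, `∫ Q dφ`. -/
noncomputable def phiCost (μ : Measure Ω) (ρ : Ω → ℝ) (w Q : ℝ → ℝ) : ENNReal :=
  ∫⁻ y, ENNReal.ofReal (quantile μ ρ y) * ENNReal.ofReal (Q (1 - w y)) ∂unif

/-- The budget of the quantile `Q` in the expected-utility problem, `∫ Q dδ`. -/
noncomputable def deltaCost (μ : Measure Ω) (ρ : Ω → ℝ) (w Q : ℝ → ℝ) : ENNReal :=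
  ∫⁻ y, ENNReal.ofReal (deltaDeriv μ ρ w (1 - y)) * ENNReal.ofReal (Q (1 - y)) ∂unif

theorem aemeasurable_comp_weighting (hw : IsWeighting w) {Q : ℝ → ℝ}
    (hQ : MonotoneOn Q (Ioo 0 1)) : AEMeasurable (fun y => Q (1 - w y)) unif := by
  refine aemeasurable_restrict_of_antitoneOn measurableSet_Ioo fun x hx y hy hxy => ?_
  refine hQ (one_sub_mem_Ioo (hw.mapsTo_Ioo hy)) (one_sub_mem_Ioo (hw.mapsTo_Ioo hx)) ?_
  have := hw.strictMonoOn.monotoneOn (Ioo_subset_Icc_self hx) (Ioo_subset_Icc_self hy) hxy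
  linarith

theorem phiCost_eq_layercake (hw : IsWeighting w) {Q : ℝ → ℝ}
    (hQ : MonotoneOn Q (Ioo 0 1)) (hQ0 : ∀ x ∈ Ioo (0 : ℝ) 1, 0 ≤ Q x) :
    phiCost μ ρ w Q = ∫⁻ t in Ioi 0,
      unif.withDensity (fun y => ENNReal.ofReal (quantile μ ρ y)) {y | t < Q (1 - w y)} := by
  refine lintegral_mul_eq_layercake (aemeasurable_of_monotoneOn monotoneOn_quantile).ennreal_ofReal
    (aemeasurable_comp_weighting hw hQ) ?_
  filter_upwards [ae_mem_unif] with y hy using hQ0 _ (one_sub_mem_Ioo (hw.mapsTo_Ioo hy))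

theorem setOf_lt_weighting_ae_eq (hw : IsWeighting w) {Q : ℝ → ℝ} {t a : ℝ}
    (ha : a ∈ Icc (0 : ℝ) 1)
    (hat : ∀ z ∈ Ioo (0 : ℝ) 1, (z < a → t < Q (1 - z)) ∧ (t < Q (1 - z) → z ≤ a)) :
    {y | t < Q (1 - w y)} =ᵐ[unif] {y | y < winv w a} := by
  filter_upwards [ae_mem_unif, ae_restrict_of_ae (Measure.ae_ne volume (winv w a))] with y h1 h2
  have h3 := hat _ (hw.mapsTo_Ioo h1)
  have h1' := Ioo_subset_Icc_self h1
  refine propext ⟨fun h => lt_of_le_of_ne ?_ h2, fun h => h3.1 ((hw.lt_winv_iff h1' ha).1 h)⟩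
  rw [← hw.strictMonoOn.le_iff_le h1' (hw.winv_mem ha), hw.apply_winv ha]
  exact h3.2 h

variable [IsProbabilityMeasure μ]

theorem IsKernel.quantile_pos (hρ : IsKernel μ ρ) {y : ℝ} (hy : y ∈ Ioo (0 : ℝ) 1) :
    0 < quantile μ ρ y := by
  have hy' : y / 2 ∈ Ioo (0 : ℝ) 1 := ⟨by linarith [hy.1], by linarith [hy.1, hy.2]⟩
  exact (quantile_nonneg hρ.aemeasurable (hρ.pos.mono fun _ h => h.le) hy').trans_lt
    (strictMonoOn_quantile hρ.continuous_cdf hy' hy (by linarith [hy.1]))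

theorem integrable_quantile {X : Ω → ℝ} (hX : Integrable X μ) : Integrable (quantile μ X) unif := by
  have hm := aemeasurable_of_monotoneOn (monotoneOn_quantile (μ := μ) (X := X))
  have h1 : Integrable id (μ.map X) :=
    (integrable_map_measure aestronglyMeasurable_id hX.aemeasurable).2 hX
  rw [← map_quantile hX.aemeasurable] at h1
  exact (integrable_map_measure aestronglyMeasurable_id hm).1 h1

theorem IsKernel.intervalIntegrable (hρ : IsKernel μ ρ) {a b : ℝ} (ha : a ∈ Icc (0 : ℝ) 1)
    (hb : b ∈ Icc (0 : ℝ) 1) : IntervalIntegrable (quantile μ ρ) volume a b := by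
  have h : IntervalIntegrable (quantile μ ρ) volume 0 1 := by
    rw [intervalIntegrable_iff_integrableOn_Ioo_of_le zero_le_one]
    exact integrable_quantile hρ.integrable
  refine h.mono_set ?_
  rw [uIcc_of_le zero_le_one]
  exact uIcc_subset_Icc ha hb

theorem strictMonoOn_phi (hρ : IsKernel μ ρ) (hw : IsWeighting w) :
    StrictMonoOn (phi μ ρ w) (Icc 0 1) := by
  intro x hx y hy hxy
  have hx' := hw.winv_mem (one_sub_mem hx)
  have hy' := hw.winv_mem (one_sub_mem hy)
  have hlt := hw.strictMonoOn_winv (one_sub_mem hy) (one_sub_mem hx) (by linarith)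
  rw [phi_eq, phi_eq, neg_lt_neg_iff, ← sub_pos,
    intervalIntegral.integral_interval_sub_left
      (hρ.intervalIntegrable ⟨le_rfl, zero_le_one⟩ hx')
      (hρ.intervalIntegrable ⟨le_rfl, zero_le_one⟩ hy')]
  refine intervalIntegral.intervalIntegral_pos_of_pos_on (hρ.intervalIntegrable hy' hx') ?_ hlt
  exact fun z hz => hρ.quantile_pos ⟨hy'.1.trans_lt hz.1, hz.2.trans_le hx'.2⟩

theorem continuousOn_phi (hρ : IsKernel μ ρ) (hw : IsWeighting w) :
    ContinuousOn (phi μ ρ w) (Icc 0 1) := by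
  have h1 : ContinuousOn (fun z => ∫ y in (0 : ℝ)..z, quantile μ ρ y) (Icc 0 1) := by
    have := intervalIntegral.continuousOn_primitive_interval (a := (0 : ℝ)) (b := 1)
      (f := quantile μ ρ) (μ := volume) (by
        rw [uIcc_of_le zero_le_one, integrableOn_Icc_iff_integrableOn_Ioo]
        exact integrable_quantile hρ.integrable)
    rwa [uIcc_of_le zero_le_one] at this
  refine (h1.comp (f := fun x => winv w (1 - x)) (hw.continuousOn_winv.comp
    (f := fun x => 1 - x) (by fun_prop) fun x hx => one_sub_mem hx) fun x hx =>
      hw.winv_mem (one_sub_mem hx)).neg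

theorem phi_le_zero (hρ : IsKernel μ ρ) (hw : IsWeighting w) :
    ∀ t ∈ Icc (0 : ℝ) 1, phi μ ρ w t ≤ 0 := fun t ht => by
  rw [← phi_one (μ := μ) (ρ := ρ) hw]
  exact (strictMonoOn_phi hρ hw).monotoneOn ht ⟨zero_le_one, le_rfl⟩ ht.2

theorem concaveEnvelope_phi_one (hρ : IsKernel μ ρ) (hw : IsWeighting w) :
    concaveEnvelope (phi μ ρ w) 1 = 0 := by
  rw [concaveEnvelope_one (phi_le_zero hρ hw), phi_one hw]

/-- The strict inequality makes the slopes of `δ` towards the endpoint `1` positive, and with them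
the new kernel. -/
theorem concaveEnvelope_phi_neg (hρ : IsKernel μ ρ) (hw : IsWeighting w) {x : ℝ}
    (hx : x ∈ Ico (0 : ℝ) 1) : concaveEnvelope (phi μ ρ w) x < 0 := by
  obtain ⟨c, hxc, hc1⟩ := exists_between hx.2
  have hc0 : 0 < c := hx.1.trans_lt hxc
  have hcm : c ∈ Icc (0 : ℝ) 1 := ⟨hc0.le, hc1.le⟩
  have hφc : phi μ ρ w c < 0 := by
    rw [← phi_one (μ := μ) (ρ := ρ) hw]
    exact strictMonoOn_phi hρ hw hcm ⟨zero_le_one, le_rfl⟩ hc1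
  set p := phi μ ρ w c with hp
  have hdiv : 0 < -p / c := div_pos (by linarith) hc0
  have hpc : -p / c * c = -p := div_mul_cancel₀ _ hc0.ne'
  -- The majorant is the line through `(0, φ(c))` and `(c, 0)`: left of `c` monotonicity gives `φ ≤
  -- φ(c)`, right of `c` one has `φ ≤ 0`, and at `x < c` the line is negative.
  refine (concaveEnvelope_le_of_concaveOn (concaveOn_affine p (-p / c) 0) ?_
    ⟨hx.1, hx.2.le⟩).trans_lt ?_
  · intro t ht
    rcases le_total t c with h | h
    · have := (strictMonoOn_phi hρ hw).monotoneOn ht hcm h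
      have := mul_nonneg hdiv.le ht.1
      rw [sub_zero]; linarith
    · have := phi_le_zero hρ hw t ht
      have := mul_le_mul_of_nonneg_left h hdiv.le
      rw [sub_zero]; linarith
  · have := mul_lt_mul_of_pos_left hxc hdiv
    rw [sub_zero]; linarith

theorem deltaDeriv_pos (hρ : IsKernel μ ρ) (hw : IsWeighting w) {y : ℝ} (hy : y ∈ Ioo (0 : ℝ) 1) :
    0 < deltaDeriv μ ρ w (1 - y) :=
  leftDeriv_reflect_pos (concaveOn_concaveEnvelope (phi_le_zero hρ hw))
    (fun x hx => by
      rw [concaveEnvelope_phi_one hρ hw]; exact concaveEnvelope_phi_neg hρ hw hx) hy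

theorem monotoneOn_deltaDeriv (hρ : IsKernel μ ρ) (hw : IsWeighting w) :
    MonotoneOn (fun y => deltaDeriv μ ρ w (1 - y)) (Ioo 0 1) :=
  monotoneOn_leftDeriv_reflect (concaveOn_concaveEnvelope (phi_le_zero hρ hw))

theorem rightContinuous_deltaDeriv (hρ : IsKernel μ ρ) (hw : IsWeighting w) {y : ℝ}
    (hy : y ∈ Ioo (0 : ℝ) 1) :
    ContinuousWithinAt (fun y => deltaDeriv μ ρ w (1 - y)) (Ici y) y :=
  rightContinuous_leftDeriv_reflect (concaveOn_concaveEnvelope (phi_le_zero hρ hw)) hy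

theorem integral_deltaDeriv (hρ : IsKernel μ ρ) (hw : IsWeighting w) {z : ℝ}
    (hz : z ∈ Icc (0 : ℝ) 1) :
    IntervalIntegrable (fun y => deltaDeriv μ ρ w (1 - y)) volume 0 z ∧
      ∫ y in (0 : ℝ)..z, deltaDeriv μ ρ w (1 - y) = -concaveEnvelope (phi μ ρ w) (1 - z) := by
  have h := intervalIntegrable_leftDeriv_reflect
    (concaveOn_concaveEnvelope (phi_le_zero hρ hw))
    (continuousOn_concaveEnvelope (phi_le_zero hρ hw) (continuousOn_phi hρ hw))
    (fun y hy => (deltaDeriv_pos hρ hw hy).le) hz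
  rw [concaveEnvelope_phi_one hρ hw, zero_sub] at h
  exact h

theorem withDensity_unif_Iio {H : ℝ → ℝ} (hpos : ∀ y ∈ Ioo (0 : ℝ) 1, 0 ≤ H y) {b : ℝ}
    (hb : b ∈ Icc (0 : ℝ) 1) (hH : IntervalIntegrable H volume 0 b) :
    unif.withDensity (fun y => ENNReal.ofReal (H y)) {y | y < b} =
      ENNReal.ofReal (∫ y in (0 : ℝ)..b, H y) := by
  have h1 : Iio b ∩ Ioo (0 : ℝ) 1 = Ioo 0 b := by
    ext x; simp only [mem_inter_iff, mem_Iio, mem_Ioo]; constructor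
    · rintro ⟨a, c, _⟩; exact ⟨c, a⟩
    · rintro ⟨a, c⟩; exact ⟨c, a, c.trans_le hb.2⟩
  change unif.withDensity _ (Iio b) = _
  rw [withDensity_apply _ measurableSet_Iio, Measure.restrict_restrict measurableSet_Iio, h1,
    intervalIntegral.integral_of_le hb.1, integral_Ioc_eq_integral_Ioo,
    ofReal_integral_eq_lintegral_ofReal]
  · rwa [intervalIntegrable_iff_integrableOn_Ioo_of_le hb.1] at hH
  · refine (ae_restrict_iff' measurableSet_Ioo).2 (.of_forall fun y hy => hpos y ?_)
    exact ⟨hy.1, hy.2.trans_le hb.2⟩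

/-- The layer of the budget at level `t` depends on `Q` only through the crossing point `1 - a`,
where it reads off `φ`. The same threshold serves for `δ`, so the budgets can be compared layer by
layer. -/
theorem phiCost_layer (hρ : IsKernel μ ρ) (hw : IsWeighting w) {Q : ℝ → ℝ} {t a : ℝ}
    (ha : a ∈ Icc (0 : ℝ) 1)
    (hat : ∀ z ∈ Ioo (0 : ℝ) 1, (z < a → t < Q (1 - z)) ∧ (t < Q (1 - z) → z ≤ a)) :
    unif.withDensity (fun y => ENNReal.ofReal (quantile μ ρ y)) {y | t < Q (1 - w y)} =
      ENNReal.ofReal (-phi μ ρ w (1 - a)) := by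
  rw [measure_congr ((withDensity_absolutelyContinuous _ _).ae_eq
      (setOf_lt_weighting_ae_eq hw ha hat)),
    withDensity_unif_Iio (fun y hy => (hρ.quantile_pos hy).le) (hw.winv_mem ha)
      (hρ.intervalIntegrable ⟨le_rfl, zero_le_one⟩ (hw.winv_mem ha)), phi_eq, neg_neg,
    sub_sub_cancel]

theorem deltaCost_layer (hρ : IsKernel μ ρ) (hw : IsWeighting w) {Q : ℝ → ℝ} {t a : ℝ}
    (ha : a ∈ Icc (0 : ℝ) 1)
    (hat : ∀ z ∈ Ioo (0 : ℝ) 1, (z < a → t < Q (1 - z)) ∧ (t < Q (1 - z) → z ≤ a)) :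
    unif.withDensity (fun y => ENNReal.ofReal (deltaDeriv μ ρ w (1 - y))) {y | t < Q (1 - y)} =
      ENNReal.ofReal (-concaveEnvelope (phi μ ρ w) (1 - a)) := by
  have hae : {y | t < Q (1 - y)} =ᵐ[unif] {y | y < a} :=
    setOf_lt_ae_eq (V := id) Measure.map_id hat
  have hi := integral_deltaDeriv hρ hw ha
  rw [measure_congr ((withDensity_absolutelyContinuous _ _).ae_eq hae),
    withDensity_unif_Iio (fun y hy => (deltaDeriv_pos hρ hw hy).le) ha hi.1, hi.2]

theorem deltaCost_eq_layercake (hρ : IsKernel μ ρ) (hw : IsWeighting w) {Q : ℝ → ℝ}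
    (hQ : MonotoneOn Q (Ioo 0 1)) (hQ0 : ∀ x ∈ Ioo (0 : ℝ) 1, 0 ≤ Q x) :
    deltaCost μ ρ w Q = ∫⁻ t in Ioi 0,
      unif.withDensity (fun y => ENNReal.ofReal (deltaDeriv μ ρ w (1 - y)))
        {y | t < Q (1 - y)} := by
  refine lintegral_mul_eq_layercake
    (aemeasurable_of_monotoneOn (monotoneOn_deltaDeriv hρ hw)).ennreal_ofReal
    (aemeasurable_comp_one_sub (aemeasurable_of_monotoneOn hQ)) ?_
  filter_upwards [ae_mem_unif] with y hy using hQ0 _ (one_sub_mem_Ioo hy)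

theorem deltaCost_le_phiCost (hρ : IsKernel μ ρ) (hw : IsWeighting w) {Q : ℝ → ℝ}
    (hQ : MonotoneOn Q (Ioo 0 1)) (hQ0 : ∀ x ∈ Ioo (0 : ℝ) 1, 0 ≤ Q x) :
    deltaCost μ ρ w Q ≤ phiCost μ ρ w Q := by
  rw [deltaCost_eq_layercake hρ hw hQ hQ0, phiCost_eq_layercake hw hQ hQ0]
  refine lintegral_mono fun t => ?_
  obtain ⟨a, ha, hat⟩ := exists_threshold hQ t
  rw [deltaCost_layer hρ hw ha hat, phiCost_layer hρ hw ha hat]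
  exact ENNReal.ofReal_le_ofReal (neg_le_neg
    (le_concaveEnvelope (phi_le_zero hρ hw) (one_sub_mem ha)))

/-- The two budgets agree for a quantile that is constant wherever `δ` is affine. -/
theorem phiCost_eq_deltaCost (hρ : IsKernel μ ρ) (hw : IsWeighting w) {Q : ℝ → ℝ}
    (hQ : MonotoneOn Q (Ioo 0 1)) (hQ0 : ∀ x ∈ Ioo (0 : ℝ) 1, 0 ≤ Q x)
    (hconst : ∀ l r : ℝ, 0 ≤ l → r ≤ 1 →
      (∀ x ∈ Ioo l r, ∀ y ∈ Ioo l r, deltaDeriv μ ρ w x = deltaDeriv μ ρ w y) →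
      ∀ x ∈ Ioo l r, ∀ y ∈ Ioo l r, Q x = Q y) :
    phiCost μ ρ w Q = deltaCost μ ρ w Q := by
  rw [deltaCost_eq_layercake hρ hw hQ hQ0, phiCost_eq_layercake hw hQ hQ0]
  refine lintegral_congr fun t => ?_
  obtain ⟨a, ha, hat⟩ := exists_threshold hQ t
  rw [deltaCost_layer hρ hw ha hat, phiCost_layer hρ hw ha hat]
  have hM := phi_le_zero hρ hw
  congr 2
  -- If `φ < δ` at the crossing point, then `δ` is affine around it and `Q` is constant there, so
  -- `Q` cannot cross the level `t` at that point. The endpoints are no exception, because the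
  -- envelope touches `φ` there.
  by_contra hne
  have hlt := lt_of_le_of_ne (le_concaveEnvelope hM (one_sub_mem ha)) hne
  have ha' : 1 - a ∈ Ioo (0 : ℝ) 1 := by
    refine ⟨lt_of_le_of_ne (one_sub_mem ha).1 fun h => ?_,
      lt_of_le_of_ne (one_sub_mem ha).2 fun h => ?_⟩
    · rw [← h, concaveEnvelope_zero hM] at hlt; exact lt_irrefl _ hlt
    · rw [h, concaveEnvelope_one hM] at hlt; exact lt_irrefl _ hlt
  obtain ⟨l, r, s, h0, hl, hr, h1, haff⟩ :=
    exists_affine_of_lt_concaveEnvelope hM (continuousOn_phi hρ hw) ha' hlt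
  have hD : ∀ x ∈ Ioo l r, deltaDeriv μ ρ w x = s := fun x hx =>
    leftDeriv_eq_of_affine haff ⟨hx.1, hx.2.le⟩
  obtain ⟨x, hlx, hxa⟩ := exists_between hl
  obtain ⟨y, hay, hyr⟩ := exists_between hr
  have hxy := hconst l r h0 h1 (fun x hx y hy => (hD x hx).trans (hD y hy).symm) x
    ⟨hlx, hxa.trans hr⟩ y ⟨hl.trans hay, hyr⟩
  have hx1 := hat (1 - x) (one_sub_mem_Ioo ⟨by linarith, by linarith⟩)
  have hy1 := hat (1 - y) (one_sub_mem_Ioo ⟨by linarith, by linarith⟩)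
  rw [sub_sub_cancel] at hx1 hy1
  have := hx1.2 (hxy ▸ hy1.1 (by linarith))
  linarith

end Kernel

/-! ### Extended-real integrals through positive and negative parts. -/

section ExtIntegral

open Filter Topology

variable {α : Type*} [MeasurableSpace α] {m : Measure α} {f g : α → EReal}

theorem extIntegral_mono (h : f ≤ᵐ[m] g) : extIntegral m f ≤ extIntegral m g := by
  refine EReal.sub_le_sub ?_ ?_
  · refine EReal.coe_ennreal_le_coe_ennreal_iff.2 (lintegral_mono_ae ?_)
    filter_upwards [h] with a ha using EReal.toENNReal_le_toENNReal ha
  · refine EReal.coe_ennreal_le_coe_ennreal_iff.2 (lintegral_mono_ae ?_)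
    filter_upwards [h] with a ha using EReal.toENNReal_le_toENNReal (EReal.neg_le_neg_iff.2 ha)

theorem extIntegral_congr (h : f =ᵐ[m] g) : extIntegral m f = extIntegral m g :=
  le_antisymm (extIntegral_mono h.le) (extIntegral_mono h.symm.le)

theorem extIntegral_map {β : Type*} [MeasurableSpace β] {X : β → α} {ν : Measure β}
    (hX : AEMeasurable X ν) (hf : Measurable f) :
    extIntegral (ν.map X) f = extIntegral ν fun b => f (X b) := by
  rw [extIntegral, extIntegral, lintegral_map' hf.ereal_toENNReal.aemeasurable hX,
    lintegral_map' (f := fun a => (-f a).toENNReal) hf.neg.ereal_toENNReal.aemeasurable hX]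

/-- The second hypothesis excludes `d = ⊤` with `b` finite; there the first could hold with `c = ⊤`,
although `⊤ - ⊤` is `⊥` on the right. -/
theorem ereal_ennreal_sub_le_sub {a b c d : ENNReal} (h : a + d ≤ c + b) (h' : d ≤ b) :
    (a : EReal) - b ≤ (c : EReal) - d := by
  by_cases hb : b = ⊤
  · simp [hb]
  have hd : d ≠ ⊤ := ne_top_of_le_ne_top hb h'
  by_cases hc : c = ⊤
  · subst hc
    lift d to NNReal using hd
    have : ((⊤ : ENNReal) : EReal) - ((d : ENNReal) : EReal) = ⊤ := by
      rw [EReal.coe_ennreal_top, sub_eq_add_neg]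
      exact EReal.top_add_of_ne_bot (by simp)
    rw [this]; exact le_top
  have ha : a ≠ ⊤ := ne_top_of_le_ne_top (ENNReal.add_ne_top.2 ⟨hc, hb⟩) (le_self_add.trans h)
  lift a to NNReal using ha
  lift b to NNReal using hb
  lift c to NNReal using hc
  lift d to NNReal using hd
  have h1 : (a : ℝ) + d ≤ c + b := by exact_mod_cast h
  have h2 : ((a : ℝ) - b : ℝ) ≤ (c : ℝ) - d := by linarith
  exact EReal.coe_le_coe_iff.2 h2

theorem extIntegral_le_of_parts
    (h : ∫⁻ a, (f a).toENNReal ∂m + ∫⁻ a, (-g a).toENNReal ∂m ≤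
      ∫⁻ a, (g a).toENNReal ∂m + ∫⁻ a, (-f a).toENNReal ∂m)
    (h' : ∫⁻ a, (-g a).toENNReal ∂m ≤ ∫⁻ a, (-f a).toENNReal ∂m) :
    extIntegral m f ≤ extIntegral m g := ereal_ennreal_sub_le_sub h h'

theorem integrable_of_lintegral_parts {f : α → ℝ} (hf : AEMeasurable f m)
    (hP : ∫⁻ a, ENNReal.ofReal (f a) ∂m ≠ ⊤) (hN : ∫⁻ a, ENNReal.ofReal (-f a) ∂m ≠ ⊤) :
    Integrable f m := by
  refine ⟨hf.aestronglyMeasurable, ?_⟩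
  rw [hasFiniteIntegral_iff_norm]
  have hs : ∫⁻ a, (ENNReal.ofReal (f a) + ENNReal.ofReal (-f a)) ∂m ≠ ⊤ := by
    rw [lintegral_add_left' hf.ennreal_ofReal]
    exact ENNReal.add_ne_top.2 ⟨hP, hN⟩
  refine lt_of_le_of_lt (lintegral_mono fun a => ?_) (lt_top_iff_ne_top.2 hs)
  rw [Real.norm_eq_abs]
  rcases le_total 0 (f a) with h | h
  · rw [abs_of_nonneg h]; exact le_self_add
  · rw [abs_of_nonpos h]; exact le_add_self

theorem integrable_toReal_of_parts (hf : AEMeasurable f m)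
    (hP : ∫⁻ a, (f a).toENNReal ∂m ≠ ⊤) (hN : ∫⁻ a, (-f a).toENNReal ∂m ≠ ⊤) :
    (f =ᵐ[m] fun a => ((f a).toReal : EReal)) ∧ Integrable (fun a => (f a).toReal) m := by
  have h1 := ae_lt_top' hf.ereal_toENNReal hP
  have hfn : AEMeasurable (fun a => -f a) m := hf.neg
  have h2 := ae_lt_top' hfn.ereal_toENNReal hN
  have hae : f =ᵐ[m] fun a => ((f a).toReal : EReal) := by
    filter_upwards [h1, h2] with a ha hb
    refine (EReal.coe_toReal ?_ ?_).symm
    · exact EReal.toENNReal_ne_top_iff.1 ha.ne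
    · intro h; rw [h] at hb; simp at hb
  refine ⟨hae, integrable_of_lintegral_parts hf.ereal_toReal ?_ ?_⟩
  · rwa [lintegral_congr_ae (g := fun a => (f a).toENNReal)]
    filter_upwards [hae] with a ha
    rw [ha, EReal.toReal_coe, EReal.real_coe_toENNReal]
  · rwa [lintegral_congr_ae (g := fun a => (-f a).toENNReal)]
    filter_upwards [hae] with a ha
    rw [ha, EReal.toReal_coe, ← EReal.coe_neg, EReal.real_coe_toENNReal]

theorem extIntegral_coe {f : α → ℝ} (hf : Integrable f m) :
    extIntegral m (fun a => (f a : EReal)) = ((∫ a, f a ∂m : ℝ) : EReal) := by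
  have hP : ∫⁻ a, ENNReal.ofReal (f a) ∂m ≠ ⊤ := hf.lintegral_lt_top.ne
  have hN : ∫⁻ a, ENNReal.ofReal (-f a) ∂m ≠ ⊤ := hf.neg.lintegral_lt_top.ne
  rw [integral_eq_lintegral_pos_part_sub_lintegral_neg_part hf, extIntegral]
  simp only [← EReal.coe_neg, EReal.real_coe_toENNReal, EReal.coe_sub]
  rw [← EReal.coe_ennreal_toReal hP, ← EReal.coe_ennreal_toReal hN]

theorem parts_ne_top_of_extIntegral (hb : extIntegral m f ≠ ⊥) (ht : extIntegral m f ≠ ⊤) :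
    ∫⁻ a, (f a).toENNReal ∂m ≠ ⊤ ∧ ∫⁻ a, (-f a).toENNReal ∂m ≠ ⊤ := by
  rw [extIntegral] at hb ht
  have h2 : ∫⁻ a, (-f a).toENNReal ∂m ≠ ⊤ := fun h => hb (by rw [h]; simp)
  refine ⟨fun h => ht ?_, h2⟩
  rw [h, EReal.coe_ennreal_top, sub_eq_add_neg]
  exact EReal.top_add_of_ne_bot (by simpa using h2)

theorem exists_integrable_of_extIntegral (hf : AEMeasurable f m) (hb : extIntegral m f ≠ ⊥)
    (ht : extIntegral m f ≠ ⊤) : ∃ f' : α → ℝ, Integrable f' m ∧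
      (f =ᵐ[m] fun a => (f' a : EReal)) ∧ extIntegral m f = ((∫ a, f' a ∂m : ℝ) : EReal) := by
  obtain ⟨hP, hN⟩ := parts_ne_top_of_extIntegral hb ht
  obtain ⟨h1, h2⟩ := integrable_toReal_of_parts hf hP hN
  exact ⟨_, h2, h1, by rw [extIntegral_congr h1, extIntegral_coe h2]⟩

theorem ae_eq_of_extIntegral_le (hf : AEMeasurable f m) (hg : AEMeasurable g m) (hfg : f ≤ᵐ[m] g)
    (hle : extIntegral m g ≤ extIntegral m f) (hb : extIntegral m f ≠ ⊥)
    (ht : extIntegral m f ≠ ⊤) : f =ᵐ[m] g := by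
  have he := le_antisymm (extIntegral_mono hfg) hle
  obtain ⟨f', hf1, hf2, hf3⟩ := exists_integrable_of_extIntegral hf hb ht
  obtain ⟨g', hg1, hg2, hg3⟩ := exists_integrable_of_extIntegral hg (he ▸ hb) (he ▸ ht)
  rw [hf3, hg3, EReal.coe_eq_coe_iff, integral_eq_iff_of_ae_le hf1 hg1] at he
  · filter_upwards [hf2, hg2, he] with a h1 h2 h3
    rw [h1, h2, h3]
  · filter_upwards [hf2, hg2, hfg] with a h1 h2 h3
    rw [h1, h2] at h3
    exact EReal.coe_le_coe_iff.1 h3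

end ExtIntegral

/-! ### Tangents of the utility function and Jensen's inequality. -/

section Utility

open Filter Topology

variable {u : ℝ → ℝ}

theorem utilityExt_of_pos {x : ℝ} (hx : 0 < x) : utilityExt u x = u x := if_pos hx

theorem utilityExt_of_nonpos {x : ℝ} (hx : x ≤ 0) :
    utilityExt u x = ⨅ y : Ioi (0 : ℝ), (u y : EReal) := if_neg (not_lt.2 hx)

theorem utilityExt_le_of_nonpos {x y : ℝ} (hx : x ≤ 0) (hy : 0 < y) : utilityExt u x ≤ u y := by
  rw [utilityExt_of_nonpos hx]
  exact iInf_le (fun y : Ioi (0 : ℝ) => (u y : EReal)) ⟨y, hy⟩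

variable (hu : IsUtility u)
include hu

theorem IsUtility.monotone_ext : Monotone (utilityExt u) := by
  intro x y hxy
  rcases le_or_gt y 0 with hy | hy
  · rw [utilityExt_of_nonpos hy, utilityExt_of_nonpos (hxy.trans hy)]
  rcases le_or_gt x 0 with hx | hx
  · rw [utilityExt_of_pos hy]; exact utilityExt_le_of_nonpos hx hy
  · rw [utilityExt_of_pos hy, utilityExt_of_pos hx]
    exact EReal.coe_le_coe_iff.2 (hu.strictMonoOn.monotoneOn hx hy hxy)

theorem IsUtility.measurable_ext : Measurable (utilityExt u) := hu.monotone_ext.measurable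

theorem IsUtility.strictMonoOn_ext : StrictMonoOn (utilityExt u) (Ici 0) := by
  intro x hx y _ hxy
  have hy : 0 < y := lt_of_le_of_lt hx hxy
  refine (hu.monotone_ext (show x ≤ (x + y) / 2 by linarith)).trans_lt ?_
  have h : 0 < (x + y) / 2 := by linarith [show 0 ≤ x from hx]
  rw [utilityExt_of_pos hy, utilityExt_of_pos h, EReal.coe_lt_coe_iff]
  exact hu.strictMonoOn h hy (by linarith)

theorem IsUtility.strictConcaveOn : StrictConcaveOn ℝ (Ioi 0) u := by
  refine strictConcaveOn_of_deriv2_neg' (convex_Ioi 0) hu.differentiableOn.continuousOn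
    fun x hx => ?_
  exact hu.deriv_deriv_neg x hx

theorem IsUtility.hasDerivAt {a : ℝ} (ha : 0 < a) : HasDerivAt u (deriv u a) a :=
  (hu.differentiableOn.differentiableAt (Ioi_mem_nhds ha)).hasDerivAt

theorem IsUtility.lt_tangent_of_pos {a x : ℝ} (ha : 0 < a) (hx : 0 < x) (hne : x ≠ a) :
    u x < u a + deriv u a * (x - a) := by
  rcases hne.lt_or_gt with h | h
  · have := hu.strictConcaveOn.lt_slope_of_hasDerivAt hx ha h (hu.hasDerivAt ha)
    rw [slope_def_field, lt_div_iff₀ (by linarith)] at this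
    linarith
  · have := hu.strictConcaveOn.slope_lt_of_hasDerivAt ha hx h (hu.hasDerivAt ha)
    rw [slope_def_field, div_lt_iff₀ (by linarith)] at this
    linarith

theorem IsUtility.lt_tangent {a x : ℝ} (ha : 0 < a) (hx : 0 ≤ x) (hne : x ≠ a) :
    utilityExt u x < ((u a + deriv u a * (x - a) : ℝ) : EReal) := by
  rcases hx.eq_or_lt with rfl | hx
  · have hb : 0 < a / 2 := by linarith
    have h0 : utilityExt u 0 ≤ ((u (a / 2) + deriv u (a / 2) * (0 - a / 2) : ℝ) : EReal) := by
      have hc : Tendsto (fun x : ℝ => ((u (a / 2) + deriv u (a / 2) * (x - a / 2) : ℝ) : EReal))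
          (𝓝[>] 0) (𝓝 ((u (a / 2) + deriv u (a / 2) * (0 - a / 2) : ℝ) : EReal)) := by
        refine Tendsto.mono_left ?_ nhdsWithin_le_nhds
        exact (continuous_coe_real_ereal.comp (by fun_prop :
          Continuous fun x : ℝ => u (a / 2) + deriv u (a / 2) * (x - a / 2))).tendsto 0
      refine ge_of_tendsto hc ?_
      filter_upwards [self_mem_nhdsWithin, mem_nhdsWithin_of_mem_nhds (Iio_mem_nhds hb)]
        with x hx hxb
      exact (utilityExt_le_of_nonpos le_rfl hx).trans
        (EReal.coe_le_coe_iff.2 (hu.lt_tangent_of_pos hb hx (ne_of_lt hxb)).le)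
    refine h0.trans_lt (EReal.coe_lt_coe_iff.2 ?_)
    have h1 := hu.lt_tangent_of_pos ha hb (by linarith)
    have h2 := hu.lt_tangent_of_pos hb ha (by linarith)
    nlinarith
  · rw [utilityExt_of_pos hx, EReal.coe_lt_coe_iff]
    exact hu.lt_tangent_of_pos ha hx hne

theorem IsUtility.le_tangent {a x : ℝ} (ha : 0 < a) (hx : 0 ≤ x) :
    utilityExt u x ≤ ((u a + deriv u a * (x - a) : ℝ) : EReal) := by
  by_cases h : x = a
  · subst h; rw [utilityExt_of_pos ha, sub_self, mul_zero, add_zero]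
  · exact (hu.lt_tangent ha hx h).le

/-- Both points are compared with the tangent at the midpoint, which is positive since the points
differ; the linear terms cancel on averaging. -/
theorem IsUtility.midpoint_lt {x y p q : ℝ} (hx : 0 ≤ x) (hy : 0 ≤ y) (hne : x ≠ y)
    (hp : utilityExt u x = p) (hq : utilityExt u y = q) :
    (((p + q) / 2 : ℝ) : EReal) < utilityExt u ((x + y) / 2) := by
  have hpos : 0 < (x + y) / 2 := by
    rcases hx.eq_or_lt with rfl | hx
    · have := lt_of_le_of_ne hy hne; linarith
    · linarith
  have h1 := hu.lt_tangent hpos hx (fun h => hne (by linarith))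
  have h2 := hu.lt_tangent hpos hy (fun h => hne (by linarith))
  rw [hp, EReal.coe_lt_coe_iff] at h1
  rw [hq, EReal.coe_lt_coe_iff] at h2
  rw [utilityExt_of_pos hpos, EReal.coe_lt_coe_iff]
  nlinarith

/-- Jensen's inequality for the mean `q` of `Q`, in a form that allows infinite parts. -/
theorem IsUtility.jensen {α : Type*} [MeasurableSpace α] {m : Measure α} [IsFiniteMeasure m]
    (hm : m univ ≠ 0) {Q : α → ℝ} (hQ : Integrable Q m) (hQ0 : ∀ᵐ a ∂m, 0 ≤ Q a) {q : ℝ}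
    (hq : ∫ a, Q a ∂m = q * m.real univ) :
    (∫⁻ a, (utilityExt u (Q a)).toENNReal ∂m + ∫⁻ _, (-utilityExt u q).toENNReal ∂m ≤
      ∫⁻ _, (utilityExt u q).toENNReal ∂m + ∫⁻ a, (-utilityExt u (Q a)).toENNReal ∂m) ∧
    ∫⁻ _, (-utilityExt u q).toENNReal ∂m ≤ ∫⁻ a, (-utilityExt u (Q a)).toENNReal ∂m := by
  have hmr : 0 < m.real univ := ENNReal.toReal_pos hm (measure_ne_top _ _)
  have hq0 : 0 ≤ q := by
    have := integral_nonneg_of_ae hQ0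
    rw [hq] at this
    exact nonneg_of_mul_nonneg_left this hmr
  -- Mean zero forces `Q = 0` almost everywhere. This case is separate because there is no tangent
  -- at `0`, where the utility may be `-∞`.
  rcases hq0.eq_or_lt with rfl | hqpos
  · rw [zero_mul, integral_eq_zero_iff_of_nonneg_ae hQ0 hQ] at hq
    have h1 : ∫⁻ a, (utilityExt u (Q a)).toENNReal ∂m = ∫⁻ _, (utilityExt u 0).toENNReal ∂m :=
      lintegral_congr_ae (hq.mono fun a ha => by dsimp only; rw [ha]; rfl)
    have h2 : ∫⁻ a, (-utilityExt u (Q a)).toENNReal ∂m = ∫⁻ _, (-utilityExt u 0).toENNReal ∂m :=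
      lintegral_congr_ae (hq.mono fun a ha => by dsimp only; rw [ha]; rfl)
    exact ⟨by rw [h1, h2], h2.ge⟩
  by_cases hN : ∫⁻ a, (-utilityExt u (Q a)).toENNReal ∂m = ⊤
  · rw [hN]; exact ⟨by simp, le_top⟩
  have hd : Integrable (fun a => Q a - q) m := hQ.sub (integrable_const q)
  have hℓi : Integrable (fun a => u q + deriv u q * (Q a - q)) m :=
    (integrable_const _).add (hd.const_mul _)
  have hle : ∀ᵐ a ∂m, utilityExt u (Q a) ≤ ((u q + deriv u q * (Q a - q) : ℝ) : EReal) :=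
    hQ0.mono fun a ha => hu.le_tangent hqpos ha
  have hP : ∫⁻ a, (utilityExt u (Q a)).toENNReal ∂m ≠ ⊤ := by
    refine ne_top_of_le_ne_top hℓi.lintegral_lt_top.ne (lintegral_mono_ae ?_)
    filter_upwards [hle] with a ha
    rw [← EReal.real_coe_toENNReal]
    exact EReal.toENNReal_le_toENNReal ha
  have hmeas : AEMeasurable (fun a => utilityExt u (Q a)) m :=
    hu.measurable_ext.comp_aemeasurable hQ.aemeasurable
  obtain ⟨hae, hfi⟩ := integrable_toReal_of_parts hmeas hP hN
  set f' : α → ℝ := fun a => (utilityExt u (Q a)).toReal with hf'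
  have hPe : ∫⁻ a, (utilityExt u (Q a)).toENNReal ∂m = ∫⁻ a, ENNReal.ofReal (f' a) ∂m :=
    lintegral_congr_ae (hae.mono fun a ha => congrArg EReal.toENNReal ha)
  have hNe : ∫⁻ a, (-utilityExt u (Q a)).toENNReal ∂m = ∫⁻ a, ENNReal.ofReal (-f' a) ∂m :=
    lintegral_congr_ae (hae.mono fun a ha => by
      simpa using congrArg (fun x : EReal => (-x).toENNReal) ha)
  have hint : ∫ a, f' a ∂m ≤ ∫ a, u q ∂m := by
    have h1 : ∫ a, f' a ∂m ≤ ∫ a, (u q + deriv u q * (Q a - q)) ∂m := by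
      refine integral_mono_ae hfi hℓi ?_
      filter_upwards [hle, hae] with a h1 h2
      exact EReal.coe_le_coe_iff.1 (h2.symm.trans_le h1)
    refine h1.trans (le_of_eq ?_)
    rw [integral_add (integrable_const _) (hd.const_mul _),
      integral_const_mul, integral_sub hQ (integrable_const q), hq, integral_const (μ := m) q,
      smul_eq_mul]
    ring
  rw [integral_eq_lintegral_pos_part_sub_lintegral_neg_part hfi,
    integral_eq_lintegral_pos_part_sub_lintegral_neg_part (integrable_const (u q))] at hint
  rw [utilityExt_of_pos hqpos, hPe, hNe, ← EReal.coe_neg, EReal.real_coe_toENNReal,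
    EReal.real_coe_toENNReal]
  rw [hPe] at hP
  rw [hNe] at hN
  have hP' : ∫⁻ _, ENNReal.ofReal (u q) ∂m ≠ ⊤ := (integrable_const (u q)).lintegral_lt_top.ne
  have hN' : ∫⁻ _, ENNReal.ofReal (-u q) ∂m ≠ ⊤ := (integrable_const (-u q)).lintegral_lt_top.ne
  -- At most one part of the constant `u q` is nonzero. This extracts the inequality between
  -- negative parts from the combined inequality.
  have hcase : ∫⁻ _, ENNReal.ofReal (u q) ∂m = 0 ∨ ∫⁻ _, ENNReal.ofReal (-u q) ∂m = 0 := by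
    rcases le_total (u q) 0 with h | h
    · left; simp [ENNReal.ofReal_of_nonpos h]
    · right; simp [ENNReal.ofReal_of_nonpos (neg_nonpos.2 h)]
  generalize ∫⁻ a, ENNReal.ofReal (f' a) ∂m = A at *
  generalize ∫⁻ a, ENNReal.ofReal (-f' a) ∂m = B at *
  generalize ∫⁻ _, ENNReal.ofReal (u q) ∂m = C at *
  generalize ∫⁻ _, ENNReal.ofReal (-u q) ∂m = D at *
  lift A to NNReal using hP
  lift B to NNReal using hN
  lift C to NNReal using hP'
  lift D to NNReal using hN'
  simp only [ENNReal.coe_toReal] at hint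
  have hA := A.2
  have hB := B.2
  have hadd : (A : ℝ) + D ≤ C + B := by linarith
  refine ⟨by exact_mod_cast hadd, ?_⟩
  rcases hcase with h | h
  · have h' : (C : ℝ) = 0 := by exact_mod_cast h
    have : (D : ℝ) ≤ B := by linarith [A.coe_nonneg]
    exact_mod_cast this
  · rw [h]; exact zero_le

end Utility

/-! ### Averaging a quantile over the level sets of `δ'`. -/

section LevelAverage

open Filter Topology

/-- The level sets of `D` in the open unit interval. -/
def level (D : ℝ → ℝ) (c : ℝ) : Set ℝ := {x | x ∈ Ioo (0 : ℝ) 1 ∧ D x = c}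

open Classical in
/-- The function `Q` averaged over every nontrivial level set of `D`. -/
noncomputable def levelAverage (D Q : ℝ → ℝ) (x : ℝ) : ℝ :=
  if volume (level D (D x)) = 0 then Q x
  else (∫ y in level D (D x), Q y) / volume.real (level D (D x))

variable {D Q : ℝ → ℝ}

theorem measurableSet_level (hD : AntitoneOn D (Ioo 0 1)) (c : ℝ) : MeasurableSet (level D c) := by
  refine OrdConnected.measurableSet ⟨fun x hx y hy z hz => ?_⟩
  have hz' : z ∈ Ioo (0 : ℝ) 1 := ⟨hx.1.1.trans_le hz.1, hz.2.trans_lt hy.1.2⟩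
  exact ⟨hz', le_antisymm ((hD hx.1 hz' hz.1).trans_eq hx.2) (hy.2.symm.trans_le (hD hz' hy.1 hz.2))⟩

theorem level_subset (D : ℝ → ℝ) (c : ℝ) : level D c ⊆ Ioo 0 1 := fun _ hx => hx.1

theorem volume_level_ne_top (D : ℝ → ℝ) (c : ℝ) : volume (level D c) ≠ ⊤ :=
  ne_top_of_le_ne_top (by simp) (measure_mono (level_subset D c))

instance isFiniteMeasure_restrict_level (D : ℝ → ℝ) (c : ℝ) :
    IsFiniteMeasure (volume.restrict (level D c)) :=
  ⟨by rw [Measure.restrict_apply_univ]; exact (volume_level_ne_top D c).lt_top⟩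

theorem pairwise_disjoint_level (D : ℝ → ℝ) :
    Pairwise (Function.onFun Disjoint (level D)) := fun _ _ h =>
  Set.disjoint_left.2 fun _ hx hy => h (hx.2.symm.trans hy.2)

theorem levelAverage_of_null {x : ℝ} (h : volume (level D (D x)) = 0) :
    levelAverage D Q x = Q x := if_pos h

theorem levelAverage_of_ne {x : ℝ} (h : volume (level D (D x)) ≠ 0) :
    levelAverage D Q x = (∫ y in level D (D x), Q y) / volume.real (level D (D x)) := if_neg h

theorem volumeReal_level_pos {c : ℝ} (h : volume (level D c) ≠ 0) : 0 < volume.real (level D c) :=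
  ENNReal.toReal_pos h (volume_level_ne_top D c)

theorem levelAverage_eq {x y : ℝ} (hxy : D x = D y) (h : volume (level D (D x)) ≠ 0) :
    levelAverage D Q x = levelAverage D Q y := by
  rw [levelAverage_of_ne h, levelAverage_of_ne (hxy ▸ h), hxy]

theorem levelAverage_eq_of_forall {l r : ℝ} (h0 : 0 ≤ l) (h1 : r ≤ 1)
    (h : ∀ x ∈ Ioo l r, ∀ y ∈ Ioo l r, D x = D y) :
    ∀ x ∈ Ioo l r, ∀ y ∈ Ioo l r, levelAverage D Q x = levelAverage D Q y := by
  intro x hx y hy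
  refine levelAverage_eq (h x hx y hy) fun hv => ?_
  have hsub : Ioo l r ⊆ level D (D x) := fun z hz =>
    ⟨⟨h0.trans_lt hz.1, hz.2.trans_le h1⟩, h z hz x hx⟩
  have := measure_mono_null hsub hv
  rw [Real.volume_Ioo, ENNReal.ofReal_eq_zero] at this
  linarith [hx.1, hx.2]

theorem levelAverage_le (hD : AntitoneOn D (Ioo 0 1)) {x B : ℝ} (hx : x ∈ Ioo (0 : ℝ) 1)
    (hi : IntegrableOn Q (level D (D x))) (h : ∀ a ∈ level D (D x), Q a ≤ B) :
    levelAverage D Q x ≤ B := by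
  by_cases hv : volume (level D (D x)) = 0
  · rw [levelAverage_of_null hv]; exact h x ⟨hx, rfl⟩
  · rw [levelAverage_of_ne hv, div_le_iff₀ (volumeReal_level_pos hv), mul_comm, ← smul_eq_mul,
      ← setIntegral_const]
    exact setIntegral_mono_on hi (integrable_const B) (measurableSet_level hD _) h

theorem le_levelAverage (hD : AntitoneOn D (Ioo 0 1)) {x B : ℝ} (hx : x ∈ Ioo (0 : ℝ) 1)
    (hi : IntegrableOn Q (level D (D x))) (h : ∀ a ∈ level D (D x), B ≤ Q a) :
    B ≤ levelAverage D Q x := by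
  by_cases hv : volume (level D (D x)) = 0
  · rw [levelAverage_of_null hv]; exact h x ⟨hx, rfl⟩
  · rw [levelAverage_of_ne hv, le_div_iff₀ (volumeReal_level_pos hv), mul_comm, ← smul_eq_mul,
      ← setIntegral_const]
    exact setIntegral_mono_on (integrable_const B) hi (measurableSet_level hD _) h

/-- Distinct level sets of `D` are ordered like intervals, so each value of `Q` on the left one is
at most each value on the right one, and the averages inherit this. -/
theorem monotoneOn_levelAverage (hD : AntitoneOn D (Ioo 0 1)) (hQ : MonotoneOn Q (Ioo 0 1))
    (hi : ∀ c, IntegrableOn Q (level D c)) : MonotoneOn (levelAverage D Q) (Ioo 0 1) := by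
  intro x hx y hy hxy
  rcases (hD hx hy hxy).eq_or_lt with h | h
  · by_cases hv : volume (level D (D x)) = 0
    · rw [levelAverage_of_null hv, levelAverage_of_null (by rwa [h])]
      exact hQ hx hy hxy
    · exact (levelAverage_eq h.symm hv).le
  · refine le_levelAverage hD hy (hi _) fun b hb => levelAverage_le hD hx (hi _) fun a ha => ?_
    refine hQ ha.1 hb.1 (le_of_lt ?_)
    by_contra hab
    have := hD hb.1 ha.1 (not_lt.1 hab)
    rw [ha.2, hb.2] at this
    exact absurd h (not_lt.2 this)

/-- An integral inequality that holds on the nontrivial level sets, and pointwise off them. -/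
theorem lintegral_le_of_level (hD : AntitoneOn D (Ioo 0 1)) {f g : ℝ → ENNReal}
    (h : ∀ c, volume (level D c) ≠ 0 → ∫⁻ x in level D c, f x ≤ ∫⁻ x in level D c, g x)
    (h' : ∀ x ∈ Ioo (0 : ℝ) 1, volume (level D (D x)) = 0 → f x ≤ g x) :
    ∫⁻ x, f x ∂unif ≤ ∫⁻ x, g x ∂unif := by
  have hm := measurableSet_level hD
  let S : Set ℝ := {c | 0 < volume (level D c)}
  -- Disjoint sets of positive measure in a σ-finite space are countably many, so the nontrivial
  -- levels can be summed.
  have hS : S.Countable := Measure.countable_meas_pos_of_disjoint_iUnion hm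
    (pairwise_disjoint_level D)
  have hT : MeasurableSet (⋃ c ∈ S, level D c) := .biUnion hS fun c _ => hm c
  have hTsub : (⋃ c ∈ S, level D c) ⊆ Ioo 0 1 := iUnion₂_subset fun c _ => level_subset D c
  have hdis : S.PairwiseDisjoint (level D) := fun a _ b _ hab => pairwise_disjoint_level D hab
  rw [unif, ← lintegral_inter_add_sdiff f _ hT, ← lintegral_inter_add_sdiff g _ hT,
    inter_eq_self_of_subset_right hTsub]
  refine add_le_add ?_ ?_
  · rw [lintegral_biUnion hS (fun c _ => hm c) hdis, lintegral_biUnion hS (fun c _ => hm c) hdis]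
    exact ENNReal.tsum_le_tsum fun c => h c (ne_of_gt c.2)
  · refine setLIntegral_mono' (measurableSet_Ioo.diff hT) fun x hx => h' x hx.1 ?_
    by_contra hne
    exact hx.2 (mem_iUnion₂.2 ⟨D x, pos_iff_ne_zero.2 hne, hx.1, rfl⟩)

/-- The expected utility of a payoff with quantile function `Q`. -/
noncomputable def quantileUtility (u Q : ℝ → ℝ) : EReal :=
  extIntegral unif fun x => utilityExt u (Q x)

theorem aemeasurable_utility {u : ℝ → ℝ} (hu : IsUtility u) (hQ : MonotoneOn Q (Ioo 0 1)) :
    AEMeasurable (fun x => utilityExt u (Q x)) unif :=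
  hu.measurable_ext.comp_aemeasurable (aemeasurable_of_monotoneOn hQ)

/-- On the level `c` the cost is `c ∫ Q` with `c > 0`, so a finite cost makes `Q` integrable there,
even if `Q` is not integrable on all of `(0,1)`. -/
theorem integrableOn_level (hD : AntitoneOn D (Ioo 0 1)) (hpos : ∀ x ∈ Ioo (0 : ℝ) 1, 0 < D x)
    (hQ : MonotoneOn Q (Ioo 0 1)) (hQ0 : ∀ x ∈ Ioo (0 : ℝ) 1, 0 ≤ Q x)
    (hfin : ∫⁻ x, ENNReal.ofReal (D x) * ENNReal.ofReal (Q x) ∂unif ≠ ⊤) (c : ℝ) :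
    IntegrableOn Q (level D c) := by
  have hle : volume.restrict (level D c) ≤ unif := Measure.restrict_mono (level_subset D c) le_rfl
  rcases (level D c).eq_empty_or_nonempty with he | ⟨x, hx⟩
  · rw [he]; exact integrableOn_empty
  have hc : 0 < c := hx.2 ▸ hpos x hx.1
  have h1 : ∫⁻ x in level D c, ENNReal.ofReal c * ENNReal.ofReal (Q x) ≠ ⊤ := by
    refine ne_top_of_le_ne_top hfin (le_trans (le_of_eq ?_) (lintegral_mono' hle le_rfl))
    exact setLIntegral_congr_fun (measurableSet_level hD c) fun x hx => by rw [hx.2]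
  rw [lintegral_const_mul' _ _ ENNReal.ofReal_ne_top] at h1
  have h2 : ∫⁻ x in level D c, ENNReal.ofReal (Q x) ≠ ⊤ := fun h => h1 (by
    rw [h, ENNReal.mul_top]; simpa using hc)
  refine integrable_of_lintegral_parts ((aemeasurable_of_monotoneOn hQ).mono_measure hle) h2 ?_
  rw [setLIntegral_congr_fun (g := fun _ => 0) (measurableSet_level hD c)
    fun x hx => ENNReal.ofReal_of_nonpos (neg_nonpos.2 (hQ0 x hx.1))]
  simp

theorem setIntegral_level_eq {x : ℝ} (h : volume (level D (D x)) ≠ 0) :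
    ∫ y in level D (D x), Q y =
      levelAverage D Q x * (volume.restrict (level D (D x))).real univ := by
  rw [levelAverage_of_ne h, measureReal_restrict_apply_univ,
    div_mul_cancel₀ _ (volumeReal_level_pos h).ne']

/-- On a level set `D` is constant, so the cost sees only the integral of `Q`, which averaging
preserves. -/
theorem lintegral_levelAverage_le (hD : AntitoneOn D (Ioo 0 1))
    (hQ0 : ∀ x ∈ Ioo (0 : ℝ) 1, 0 ≤ Q x) (hi : ∀ c, IntegrableOn Q (level D c)) :
    ∫⁻ x, ENNReal.ofReal (D x) * ENNReal.ofReal (levelAverage D Q x) ∂unif ≤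
      ∫⁻ x, ENNReal.ofReal (D x) * ENNReal.ofReal (Q x) ∂unif := by
  refine lintegral_le_of_level hD (fun c hc => le_of_eq ?_) fun x _ h => by
    rw [levelAverage_of_null h]
  have hm := measurableSet_level hD c
  obtain ⟨x, hx⟩ := nonempty_of_measure_ne_zero hc
  obtain ⟨-, rfl⟩ := hx
  have h1 : ∫⁻ y in level D (D x), ENNReal.ofReal (D y) * ENNReal.ofReal (levelAverage D Q y) =
      ENNReal.ofReal (D x) * (ENNReal.ofReal (levelAverage D Q x) * volume (level D (D x))) := by
    rw [← setLIntegral_const, ← lintegral_const_mul' _ _ ENNReal.ofReal_ne_top]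
    exact setLIntegral_congr_fun hm fun y hy => by rw [hy.2, levelAverage_eq hy.2 (by rwa [hy.2])]
  have h2 : ∫⁻ y in level D (D x), ENNReal.ofReal (D y) * ENNReal.ofReal (Q y) =
      ENNReal.ofReal (D x) * ∫⁻ y in level D (D x), ENNReal.ofReal (Q y) := by
    rw [← lintegral_const_mul' _ _ ENNReal.ofReal_ne_top]
    exact setLIntegral_congr_fun hm fun y hy => by rw [hy.2]
  rw [h1, h2, ← ofReal_integral_eq_lintegral_ofReal (hi _)
      ((ae_restrict_iff' hm).2 (.of_forall fun y hy => hQ0 y hy.1)),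
    setIntegral_level_eq hc, ENNReal.ofReal_mul' measureReal_nonneg,
    measureReal_restrict_apply_univ, measureReal_def, ENNReal.ofReal_toReal (volume_level_ne_top D _)]

/-- Jensen is applied on every nontrivial level. It is summed in its subtraction-free form because
the total positive or negative part may be infinite. -/
theorem quantileUtility_le_levelAverage {u : ℝ → ℝ} (hu : IsUtility u)
    (hD : AntitoneOn D (Ioo 0 1)) (hQ : MonotoneOn Q (Ioo 0 1))
    (hQ0 : ∀ x ∈ Ioo (0 : ℝ) 1, 0 ≤ Q x) (hi : ∀ c, IntegrableOn Q (level D c)) :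
    quantileUtility u Q ≤ quantileUtility u (levelAverage D Q) := by
  have hm := measurableSet_level hD
  have hle : ∀ c, volume.restrict (level D c) ≤ unif := fun c =>
    Measure.restrict_mono (level_subset D c) le_rfl
  have hU := aemeasurable_utility hu hQ
  have hU' := aemeasurable_utility hu (monotoneOn_levelAverage hD hQ hi)
  have hJ : ∀ x, volume (level D (D x)) ≠ 0 → _ := fun x hx =>
    hu.jensen (m := volume.restrict (level D (D x))) (Q := Q)
      (by rwa [Measure.restrict_apply_univ])
      (hi _) ((ae_restrict_iff' (hm _)).2 (.of_forall fun y hy => hQ0 y hy.1))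
      (setIntegral_level_eq hx)
  have hc : ∀ x, volume (level D (D x)) ≠ 0 → ∀ f : EReal → ENNReal,
      ∫⁻ y in level D (D x), f (utilityExt u (levelAverage D Q y)) =
        ∫⁻ _ in level D (D x), f (utilityExt u (levelAverage D Q x)) := fun x hx f =>
    setLIntegral_congr_fun (hm _) fun y hy => by
      rw [levelAverage_eq hy.2 (by rwa [hy.2])]
  refine extIntegral_le_of_parts ?_ ?_
  · rw [← lintegral_add_left' hU.ereal_toENNReal, ← lintegral_add_left' hU'.ereal_toENNReal]
    refine lintegral_le_of_level hD (fun c hcne => ?_) fun x _ h => by rw [levelAverage_of_null h]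
    obtain ⟨x, -, rfl⟩ := nonempty_of_measure_ne_zero hcne
    rw [lintegral_add_left' (hU.mono_measure (hle _)).ereal_toENNReal,
      lintegral_add_left' (hU'.mono_measure (hle _)).ereal_toENNReal,
      hc x hcne EReal.toENNReal, hc x hcne fun z => (-z).toENNReal]
    exact (hJ x hcne).1
  · refine lintegral_le_of_level hD (fun c hcne => ?_) fun x _ h => by rw [levelAverage_of_null h]
    obtain ⟨x, -, rfl⟩ := nonempty_of_measure_ne_zero hcne
    rw [hc x hcne fun z => (-z).toENNReal]
    exact (hJ x hcne).2

end LevelAverage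

/-! ### Utility of quantiles: levelling, strict concavity, strict monotonicity. -/

section Quantiles

variable {Ω : Type*} [MeasurableSpace Ω] {μ : Measure Ω} [IsProbabilityMeasure μ]
  {ρ : Ω → ℝ} {w u : ℝ → ℝ}

theorem antitoneOn_deltaDeriv (hρ : IsKernel μ ρ) (hw : IsWeighting w) :
    AntitoneOn (deltaDeriv μ ρ w) (Ioo 0 1) := fun x hx y hy hxy => by
  have := monotoneOn_deltaDeriv hρ hw (one_sub_mem_Ioo hy) (one_sub_mem_Ioo hx) (by linarith)
  simpa only [sub_sub_cancel] using this

theorem deltaCost_eq (hρ : IsKernel μ ρ) (hw : IsWeighting w) {Q : ℝ → ℝ}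
    (hQ : MonotoneOn Q (Ioo 0 1)) : deltaCost μ ρ w Q =
      ∫⁻ x, ENNReal.ofReal (deltaDeriv μ ρ w x) * ENNReal.ofReal (Q x) ∂unif :=
  lintegral_comp_one_sub (fun x => ENNReal.ofReal (deltaDeriv μ ρ w x) * ENNReal.ofReal (Q x))
    ((aemeasurable_restrict_of_antitoneOn measurableSet_Ioo
      (antitoneOn_deltaDeriv hρ hw)).ennreal_ofReal.mul
        (aemeasurable_of_monotoneOn hQ).ennreal_ofReal)

/-- Averaging a quantile over the level sets of `δ'` makes the two budgets agree, and can only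
increase utility. -/
theorem exists_leveled (hρ : IsKernel μ ρ) (hw : IsWeighting w) (hu : IsUtility u) {Q : ℝ → ℝ}
    (hQ : MonotoneOn Q (Ioo 0 1)) (hQ0 : ∀ x ∈ Ioo (0 : ℝ) 1, 0 ≤ Q x)
    (hfin : deltaCost μ ρ w Q ≠ ⊤) :
    ∃ R : ℝ → ℝ, MonotoneOn R (Ioo 0 1) ∧ (∀ x ∈ Ioo (0 : ℝ) 1, 0 ≤ R x) ∧
      (∀ l r : ℝ, 0 ≤ l → r ≤ 1 →
        (∀ x ∈ Ioo l r, ∀ y ∈ Ioo l r, deltaDeriv μ ρ w x = deltaDeriv μ ρ w y) →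
        ∀ x ∈ Ioo l r, ∀ y ∈ Ioo l r, R x = R y) ∧
      deltaCost μ ρ w R ≤ deltaCost μ ρ w Q ∧ quantileUtility u Q ≤ quantileUtility u R := by
  have hD := antitoneOn_deltaDeriv hρ hw
  have hpos : ∀ x ∈ Ioo (0 : ℝ) 1, 0 < deltaDeriv μ ρ w x := fun x hx => by
    have := deltaDeriv_pos hρ hw (one_sub_mem_Ioo hx)
    rwa [sub_sub_cancel] at this
  rw [deltaCost_eq hρ hw hQ] at hfin ⊢
  have hi := integrableOn_level hD hpos hQ hQ0 hfin
  have hR := monotoneOn_levelAverage hD hQ hi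
  refine ⟨levelAverage (deltaDeriv μ ρ w) Q, hR, fun x hx => ?_, fun l r => ?_, ?_, ?_⟩
  · exact le_levelAverage hD hx (hi _) fun a ha => hQ0 a ha.1
  · exact levelAverage_eq_of_forall
  · rw [deltaCost_eq hρ hw hR]
    exact lintegral_levelAverage_le hD hQ0 hi
  · exact quantileUtility_le_levelAverage hu hD hQ hQ0 hi

/-- Strict concavity: two quantiles of the same finite utility that their mean does not improve
on agree. -/
theorem ae_eq_of_quantileUtility_midpoint (hu : IsUtility u) {Q R : ℝ → ℝ}
    (hQ : MonotoneOn Q (Ioo 0 1)) (hQ0 : ∀ x ∈ Ioo (0 : ℝ) 1, 0 ≤ Q x)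
    (hR : MonotoneOn R (Ioo 0 1)) (hR0 : ∀ x ∈ Ioo (0 : ℝ) 1, 0 ≤ R x)
    (hb : quantileUtility u Q ≠ ⊥) (ht : quantileUtility u Q ≠ ⊤)
    (he : quantileUtility u R = quantileUtility u Q)
    (hmid : quantileUtility u (fun x => (Q x + R x) / 2) ≤ quantileUtility u Q) :
    Q =ᵐ[unif] R := by
  obtain ⟨f, hf1, hf2, hf3⟩ := exists_integrable_of_extIntegral (aemeasurable_utility hu hQ) hb ht
  obtain ⟨g, hg1, hg2, hg3⟩ := exists_integrable_of_extIntegral (aemeasurable_utility hu hR)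
    (he ▸ hb : quantileUtility u R ≠ ⊥) (he ▸ ht : quantileUtility u R ≠ ⊤)
  have hk : Integrable (fun x => (f x + g x) / 2) unif := (hf1.add hg1).div_const 2
  have hM : MonotoneOn (fun x => (Q x + R x) / 2) (Ioo 0 1) := fun x hx y hy hxy => by
    have := hQ hx hy hxy; have := hR hx hy hxy
    dsimp only; linarith
  have hke : extIntegral unif (fun x => (((f x + g x) / 2 : ℝ) : EReal)) = quantileUtility u Q := by
    have h1 : ∫ x, g x ∂unif = ∫ x, f x ∂unif := by
      have : quantileUtility u R = ((∫ x, g x ∂unif : ℝ) : EReal) := hg3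
      rw [he] at this
      exact EReal.coe_eq_coe_iff.1 (this.symm.trans hf3)
    rw [extIntegral_coe hk, integral_div, integral_add hf1 hg1, h1, add_self_div_two]
    exact hf3.symm
  -- The mean of the two utilities is pointwise at most the utility of the mean, and its integral is
  -- already the assumed bound. So they agree almost everywhere, which strict concavity allows only
  -- where `Q = R`.
  have hae := ae_eq_of_extIntegral_le
    (f := fun x => (((f x + g x) / 2 : ℝ) : EReal))
    (g := fun x => utilityExt u ((Q x + R x) / 2)) (m := unif)
    (hk.aemeasurable.coe_real_ereal) (aemeasurable_utility hu hM) (by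
      filter_upwards [hf2, hg2, ae_mem_unif] with x h1 h2 hx
      by_cases hne : Q x = R x
      · rw [hne] at h1
        have h3 : f x = g x := EReal.coe_eq_coe_iff.1 (h1.symm.trans h2)
        rw [h3, hne, add_self_div_two, add_self_div_two]
        exact h2.ge
      · exact (hu.midpoint_lt (hQ0 x hx) (hR0 x hx) hne h1 h2).le)
    (hke ▸ hmid) (hke ▸ hb) (hke ▸ ht)
  filter_upwards [hf2, hg2, ae_mem_unif, hae] with x h1 h2 hx h3
  by_contra hne
  exact absurd h3 (hu.midpoint_lt (hQ0 x hx) (hR0 x hx) hne h1 h2).ne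

theorem quantileUtility_add_const_lt (hu : IsUtility u) {Q : ℝ → ℝ}
    (hQ : MonotoneOn Q (Ioo 0 1)) (hQ0 : ∀ x ∈ Ioo (0 : ℝ) 1, 0 ≤ Q x)
    (hb : quantileUtility u Q ≠ ⊥) (ht : quantileUtility u Q ≠ ⊤) {c : ℝ} (hc : 0 < c) :
    quantileUtility u Q < quantileUtility u (fun x => Q x + c) := by
  by_contra hle
  have hQc : MonotoneOn (fun x => Q x + c) (Ioo 0 1) := fun x hx y hy hxy =>
    add_le_add (hQ hx hy hxy) le_rfl
  have hae := ae_eq_of_extIntegral_le (aemeasurable_utility hu hQ) (aemeasurable_utility hu hQc)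
    (.of_forall fun x => hu.monotone_ext (by linarith)) (not_lt.1 hle) hb ht
  obtain ⟨x, hx1, hx2⟩ := (hae.and ae_mem_unif).exists
  have h0 := hQ0 x hx2
  exact absurd hx1 (hu.strictMonoOn_ext (show 0 ≤ Q x from h0) (show 0 ≤ Q x + c by linarith)
    (by linarith)).ne

end Quantiles

/-! ### Translation of both problems into the language of quantiles. -/

section Problems

open Filter Topology

variable {Ω : Type*} [MeasurableSpace Ω] {μ : Measure Ω}
  {ρ κ X Z V : Ω → ℝ} {w u Q : ℝ → ℝ} {x₀ : ℝ}

theorem map_comp_uniform {β : Type*} [MeasurableSpace β] (hV : μ.map V = unif) {f : ℝ → β}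
    (hf : AEMeasurable f unif) : μ.map (fun ω => f (V ω)) = unif.map f := by
  have hVm := aemeasurable_of_map_eq_unif hV
  rw [← hV] at hf ⊢
  exact (AEMeasurable.map_map_of_aemeasurable hf hVm).symm

theorem map_comp_one_sub (hQ : AEMeasurable Q unif) :
    unif.map (fun y => Q (1 - y)) = unif.map Q := by
  have h := AEMeasurable.map_map_of_aemeasurable (μ := unif) (f := fun y : ℝ => 1 - y) (g := Q)
    (by rwa [map_one_sub_unif]) (by fun_prop)
  rw [map_one_sub_unif] at h
  exact h.symm

theorem ae_mem_comp_weighting (hw : IsWeighting w) (hV : μ.map V = unif) :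
    ∀ᵐ ω ∂μ, 1 - w (V ω) ∈ Ioo (0 : ℝ) 1 := by
  filter_upwards [ae_mem_of_map_eq_unif hV] with ω hω using one_sub_mem_Ioo (hw.mapsTo_Ioo hω)

/-- The quantile function of `X` under the distorted distribution function. -/
noncomputable def distortedQuantile (μ : Measure Ω) (w : ℝ → ℝ) (X : Ω → ℝ) (x : ℝ) : ℝ :=
  quantile μ X (1 - winv w (1 - x))

theorem distortedQuantile_weighting (hw : IsWeighting w) {y : ℝ} (hy : y ∈ Ioo (0 : ℝ) 1) :
    distortedQuantile μ w X (1 - w y) = quantile μ X (1 - y) := by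
  rw [distortedQuantile, sub_sub_cancel, hw.winv_apply (Ioo_subset_Icc_self hy)]

theorem IsFeasible.lintegral_eq (h : IsFeasible μ κ x₀ X) (hκ : ∀ᵐ ω ∂μ, 0 < κ ω) :
    ∫⁻ ω, ENNReal.ofReal (κ ω) * ENNReal.ofReal (X ω) ∂μ = ENNReal.ofReal x₀ := by
  rw [← h.budget, ofReal_integral_eq_lintegral_ofReal h.integrable]
  · refine lintegral_congr_ae ?_
    filter_upwards [hκ] with ω hω using (ENNReal.ofReal_mul hω.le).symm
  · filter_upwards [hκ, h.nonneg] with ω h1 h2 using mul_nonneg h1.le h2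

theorem IsFeasible.budget_nonneg (h : IsFeasible μ κ x₀ X) (hκ : ∀ᵐ ω ∂μ, 0 < κ ω) : 0 ≤ x₀ := by
  rw [← h.budget]
  refine integral_nonneg_of_ae ?_
  filter_upwards [hκ, h.nonneg] with ω h1 h2 using mul_nonneg h1.le h2

theorem isFeasible_of_lintegral (hκ : ∀ᵐ ω ∂μ, 0 < κ ω) (hκm : AEMeasurable κ μ)
    (hX : AEMeasurable X μ) (h0 : ∀ᵐ ω ∂μ, 0 ≤ X ω) (hx₀ : 0 ≤ x₀)
    (h : ∫⁻ ω, ENNReal.ofReal (κ ω) * ENNReal.ofReal (X ω) ∂μ = ENNReal.ofReal x₀) :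
    IsFeasible μ κ x₀ X := by
  have hnn : ∀ᵐ ω ∂μ, 0 ≤ κ ω * X ω := by
    filter_upwards [hκ, h0] with ω h1 h2 using mul_nonneg h1.le h2
  have he : ∫⁻ ω, ENNReal.ofReal (κ ω * X ω) ∂μ = ENNReal.ofReal x₀ := by
    rw [← h]
    refine lintegral_congr_ae ?_
    filter_upwards [hκ] with ω hω using ENNReal.ofReal_mul hω.le
  have hm : AEMeasurable (fun ω => κ ω * X ω) μ := hκm.mul hX
  refine ⟨hX, h0, integrable_of_lintegral_parts hm (he ▸ ENNReal.ofReal_ne_top) ?_, ?_⟩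
  · rw [lintegral_congr_ae (g := fun _ => 0) (by
      filter_upwards [hnn] with ω hω using ENNReal.ofReal_of_nonpos (neg_nonpos.2 hω))]
    simp
  · rw [integral_eq_lintegral_of_nonneg_ae hnn hm.aestronglyMeasurable, he,
      ENNReal.toReal_ofReal hx₀]

theorem expectedUtility_comp_uniform (hu : IsUtility u) (hV : μ.map V = unif)
    (hQ : MonotoneOn Q (Ioo 0 1)) :
    expectedUtility μ u (fun ω => Q (1 - V ω)) = quantileUtility u Q := by
  have hQm := aemeasurable_of_monotoneOn hQ
  have hQ' := aemeasurable_comp_one_sub hQm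
  have hm : AEMeasurable (fun ω => Q (1 - V ω)) μ := aemeasurable_comp_uniform hV hQ'
  rw [expectedUtility, ← extIntegral_map hm hu.measurable_ext,
    map_comp_uniform (f := fun y => Q (1 - y)) hV hQ', map_comp_one_sub hQm,
    extIntegral_map hQm hu.measurable_ext]
  rfl

variable [IsProbabilityMeasure μ]

theorem expectedUtility_eq (hu : IsUtility u) (hX : AEMeasurable X μ) :
    expectedUtility μ u X = quantileUtility u (quantile μ X) := by
  rw [expectedUtility, ← extIntegral_map hX hu.measurable_ext, ← map_quantile hX,
    extIntegral_map (aemeasurable_of_monotoneOn monotoneOn_quantile) hu.measurable_ext]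
  rfl

/-- With `a` the threshold of `Q` at `t`, the set `{Q ≤ t}` has length `1 - a`, while `F_X(t) = 1 -
w⁻¹(a)`; the distortion sends the latter to `1 - a`. -/
theorem distortedCDF_measure_eq (hw : IsWeighting w) (hX : AEMeasurable X μ)
    (h0 : ∀ᵐ ω ∂μ, 0 ≤ X ω) (hQ : MonotoneOn Q (Ioo 0 1))
    (hlaw : unif.map (fun y => Q (1 - w y)) = μ.map X) :
    (distortedCDF hw (μ.map X)).measure = unif.map Q := by
  have hQm := aemeasurable_of_monotoneOn hQ
  -- A Stieltjes measure of `Iic t` is measured from the limit at `-∞`. That limit is `0`, since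
  -- `F_X` vanishes on the negative axis and `w 1 = 1`.
  have hbot : Tendsto (distortedCDF hw (μ.map X)) atBot (𝓝 0) := by
    refine tendsto_const_nhds.congr' ?_
    filter_upwards [eventually_lt_atBot 0] with t ht
    have h1 : μ {ω | X ω ≤ t} = 0 :=
      measure_mono_null (fun ω (hω : X ω ≤ t) => not_le.2 (lt_of_le_of_lt hω ht)) h0
    rw [← ofReal_cdf_map hX, ENNReal.ofReal_eq_zero] at h1
    have h2 := le_antisymm h1 (cdf_nonneg _ _)
    change 0 = 1 - w (1 - cdf (μ.map X) t)
    rw [h2, sub_zero, hw.map_one, sub_self]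
  have := Measure.isFiniteMeasure_map unif Q
  refine (Measure.ext_of_Iic _ _ fun t => ?_).symm
  obtain ⟨a, ha, hat⟩ := exists_threshold hQ t
  rw [StieltjesFunction.measure_Iic _ hbot, sub_zero,
    Measure.map_apply_of_aemeasurable hQm measurableSet_Iic]
  have h1 : unif (Q ⁻¹' Iic t) = ENNReal.ofReal (1 - a) := by
    rw [← unif_Iio (by linarith [ha.1])]
    refine measure_congr ?_
    filter_upwards [ae_mem_unif, ae_restrict_of_ae (Measure.ae_ne volume (1 - a))] with x h1 h2
    have h3 := hat (1 - x) (one_sub_mem_Ioo h1)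
    rw [sub_sub_cancel] at h3
    refine propext ⟨fun h => lt_of_le_of_ne ?_ h2, fun h => ?_⟩
    · by_contra hlt
      exact absurd (h3.1 (by linarith)) (not_lt.2 h)
    · by_contra hlt
      have h4 := h3.2 (not_le.1 hlt)
      have h5 : x < 1 - a := h
      linarith
  have h2 : cdf (μ.map X) t = 1 - winv w a := by
    have hm := Measure.isProbabilityMeasure_map hX
    have hv := hw.winv_mem ha
    have h3 : ENNReal.ofReal (cdf (μ.map X) t) = ENNReal.ofReal (1 - winv w a) := by
      rw [ofReal_cdf, ← hlaw, Measure.map_apply_of_aemeasurable (aemeasurable_comp_weighting hw hQ)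
        measurableSet_Iic, ← unif_Ici hv.1]
      refine measure_congr ?_
      filter_upwards [setOf_lt_weighting_ae_eq hw ha hat] with y hy
      have hy' : t < Q (1 - w y) ↔ y < winv w a := iff_of_eq hy
      exact propext (by
        change Q (1 - w y) ≤ t ↔ winv w a ≤ y
        rw [← not_lt, hy', not_lt])
    exact (ENNReal.ofReal_eq_ofReal_iff (cdf_nonneg _ _) (by linarith [hv.2])).1 h3
  rw [h1]
  change _ = ENNReal.ofReal (1 - w (1 - cdf (μ.map X) t))
  rw [h2, sub_sub_cancel, hw.apply_winv ha]

theorem rdu_eq (hw : IsWeighting w) (hu : IsUtility u) (hX : AEMeasurable X μ)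
    (h0 : ∀ᵐ ω ∂μ, 0 ≤ X ω) (hQ : MonotoneOn Q (Ioo 0 1)) (hQ0 : ∀ x ∈ Ioo (0 : ℝ) 1, 0 ≤ Q x)
    (hlaw : unif.map (fun y => Q (1 - w y)) = μ.map X) :
    rdu μ u hw X = quantileUtility u Q := by
  have hQm := aemeasurable_of_monotoneOn hQ
  rw [rdu, distortedCDF_measure_eq hw hX h0 hQ hlaw, Measure.restrict_eq_self_of_ae_mem,
    extIntegral_map hQm hu.measurable_ext]
  · rfl
  · refine (ae_map_iff hQm measurableSet_Ici).2 ?_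
    filter_upwards [ae_mem_unif] with x hx using hQ0 x hx

theorem rdu_comp_uniform (hw : IsWeighting w) (hu : IsUtility u) (hV : μ.map V = unif)
    (hQ : MonotoneOn Q (Ioo 0 1)) (hQ0 : ∀ x ∈ Ioo (0 : ℝ) 1, 0 ≤ Q x) :
    rdu μ u hw (fun ω => Q (1 - w (V ω))) = quantileUtility u Q := by
  have hm := aemeasurable_comp_weighting hw hQ
  refine rdu_eq hw hu (aemeasurable_comp_uniform hV hm) ?_ hQ hQ0
    (map_comp_uniform (f := fun y => Q (1 - w y)) hV hm).symm
  filter_upwards [ae_mem_comp_weighting hw hV] with ω hω using hQ0 _ hω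

theorem isQuantileFunction_distortedQuantile (hw : IsWeighting w) (hX : AEMeasurable X μ)
    (h0 : ∀ᵐ ω ∂μ, 0 ≤ X ω) : IsQuantileFunction (distortedQuantile μ w X) where
  nonneg x hx := quantile_nonneg hX h0 (one_sub_mem_Ioo (hw.winv_mem_Ioo (one_sub_mem_Ioo hx)))
  monotoneOn x hx y hy hxy := by
    refine monotoneOn_quantile (one_sub_mem_Ioo (hw.winv_mem_Ioo (one_sub_mem_Ioo hx)))
      (one_sub_mem_Ioo (hw.winv_mem_Ioo (one_sub_mem_Ioo hy))) ?_
    have := hw.strictMonoOn_winv.monotoneOn (Ioo_subset_Icc_self (one_sub_mem_Ioo hy))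
      (Ioo_subset_Icc_self (one_sub_mem_Ioo hx)) (by linarith)
    linarith
  rightContinuous x hx := by
    have hx' := one_sub_mem_Ioo hx
    have h1 : ContinuousAt (fun x => 1 - winv w (1 - x)) x := by
      have h2 : ContinuousAt (winv w) (1 - x) :=
        hw.continuousOn_winv.continuousAt (Icc_mem_nhds hx'.1 hx'.2)
      exact continuousAt_const.sub (ContinuousAt.comp (f := fun x => 1 - x) h2 (by fun_prop))
    refine (rightContinuous_quantile (one_sub_mem_Ioo (hw.winv_mem_Ioo hx'))).tendsto.comp
      (tendsto_nhdsWithin_iff.2 ⟨h1.continuousWithinAt, ?_⟩)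
    filter_upwards [self_mem_nhdsWithin, mem_nhdsWithin_of_mem_nhds (Iio_mem_nhds hx.2)]
      with z hz hz1
    have hz' : z ∈ Ioo (0 : ℝ) 1 := ⟨hx.1.trans_le hz, hz1⟩
    have := hw.strictMonoOn_winv.monotoneOn (Ioo_subset_Icc_self (one_sub_mem_Ioo hz'))
      (Ioo_subset_Icc_self hx') (sub_le_sub_left hz 1)
    exact sub_le_sub_left this 1

theorem map_distortedQuantile (hw : IsWeighting w) (hX : AEMeasurable X μ) :
    unif.map (fun y => distortedQuantile μ w X (1 - w y)) = μ.map X := by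
  have hQm := aemeasurable_of_monotoneOn (monotoneOn_quantile (μ := μ) (X := X))
  rw [← map_quantile hX, ← map_comp_one_sub hQm]
  refine Measure.map_congr ?_
  filter_upwards [ae_mem_unif] with y hy using distortedQuantile_weighting hw hy

theorem rdu_eq_distortedQuantile (hw : IsWeighting w) (hu : IsUtility u) (hX : AEMeasurable X μ)
    (h0 : ∀ᵐ ω ∂μ, 0 ≤ X ω) :
    rdu μ u hw X = quantileUtility u (distortedQuantile μ w X) :=
  have h := isQuantileFunction_distortedQuantile hw hX h0
  rdu_eq hw hu hX h0 h.monotoneOn h.nonneg (map_distortedQuantile hw hX)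

/-- A payoff whose cost is within the budget can be topped up by a constant that exhausts it. -/
theorem exists_add_const_cost (hκ : ∀ᵐ ω ∂μ, 0 < κ ω) (hκm : AEMeasurable κ μ)
    (hκi : ∫⁻ ω, ENNReal.ofReal (κ ω) ∂μ ≠ ⊤) (h0 : ∀ᵐ ω ∂μ, 0 ≤ X ω)
    (h : ∫⁻ ω, ENNReal.ofReal (κ ω) * ENNReal.ofReal (X ω) ∂μ ≤ ENNReal.ofReal x₀) :
    ∃ c : ℝ, 0 ≤ c ∧
      ∫⁻ ω, ENNReal.ofReal (κ ω) * ENNReal.ofReal (X ω + c) ∂μ = ENNReal.ofReal x₀ ∧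
      (∫⁻ ω, ENNReal.ofReal (κ ω) * ENNReal.ofReal (X ω) ∂μ ≠ ENNReal.ofReal x₀ → 0 < c) := by
  set C := ∫⁻ ω, ENNReal.ofReal (κ ω) * ENNReal.ofReal (X ω) ∂μ with hC
  set K := ∫⁻ ω, ENNReal.ofReal (κ ω) ∂μ with hK
  have hK0 : K ≠ 0 := by
    intro hz
    rw [hK, lintegral_eq_zero_iff' hκm.ennreal_ofReal] at hz
    obtain ⟨ω, h1, h2⟩ := (hz.and hκ).exists
    exact absurd h2 (not_lt.2 (ENNReal.ofReal_eq_zero.1 h1))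
  -- The constant is the unspent budget divided by the total mass of the kernel, the price of one
  -- unit paid for sure.
  have hfin : (ENNReal.ofReal x₀ - C) / K ≠ ⊤ :=
    ENNReal.div_ne_top (ENNReal.sub_ne_top ENNReal.ofReal_ne_top) hK0
  refine ⟨((ENNReal.ofReal x₀ - C) / K).toReal, ENNReal.toReal_nonneg, ?_, fun hne => ?_⟩
  · rw [lintegral_congr_ae (g := fun ω => ENNReal.ofReal (κ ω) * ENNReal.ofReal (X ω) +
        ENNReal.ofReal (κ ω) * ((ENNReal.ofReal x₀ - C) / K)),
      lintegral_add_right' _ (hκm.ennreal_ofReal.mul_const _),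
      lintegral_mul_const' _ _ hfin, ← hC, ← hK, ENNReal.mul_div_cancel hK0 hκi,
      add_tsub_cancel_of_le h]
    filter_upwards [h0] with ω hω
    rw [ENNReal.ofReal_add hω ENNReal.toReal_nonneg, ENNReal.ofReal_toReal hfin, mul_add]
  · refine ENNReal.toReal_pos ?_ hfin
    rw [ne_eq, ENNReal.div_eq_zero_iff, not_or]
    exact ⟨(tsub_pos_of_lt (lt_of_le_of_ne h hne)).ne', hκi⟩

theorem phiCost_eq_lintegral (hρ : IsKernel μ ρ) (hw : IsWeighting w)
    (hQ : MonotoneOn Q (Ioo 0 1)) : phiCost μ ρ w Q =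
      ∫⁻ ω, ENNReal.ofReal (ρ ω) * ENNReal.ofReal (Q (1 - w (cdf (μ.map ρ) (ρ ω)))) ∂μ := by
  rw [phiCost, lintegral_mul_quantile (Q := fun y => Q (1 - w y))
    (map_cdf_eq_unif hρ.aemeasurable hρ.continuous_cdf) monotoneOn_quantile
    (aemeasurable_comp_weighting hw hQ)]
  refine lintegral_congr_ae ?_
  filter_upwards [ae_eq_quantile_cdf hρ.aemeasurable hρ.continuous_cdf] with ω hω
  rw [← hω]

theorem deltaCost_eq_lintegral (hρ : IsKernel μ ρ) (hw : IsWeighting w) (hV : μ.map V = unif)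
    (hκ : κ =ᵐ[μ] fun ω => deltaDeriv μ ρ w (1 - V ω)) (hQ : MonotoneOn Q (Ioo 0 1)) :
    deltaCost μ ρ w Q = ∫⁻ ω, ENNReal.ofReal (κ ω) * ENNReal.ofReal (Q (1 - V ω)) ∂μ := by
  rw [deltaCost, lintegral_mul_quantile (Q := fun y => Q (1 - y))
    (H := fun y => deltaDeriv μ ρ w (1 - y)) hV (monotoneOn_deltaDeriv hρ hw)
    (aemeasurable_comp_one_sub (aemeasurable_of_monotoneOn hQ))]
  refine lintegral_congr_ae ?_
  filter_upwards [hκ] with ω hω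
  rw [← hω]

/-- The distortion cancels in the budget, which becomes the cost of the arrangement antimonotone to
`ρ`; Hardy-Littlewood compares it with the cost of `X`. -/
theorem phiCost_distortedQuantile_le (hρ : IsKernel μ ρ) (hw : IsWeighting w)
    (hX : AEMeasurable X μ) (h0 : ∀ᵐ ω ∂μ, 0 ≤ X ω) :
    phiCost μ ρ w (distortedQuantile μ w X) =
        ∫⁻ y, ENNReal.ofReal (quantile μ ρ y) * ENNReal.ofReal (quantile μ X (1 - y)) ∂unif ∧
      phiCost μ ρ w (distortedQuantile μ w X) ≤
        ∫⁻ ω, ENNReal.ofReal (ρ ω) * ENNReal.ofReal (X ω) ∂μ := by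
  have he : phiCost μ ρ w (distortedQuantile μ w X) =
      ∫⁻ y, ENNReal.ofReal (quantile μ ρ y) * ENNReal.ofReal (quantile μ X (1 - y)) ∂unif := by
    refine lintegral_congr_ae ?_
    filter_upwards [ae_mem_unif] with y hy
    rw [distortedQuantile_weighting hw hy]
  refine ⟨he, he.trans_le ((lintegral_mul_quantile_le
    (map_cdf_eq_unif hρ.aemeasurable hρ.continuous_cdf) monotoneOn_quantile hX h0).trans_eq ?_)⟩
  refine lintegral_congr_ae ?_
  filter_upwards [ae_eq_quantile_cdf hρ.aemeasurable hρ.continuous_cdf] with ω hω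
  rw [← hω]

theorem aemeasurable_newKernel (hρ : IsKernel μ ρ) (hw : IsWeighting w) :
    AEMeasurable (newKernel μ ρ w) μ :=
  aemeasurable_comp_uniform (f := fun y => deltaDeriv μ ρ w (1 - y))
    (map_cdf_eq_unif hρ.aemeasurable hρ.continuous_cdf)
    (aemeasurable_of_monotoneOn (monotoneOn_deltaDeriv hρ hw))

theorem newKernel_pos (hρ : IsKernel μ ρ) (hw : IsWeighting w) :
    ∀ᵐ ω ∂μ, 0 < newKernel μ ρ w ω := by
  filter_upwards [ae_mem_of_map_eq_unif (map_cdf_eq_unif hρ.aemeasurable hρ.continuous_cdf)]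
    with ω hω using deltaDeriv_pos hρ hw hω

theorem comonotonic_newKernel (hρ : IsKernel μ ρ) (hw : IsWeighting w) :
    Comonotonic μ ρ (newKernel μ ρ w) := by
  have hV := ae_mem_of_map_eq_unif (map_cdf_eq_unif hρ.aemeasurable hρ.continuous_cdf)
  filter_upwards [Measure.quasiMeasurePreserving_fst.ae hV,
    Measure.quasiMeasurePreserving_snd.ae hV] with p h1 h2
  rcases le_total (ρ p.1) (ρ p.2) with h | h
  · exact mul_nonneg (sub_nonneg.2 h)
      (sub_nonneg.2 (monotoneOn_deltaDeriv hρ hw h1 h2 (monotone_cdf _ h)))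
  · exact mul_nonneg_of_nonpos_of_nonpos (sub_nonpos.2 h)
      (sub_nonpos.2 (monotoneOn_deltaDeriv hρ hw h2 h1 (monotone_cdf _ h)))

theorem quantile_newKernel (hρ : IsKernel μ ρ) (hw : IsWeighting w) {x : ℝ}
    (hx : x ∈ Ioo (0 : ℝ) 1) :
    quantile μ (newKernel μ ρ w) x = deltaDeriv μ ρ w (1 - x) :=
  quantile_comp_uniform (H := fun y => deltaDeriv μ ρ w (1 - y))
    (map_cdf_eq_unif hρ.aemeasurable hρ.continuous_cdf) (monotoneOn_deltaDeriv hρ hw) hx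
    (rightContinuous_deltaDeriv hρ hw hx)

theorem newKernel_ae_eq_of_comonotonic (hρ : IsKernel μ ρ) (hw : IsWeighting w)
    (hV : μ.map V = unif) (hco : Comonotonic μ V (newKernel μ ρ w)) :
    newKernel μ ρ w =ᵐ[μ] fun ω => deltaDeriv μ ρ w (1 - V ω) := by
  filter_upwards [ae_eq_quantile_of_comonotonic hV (aemeasurable_newKernel hρ hw) hco,
    ae_mem_of_map_eq_unif hV] with ω h1 h2
  rw [h1, quantile_newKernel hρ hw h2]

/-- The total mass of the new kernel is the integral of `δ'` over `(0,1)`, and `δ` is continuous up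
to the endpoints. -/
theorem lintegral_newKernel_ne_top (hρ : IsKernel μ ρ) (hw : IsWeighting w) :
    ∫⁻ ω, ENNReal.ofReal (newKernel μ ρ w ω) ∂μ ≠ ⊤ := by
  have hi := (integral_deltaDeriv hρ hw (z := 1) ⟨zero_le_one, le_rfl⟩).1
  rw [intervalIntegrable_iff_integrableOn_Ioo_of_le zero_le_one] at hi
  have h := lintegral_comp_uniform (f := fun y => ENNReal.ofReal (deltaDeriv μ ρ w (1 - y)))
    (map_cdf_eq_unif hρ.aemeasurable hρ.continuous_cdf)
    (aemeasurable_of_monotoneOn (monotoneOn_deltaDeriv hρ hw)).ennreal_ofReal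
  exact ne_of_eq_of_ne h hi.lintegral_lt_top.ne

theorem deltaCost_quantile_le (hρ : IsKernel μ ρ) (hw : IsWeighting w) (hX : AEMeasurable X μ)
    (h0 : ∀ᵐ ω ∂μ, 0 ≤ X ω) :
    deltaCost μ ρ w (quantile μ X) ≤
      ∫⁻ ω, ENNReal.ofReal (newKernel μ ρ w ω) * ENNReal.ofReal (X ω) ∂μ :=
  lintegral_mul_quantile_le (H := fun y => deltaDeriv μ ρ w (1 - y))
    (map_cdf_eq_unif hρ.aemeasurable hρ.continuous_cdf) (monotoneOn_deltaDeriv hρ hw) hX h0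

end Problems

/-! ### Transfer of optimal solutions between the two problems. -/

section Optimality

open Filter Topology

variable {Ω : Type*} [MeasurableSpace Ω] {μ : Measure Ω}
  {ρ κ X V : Ω → ℝ} {w u Q R : ℝ → ℝ} {x₀ : ℝ}

theorem exists_mem_Ioo_of_ae_unif {p : ℝ → Prop} (hp : ∀ᵐ x ∂unif, p x) {a b : ℝ} (ha : 0 ≤ a)
    (hb : b ≤ 1) (hab : a < b) : ∃ x ∈ Ioo a b, p x := by
  by_contra! hcon
  have h1 : unif (Ioo a b) = 0 := measure_mono_null hcon hp
  rw [unif, Measure.restrict_apply measurableSet_Ioo,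
    inter_eq_self_of_subset_left (Ioo_subset_Ioo ha hb), Real.volume_Ioo,
    ENNReal.ofReal_eq_zero] at h1
  linarith

/-- A monotone function is squeezed between its values at nearby points where it agrees with `R`, so
almost-everywhere constancy on an open interval becomes constancy. -/
theorem const_of_ae_eq (hQ : MonotoneOn Q (Ioo 0 1)) (hQR : Q =ᵐ[unif] R) {l r : ℝ} (h0 : 0 ≤ l)
    (h1 : r ≤ 1) (hR : ∀ x ∈ Ioo l r, ∀ y ∈ Ioo l r, R x = R y) :
    ∀ x ∈ Ioo l r, ∀ y ∈ Ioo l r, Q x = Q y := by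
  have hsub : ∀ x ∈ Ioo l r, x ∈ Ioo (0 : ℝ) 1 := fun x hx => ⟨h0.trans_lt hx.1, hx.2.trans_le h1⟩
  have key : ∀ x ∈ Ioo l r, ∀ y ∈ Ioo l r, Q y ≤ Q x := by
    intro x hx y hy
    obtain ⟨a, ha, hae⟩ := exists_mem_Ioo_of_ae_unif hQR h0 (hsub x hx).2.le hx.1
    obtain ⟨b, hb, hbe⟩ := exists_mem_Ioo_of_ae_unif hQR (hsub y hy).1.le h1 hy.2
    have ha' : a ∈ Ioo l r := ⟨ha.1, ha.2.trans hx.2⟩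
    have hb' : b ∈ Ioo l r := ⟨hy.1.trans hb.1, hb.2⟩
    calc Q y ≤ Q b := hQ (hsub y hy) (hsub b hb') hb.1.le
      _ = Q a := by rw [hae, hbe, hR b hb' a ha']
      _ ≤ Q x := hQ (hsub a ha') (hsub x hx) ha.2.le
  exact fun x hx y hy => le_antisymm (key y hy x hx) (key x hx y hy)

theorem eqOn_of_ae_eq_comp_weighting (hw : IsWeighting w) (hV : μ.map V = unif)
    (hQ : IsQuantileFunction Q) (hR : IsQuantileFunction R)
    (h : (fun ω => Q (1 - w (V ω))) =ᵐ[μ] fun ω => R (1 - w (V ω))) : EqOn Q R (Ioo 0 1) := by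
  intro x hx
  -- If `Q` and `R` differed throughout some `(x, c)`, they would differ whenever `V` lies between
  -- `w⁻¹(1 - c)` and `w⁻¹(1 - x)`, an event of positive probability.
  have hfreq : ∃ᶠ z in 𝓝[>] x, Q z = R z := by
    refine frequently_iff.2 fun {s} hs => ?_
    obtain ⟨b, hxb, hbs⟩ := (mem_nhdsGT_iff_exists_Ioo_subset' hx.2).1 hs
    obtain ⟨c, hxc, hcb⟩ := exists_between (lt_min (show x < b from hxb) hx.2)
    have hc : c ∈ Ioo (0 : ℝ) 1 := ⟨hx.1.trans hxc, hcb.trans_le (min_le_right _ _)⟩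
    have hlt := hw.strictMonoOn_winv (Ioo_subset_Icc_self (one_sub_mem_Ioo hc))
      (Ioo_subset_Icc_self (one_sub_mem_Ioo hx)) (by linarith)
    have hvx := hw.winv_mem_Ioo (one_sub_mem_Ioo hx)
    have hvc := hw.winv_mem_Ioo (one_sub_mem_Ioo hc)
    by_contra! hcon
    have h1 : μ (V ⁻¹' Ioo (winv w (1 - c)) (winv w (1 - x))) = 0 := by
      refine measure_mono_null (fun ω hω => ?_) h
      have hVω : V ω ∈ Icc (0 : ℝ) 1 := ⟨(hvc.1.trans hω.1).le, (hω.2.trans hvx.2).le⟩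
      have h2 := (hw.lt_winv_iff hVω (Ioo_subset_Icc_self (one_sub_mem_Ioo hx))).1 hω.2
      have h3 := hw.strictMonoOn (hw.winv_mem (Ioo_subset_Icc_self (one_sub_mem_Ioo hc))) hVω hω.1
      rw [hw.apply_winv (Ioo_subset_Icc_self (one_sub_mem_Ioo hc))] at h3
      exact hcon _ (hbs ⟨by linarith, lt_of_lt_of_le (b := c) (by linarith)
        (hcb.le.trans (min_le_left _ _))⟩)
    rw [← Measure.map_apply_of_aemeasurable (aemeasurable_of_map_eq_unif hV) measurableSet_Ioo, hV,
      unif, Measure.restrict_apply measurableSet_Ioo,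
      inter_eq_self_of_subset_left (Ioo_subset_Ioo hvc.1.le hvx.2.le), Real.volume_Ioo,
      ENNReal.ofReal_eq_zero] at h1
    linarith
  exact tendsto_nhds_unique_of_frequently_eq
    ((hQ.rightContinuous x hx).mono_left (nhdsWithin_mono _ Ioi_subset_Ici_self))
    ((hR.rightContinuous x hx).mono_left (nhdsWithin_mono _ Ioi_subset_Ici_self)) hfreq

theorem map_eq_unif_of_isUniform {U : Ω → ℝ} (hU : pdf.IsUniform U (Ioo (0 : ℝ) 1) μ volume) :
    μ.map U = unif := by
  rw [hU, ProbabilityTheory.cond, Real.volume_Ioo]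
  simp [unif]

/-- A quantile within the budget is topped up by a constant, whatever the uniform variable that
realises it. -/
theorem exists_feasible_add_const [IsProbabilityMeasure μ] {Z : Ω → ℝ} (hκ : ∀ᵐ ω ∂μ, 0 < κ ω) (hκm : AEMeasurable κ μ)
    (hκi : ∫⁻ ω, ENNReal.ofReal (κ ω) ∂μ ≠ ⊤) (hx₀ : 0 ≤ x₀) (hZ : ∀ᵐ ω ∂μ, Z ω ∈ Ioo (0 : ℝ) 1)
    (hm : AEMeasurable (fun ω => Q (Z ω)) μ) (hQ0 : ∀ x ∈ Ioo (0 : ℝ) 1, 0 ≤ Q x)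
    (h : ∫⁻ ω, ENNReal.ofReal (κ ω) * ENNReal.ofReal (Q (Z ω)) ∂μ ≤ ENNReal.ofReal x₀) :
    ∃ c : ℝ, 0 ≤ c ∧ IsFeasible μ κ x₀ (fun ω => Q (Z ω) + c) ∧
      (∫⁻ ω, ENNReal.ofReal (κ ω) * ENNReal.ofReal (Q (Z ω)) ∂μ ≠ ENNReal.ofReal x₀ → 0 < c) := by
  have h0 : ∀ᵐ ω ∂μ, 0 ≤ Q (Z ω) := hZ.mono fun ω hω => hQ0 _ hω
  obtain ⟨c, hc, hcost, hpos⟩ := exists_add_const_cost hκ hκm hκi h0 h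
  refine ⟨c, hc, isFeasible_of_lintegral hκ hκm (hm.add_const c) ?_ hx₀ hcost, hpos⟩
  exact h0.mono fun ω hω => add_nonneg hω hc

/-- If no feasible payoff has utility above `M`, then no quantile within the budget has, and one
that attains a finite `M` exhausts the budget. -/
theorem quantileUtility_le_of_forall_feasible [IsProbabilityMeasure μ] {Z : Ω → ℝ}
    {J : (Ω → ℝ) → EReal} {M : EReal} (hu : IsUtility u)
    (hκ : ∀ᵐ ω ∂μ, 0 < κ ω) (hκm : AEMeasurable κ μ)
    (hκi : ∫⁻ ω, ENNReal.ofReal (κ ω) ∂μ ≠ ⊤) (hx₀ : 0 ≤ x₀) (hZ : ∀ᵐ ω ∂μ, Z ω ∈ Ioo (0 : ℝ) 1)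
    (hm : ∀ Q : ℝ → ℝ, MonotoneOn Q (Ioo 0 1) → AEMeasurable (fun ω => Q (Z ω)) μ)
    (hJ : ∀ Q : ℝ → ℝ, MonotoneOn Q (Ioo 0 1) → (∀ x ∈ Ioo (0 : ℝ) 1, 0 ≤ Q x) →
      J (fun ω => Q (Z ω)) = quantileUtility u Q)
    (hmax : ∀ Y, IsFeasible μ κ x₀ Y → J Y ≤ M)
    (hQ : MonotoneOn Q (Ioo 0 1)) (hQ0 : ∀ x ∈ Ioo (0 : ℝ) 1, 0 ≤ Q x)
    (h : ∫⁻ ω, ENNReal.ofReal (κ ω) * ENNReal.ofReal (Q (Z ω)) ∂μ ≤ ENNReal.ofReal x₀) :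
    quantileUtility u Q ≤ M ∧ (quantileUtility u Q = M → M ≠ ⊥ → M ≠ ⊤ →
      ∫⁻ ω, ENNReal.ofReal (κ ω) * ENNReal.ofReal (Q (Z ω)) ∂μ = ENNReal.ofReal x₀) := by
  obtain ⟨c, hc, hfeas, hpos⟩ := exists_feasible_add_const hκ hκm hκi hx₀ hZ (hm Q hQ) hQ0 h
  have hQc : MonotoneOn (fun x => Q x + c) (Ioo 0 1) := fun x hx y hy hxy =>
    add_le_add (hQ hx hy hxy) le_rfl
  have hle := hmax _ hfeas
  rw [hJ (fun x => Q x + c) hQc fun x hx => add_nonneg (hQ0 x hx) hc] at hle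
  refine ⟨(extIntegral_mono (.of_forall fun x => hu.monotone_ext (by linarith))).trans hle,
    fun he hb ht => ?_⟩
  by_contra hne
  have hlt := quantileUtility_add_const_lt hu hQ hQ0 (he ▸ hb) (he ▸ ht) (hpos hne)
  exact absurd (hlt.trans_le hle) (by rw [he]; exact lt_irrefl _)

variable [IsProbabilityMeasure μ]

theorem deltaCost_midpoint_le (hρ : IsKernel μ ρ) (hw : IsWeighting w)
    (hQ : MonotoneOn Q (Ioo 0 1)) (hQ0 : ∀ x ∈ Ioo (0 : ℝ) 1, 0 ≤ Q x)
    (hR0 : ∀ x ∈ Ioo (0 : ℝ) 1, 0 ≤ R x) {b : ENNReal}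
    (h1 : deltaCost μ ρ w Q ≤ b) (h2 : deltaCost μ ρ w R ≤ b) :
    deltaCost μ ρ w (fun x => (Q x + R x) / 2) ≤ b := by
  have hk := (aemeasurable_of_monotoneOn (monotoneOn_deltaDeriv hρ hw)).ennreal_ofReal
  have hQm := (aemeasurable_comp_one_sub (aemeasurable_of_monotoneOn hQ)).ennreal_ofReal
  have hkQ : AEMeasurable (fun y => ENNReal.ofReal (deltaDeriv μ ρ w (1 - y)) *
      ENNReal.ofReal (Q (1 - y))) unif := hk.mul hQm
  have he : deltaCost μ ρ w (fun x => (Q x + R x) / 2) =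
      (deltaCost μ ρ w Q + deltaCost μ ρ w R) * 2⁻¹ := by
    rw [deltaCost, deltaCost, deltaCost, ← lintegral_add_left' hkQ,
      ← lintegral_mul_const' _ _ (by simp)]
    refine lintegral_congr_ae ?_
    filter_upwards [ae_mem_unif] with y hy
    rw [div_eq_mul_inv, ENNReal.ofReal_mul' (by norm_num),
      ENNReal.ofReal_add (hQ0 _ (one_sub_mem_Ioo hy)) (hR0 _ (one_sub_mem_Ioo hy)),
      ENNReal.ofReal_inv_of_pos two_pos, ENNReal.ofReal_ofNat]
    ring
  rw [he]
  calc _ ≤ (b + b) * 2⁻¹ := by gcongr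
    _ = b := by rw [← div_eq_mul_inv, ENNReal.add_div, ENNReal.add_halves]

theorem isOptimal_rdu_of_isOptimal_expectedUtility (hρ : IsKernel μ ρ) (hw : IsWeighting w)
    (hu : IsUtility u)
    (hX : IsOptimal μ (newKernel μ ρ w) x₀ (expectedUtility μ u) X) :
    IsOptimal μ ρ x₀ (rdu μ u hw) fun ω => quantile μ X (1 - w (cdf (μ.map ρ) (ρ ω))) := by
  have hV := map_cdf_eq_unif hρ.aemeasurable hρ.continuous_cdf
  have hκ := newKernel_pos hρ hw
  have hκm := aemeasurable_newKernel hρ hw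
  have hx₀ := hX.feasible.budget_nonneg hκ
  set Q := quantile μ X with hQdef
  have hQ : MonotoneOn Q (Ioo 0 1) := monotoneOn_quantile
  have hQ0 : ∀ x ∈ Ioo (0 : ℝ) 1, 0 ≤ Q x := fun x hx =>
    quantile_nonneg hX.feasible.aemeasurable hX.feasible.nonneg hx
  have hM : quantileUtility u Q = expectedUtility μ u X :=
    (expectedUtility_eq hu hX.feasible.aemeasurable).symm
  have hb := hX.ne_bot
  have ht := hX.ne_top
  have hcost : deltaCost μ ρ w Q ≤ ENNReal.ofReal x₀ :=
    (deltaCost_quantile_le hρ hw hX.feasible.aemeasurable hX.feasible.nonneg).trans_eq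
      (hX.feasible.lintegral_eq hκ)
  have hmax : ∀ R : ℝ → ℝ, MonotoneOn R (Ioo 0 1) → (∀ x ∈ Ioo (0 : ℝ) 1, 0 ≤ R x) →
      deltaCost μ ρ w R ≤ ENNReal.ofReal x₀ →
      quantileUtility u R ≤ expectedUtility μ u X ∧
        (quantileUtility u R = expectedUtility μ u X → deltaCost μ ρ w R = ENNReal.ofReal x₀) := by
    intro R hR hR0 hRc
    have hcd := deltaCost_eq_lintegral hρ hw hV (κ := newKernel μ ρ w) ae_eq_rfl hR
    rw [hcd] at hRc ⊢
    have h := quantileUtility_le_of_forall_feasible (J := expectedUtility μ u) hu hκ hκm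
      (lintegral_newKernel_ne_top hρ hw) hx₀
      ((ae_mem_of_map_eq_unif hV).mono fun ω hω => one_sub_mem_Ioo hω)
      (fun Q hQ => aemeasurable_comp_uniform (f := fun y => Q (1 - y)) hV
        (aemeasurable_comp_one_sub (aemeasurable_of_monotoneOn hQ)))
      (fun Q hQ _ => expectedUtility_comp_uniform hu hV hQ) hX.le hR hR0 hRc
    exact ⟨h.1, fun he => h.2 he hb ht⟩
  have hcost' := (hmax Q hQ hQ0 hcost).2 hM
  obtain ⟨R, hR, hR0, hRconst, hRc, hRu⟩ := exists_leveled hρ hw hu hQ hQ0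
    (ne_top_of_le_ne_top ENNReal.ofReal_ne_top hcost)
  have hRM := le_antisymm ((hmax R hR hR0 (hRc.trans hcost)).1.trans hM.ge) hRu
  -- The optimal quantile and its average over levels have the same utility, and their mean is again
  -- within the budget, so optimality and strict concavity make them equal almost everywhere.
  have hmid := (hmax (fun x => (Q x + R x) / 2)
    (fun x hx y hy hxy => by
      have := hQ hx hy hxy; have := hR hx hy hxy
      dsimp only; linarith)
    (fun x hx => by have := hQ0 x hx; have := hR0 x hx; positivity)
    (deltaCost_midpoint_le hρ hw hQ hQ0 hR0 hcost (hRc.trans hcost))).1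
  have hQR := ae_eq_of_quantileUtility_midpoint hu hQ hQ0 hR hR0 (hM ▸ hb) (hM ▸ ht) hRM
    (hmid.trans hM.ge)
  have hphi : phiCost μ ρ w Q = ENNReal.ofReal x₀ := by
    rw [phiCost_eq_deltaCost hρ hw hQ hQ0 fun l r h0 h1 h =>
      const_of_ae_eq hQ hQR h0 h1 (hRconst l r h0 h1 h), hcost']
  have hrdu := (rdu_comp_uniform hw hu hV hQ hQ0).trans hM
  refine ⟨?_, hrdu ▸ hb, hrdu ▸ ht, fun Y hY => ?_⟩
  · refine isFeasible_of_lintegral hρ.pos hρ.aemeasurable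
      (aemeasurable_comp_uniform (f := fun y => Q (1 - w y)) hV (aemeasurable_comp_weighting hw hQ))
      ((ae_mem_comp_weighting hw hV).mono fun ω hω => hQ0 _ hω) hx₀ ?_
    rw [← phiCost_eq_lintegral hρ hw hQ, hphi]
  -- Every rank-dependent competitor is also within the expected-utility budget, because `deltaCost
  -- ≤ phiCost`; the known optimum therefore dominates it.
  · have hq := isQuantileFunction_distortedQuantile hw hY.aemeasurable hY.nonneg
    rw [hrdu, rdu_eq_distortedQuantile hw hu hY.aemeasurable hY.nonneg]
    refine (hmax _ hq.monotoneOn hq.nonneg ?_).1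
    exact ((deltaCost_le_phiCost hρ hw hq.monotoneOn hq.nonneg).trans
      (phiCost_distortedQuantile_le hρ hw hY.aemeasurable hY.nonneg).2).trans_eq
        (hY.lintegral_eq hρ.pos)

theorem isOptimal_expectedUtility_of_isOptimal_rdu (hρ : IsKernel μ ρ) (hw : IsWeighting w)
    (hu : IsUtility u) (hX : IsOptimal μ ρ x₀ (rdu μ u hw) X) :
    (X =ᵐ[μ] fun ω => distortedQuantile μ w X (1 - w (cdf (μ.map ρ) (ρ ω)))) ∧
      ∀ U : Ω → ℝ, μ.map U = unif → Comonotonic μ U (newKernel μ ρ w) →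
        IsOptimal μ (newKernel μ ρ w) x₀ (expectedUtility μ u)
          (fun ω => distortedQuantile μ w X (1 - U ω)) := by
  have hV := map_cdf_eq_unif hρ.aemeasurable hρ.continuous_cdf
  have hκ := newKernel_pos hρ hw
  have hκm := aemeasurable_newKernel hρ hw
  have hx₀ := hX.feasible.budget_nonneg hρ.pos
  have hXm := hX.feasible.aemeasurable
  have hX0 := hX.feasible.nonneg
  obtain ⟨hQ0, hQ, -⟩ := isQuantileFunction_distortedQuantile hw hXm hX0
  have hM := rdu_eq_distortedQuantile hw hu hXm hX0
  obtain ⟨hphi, hphile⟩ := phiCost_distortedQuantile_le hρ hw hXm hX0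
  set Q := distortedQuantile μ w X
  have hb := hX.ne_bot
  have ht := hX.ne_top
  rw [hX.feasible.lintegral_eq hρ.pos] at hphile
  have hmax : ∀ R : ℝ → ℝ, MonotoneOn R (Ioo 0 1) → (∀ x ∈ Ioo (0 : ℝ) 1, 0 ≤ R x) →
      phiCost μ ρ w R ≤ ENNReal.ofReal x₀ →
      quantileUtility u R ≤ rdu μ u hw X ∧
        (quantileUtility u R = rdu μ u hw X → phiCost μ ρ w R = ENNReal.ofReal x₀) := by
    intro R hR hR0 hRc
    rw [phiCost_eq_lintegral hρ hw hR] at hRc ⊢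
    have h := quantileUtility_le_of_forall_feasible (J := rdu μ u hw) hu hρ.pos hρ.aemeasurable
      hρ.integrable.lintegral_lt_top.ne hx₀ (ae_mem_comp_weighting hw hV)
      (fun Q hQ => aemeasurable_comp_uniform (f := fun y => Q (1 - w y)) hV
        (aemeasurable_comp_weighting hw hQ))
      (fun Q hQ hQ0 => rdu_comp_uniform hw hu hV hQ hQ0) hX.le hR hR0 hRc
    exact ⟨h.1, fun he => h.2 he hb ht⟩
  have hphieq := (hmax Q hQ hQ0 hphile).2 hM.symm
  -- Levelling turns the `δ`-budget of a competitor into a `φ`-budget without losing utility, so the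
  -- larger set of `δ`-affordable quantiles does no better.
  have hmaxδ : ∀ R : ℝ → ℝ, MonotoneOn R (Ioo 0 1) → (∀ x ∈ Ioo (0 : ℝ) 1, 0 ≤ R x) →
      deltaCost μ ρ w R ≤ ENNReal.ofReal x₀ → quantileUtility u R ≤ rdu μ u hw X := by
    intro R hR hR0 hRc
    obtain ⟨S, hS, hS0, hSconst, hSc, hSu⟩ := exists_leveled hρ hw hu hR hR0
      (ne_top_of_le_ne_top ENNReal.ofReal_ne_top hRc)
    refine hSu.trans (hmax S hS hS0 ?_).1
    rw [phiCost_eq_deltaCost hρ hw hS hS0 hSconst]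
    exact hSc.trans hRc
  have hδle : deltaCost μ ρ w Q ≤ ENNReal.ofReal x₀ :=
    (deltaCost_le_phiCost hρ hw hQ hQ0).trans hphile
  refine ⟨?_, fun U hU hco => ?_⟩
  · have hcost := hX.feasible.lintegral_eq hρ.pos
    have hcost' : ∫⁻ ω, ENNReal.ofReal (quantile μ ρ (cdf (μ.map ρ) (ρ ω))) *
        ENNReal.ofReal (X ω) ∂μ = ENNReal.ofReal x₀ := by
      rw [← hcost]
      refine lintegral_congr_ae ?_
      filter_upwards [ae_eq_quantile_cdf hρ.aemeasurable hρ.continuous_cdf] with ω hω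
      rw [← hω]
    -- The optimum exhausts its `φ`-budget, so `X` costs no more than its antimonotone
    -- rearrangement; this is the equality case of Hardy-Littlewood.
    have hae := ae_eq_of_lintegral_le_quantile hV (strictMonoOn_quantile hρ.continuous_cdf)
      (fun y hy => (hρ.quantile_pos hy).le) hXm hX0 (hcost' ▸ ENNReal.ofReal_ne_top)
      (by rw [hcost', ← hphi, hphieq])
    filter_upwards [hae, ae_mem_of_map_eq_unif hV] with ω h1 h2
    exact h1.trans (distortedQuantile_weighting hw h2).symm
  · have hκU := newKernel_ae_eq_of_comonotonic hρ hw hU hco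
    have hcd : ∀ R : ℝ → ℝ, MonotoneOn R (Ioo 0 1) → _ := fun R hR =>
      deltaCost_eq_lintegral hρ hw hU hκU (Q := R) hR
    have hle : ∀ Y, IsFeasible μ (newKernel μ ρ w) x₀ Y →
        expectedUtility μ u Y ≤ rdu μ u hw X := by
      intro Y hY
      rw [expectedUtility_eq hu hY.aemeasurable]
      exact hmaxδ _ monotoneOn_quantile (fun x hx => quantile_nonneg hY.aemeasurable hY.nonneg hx)
        ((deltaCost_quantile_le hρ hw hY.aemeasurable hY.nonneg).trans_eq (hY.lintegral_eq hκ))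
    have hZ : ∀ᵐ ω ∂μ, 1 - U ω ∈ Ioo (0 : ℝ) 1 :=
      (ae_mem_of_map_eq_unif hU).mono fun ω hω => one_sub_mem_Ioo hω
    have hm : ∀ Q : ℝ → ℝ, MonotoneOn Q (Ioo 0 1) → AEMeasurable (fun ω => Q (1 - U ω)) μ :=
      fun Q hQ => aemeasurable_comp_uniform (f := fun y => Q (1 - y)) hU
        (aemeasurable_comp_one_sub (aemeasurable_of_monotoneOn hQ))
    -- So far the `δ`-cost is only known to be at most `x₀`. Since `Q` attains the finite maximal
    -- utility, slack is impossible and the budget constraint holds with equality.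
    have hcost := (quantileUtility_le_of_forall_feasible (J := expectedUtility μ u) hu hκ hκm
      (lintegral_newKernel_ne_top hρ hw) hx₀ hZ hm
      (fun Q hQ _ => expectedUtility_comp_uniform hu hU hQ) hle hQ hQ0
      (hcd Q hQ ▸ hδle)).2 hM.symm hb ht
    have heu := (expectedUtility_comp_uniform hu hU hQ).trans hM.symm
    exact ⟨isFeasible_of_lintegral hκ hκm (hm Q hQ) (hZ.mono fun ω hω => hQ0 _ hω) hx₀ hcost,
      heu ▸ hb, heu ▸ ht, fun Y hY => heu ▸ hle Y hY⟩

end Optimality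

end RDUT

theorem mainTheorem2 {Ω : Type*} [MeasurableSpace Ω] (μ : Measure Ω) [IsProbabilityMeasure μ]
    (ρ : Ω → ℝ) (hρ_pos : ∀ᵐ ω ∂μ, 0 < ρ ω) (hρ_int : Integrable ρ μ)
    (hρ_atomless : Continuous (cdf (μ.map ρ)))
    (w : ℝ → ℝ) (hw : RDUT.IsWeighting w) (u : ℝ → ℝ) (hu : RDUT.IsUtility u) (x₀ : ℝ) :
    -- the new kernel is a positive random variable, comonotonic with `ρ`,
    -- with quantile function `x ↦ δ'(1 - x)`
    (AEMeasurable (RDUT.newKernel μ ρ w) μ ∧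
      (∀ᵐ ω ∂μ, 0 < RDUT.newKernel μ ρ w ω) ∧
      RDUT.Comonotonic μ ρ (RDUT.newKernel μ ρ w) ∧
      (∀ x ∈ Ioo (0 : ℝ) 1,
        RDUT.quantile μ (RDUT.newKernel μ ρ w) x = RDUT.deltaDeriv μ ρ w (1 - x))) ∧
    -- from expected utility to rank-dependent utility
    (∀ X' : Ω → ℝ,
      RDUT.IsOptimal μ (RDUT.newKernel μ ρ w) x₀ (RDUT.expectedUtility μ u) X' →
      RDUT.IsOptimal μ ρ x₀ (RDUT.rdu μ u hw)
        (fun ω => RDUT.quantile μ X' (1 - w (cdf (μ.map ρ) (ρ ω))))) ∧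
    -- from rank-dependent utility to expected utility
    (∀ X : Ω → ℝ, RDUT.IsOptimal μ ρ x₀ (RDUT.rdu μ u hw) X →
      ∃ Q : ℝ → ℝ,
        (RDUT.IsQuantileFunction Q ∧
          X =ᵐ[μ] fun ω => Q (1 - w (cdf (μ.map ρ) (ρ ω)))) ∧
        (∀ Q' : ℝ → ℝ, RDUT.IsQuantileFunction Q' →
          (X =ᵐ[μ] fun ω => Q' (1 - w (cdf (μ.map ρ) (ρ ω)))) → EqOn Q' Q (Ioo 0 1)) ∧
        (∀ U : Ω → ℝ, pdf.IsUniform U (Ioo (0 : ℝ) 1) μ volume →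
          RDUT.Comonotonic μ U (RDUT.newKernel μ ρ w) →
          RDUT.IsOptimal μ (RDUT.newKernel μ ρ w) x₀ (RDUT.expectedUtility μ u)
            (fun ω => Q (1 - U ω)))) := by
  have hρ : RDUT.IsKernel μ ρ := ⟨hρ_pos, hρ_int, hρ_atomless⟩
  have hV := RDUT.map_cdf_eq_unif hρ.aemeasurable hρ.continuous_cdf
  refine ⟨⟨RDUT.aemeasurable_newKernel hρ hw, RDUT.newKernel_pos hρ hw,
    RDUT.comonotonic_newKernel hρ hw, fun x hx => RDUT.quantile_newKernel hρ hw hx⟩,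
    fun X' hX' => RDUT.isOptimal_rdu_of_isOptimal_expectedUtility hρ hw hu hX', fun X hX => ?_⟩
  obtain ⟨h1, h2⟩ := RDUT.isOptimal_expectedUtility_of_isOptimal_rdu hρ hw hu hX
  have hq := RDUT.isQuantileFunction_distortedQuantile hw hX.feasible.aemeasurable
    hX.feasible.nonneg
  exact ⟨RDUT.distortedQuantile μ w X, ⟨hq, h1⟩,
    fun Q' hQ' hX' => RDUT.eqOn_of_ae_eq_comp_weighting hw hV hQ' hq (hX'.symm.trans h1),
    fun U hU hco => h2 U (RDUT.map_eq_unif_of_isUniform hU) hco⟩
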